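/- A weak alternating automaton $\mathcal A=(\Sigma,Q,q_0,\delta,F)$ has a finite alphabet $\Sigma$, a finite set $Q$ of states, an initial state $q_0$, a set $F\subseteq Q$ of accepting states, and a function $\delta$ that maps $Q\times\Sigma$ to positive Boolean formulas over $Q$ in conjunctive normal form with at least one clause and no empty clause. There is a total preorder on $Q$ such that $q'\le q$ whenever $q'$ occurs in $\delta(q,x)$, and equivalent states are all in $F$ or all outside $F$. A word $w=w_0w_1\ldots\in\Sigma^\omega$ is in $L(\mathcal A)$ iff the rejector does not win the following game from $q_0$: in state $q$ at step $i$ the rejector picks a clause of $\delta(q,w_i)$ and the acceptor picks the next state in this clause; the acceptor wins a play iff from some point on it visits only states in $F$. $\mathcal A_q$ is $\mathcal A$ with initial state $q$. The obligation graph $\mathcal G$ of $\mathcal A$ is the nondeterministic Büchi automaton obtained by applying the Miyano–Hayashi breakpoint construction to the dual automaton $\bar{\mathcal A}=(\Sigma,Q,q_0,\bar\delta,Q\setminus F)$, where $\bar\delta(q,x)$ is the dual of the formula $\delta(q,x)$. Its vertices are pairs $(P,R)$ of disjoint subsets of $Q$; the initial vertex is $v_0=(\emptyset,\{q_0\})$;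 the $x$-successors of $(P,R)$ are the pairs $(X\cap F,\ S\setminus(X\cap F))$ such that $X\subseteq S\subseteq Q$, $S$ satisfies $\bar\delta(q,x)$ for all $q\in P\cup R$, and $X=S$ if $P=\emptyset$, while $X$ satisfies $\bar\delta(q,x)$ for all $q\in P$ if $P\ne\emptyset$; the accepting vertices are those with $P=\emptyset$. Write $v_0\stackrel{p}{\rightsquigarrow}v$ if some run of $\mathcal G$ from $v_0$ on $p\in\Sigma^*$ ends in $v$. For $p\in\Sigma^*$ let $L^{\mathit{suff}}(p)=\{w\in\Sigma^\omega\mid pw\in L(\mathcal A)\}$, and let $L^{\mathit{suff}}$ be the set of all these languages. A canonical suffix-language tracking machine (SLTM) for $\mathcal A$ is a deterministic Moore machine $(\Sigma,L^{\mathit{suff}},Q^S,q^S_0,\delta^S,\lambda)$ whose states are sets of vertices of $\mathcal G$, such that $\lambda(\delta^S(q_0^S,p))=L^{\mathit{suff}}(p)$ for every $p\in\Sigma^*$ and every $q^S\in Q^S$ satisfies $$q^S=\{v\mid \exists p\in\Sigma^*:\ L^{\mathit{suff}}(p)=\lambda(q^S)\ \text{and}\ v_0\stackrel{p}{\rightsquigarrow}v\}.$$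 Lemma. Let $n$ denote the number of states of $\mathcal A$. For weak alternating automata whose alphabet has at most $2^{O(n)}$ letters and whose formulas $\delta(q,x)$ have size at most $2^{O(n)}$, a canonical SLTM for $\mathcal A$ can be constructed in $2^{2^{O(n)}}$ time. Precisely: there is an algorithm such that for every constant $c$ there is a constant $C$ such that, on every weak alternating automaton $\mathcal A$ with $n$ states, at most $2^{cn}$ letters and formulas $\delta(q,x)$ with at most $2^{cn}$ literal occurrences each, the algorithm halts within $2^{2^{Cn}}$ steps and outputs a canonical SLTM for $\mathcal A$. The output lists each state once, as a set of vertices, and gives the initial state, the transition table and, for each state, its label as a positive Boolean formula in conjunctive normal form over the languages $L(\mathcal A_q)$, $q\in Q$. -/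

import Mathlib

/-! ### Weak alternating automata -/

/-- Positive Boolean formulas over `X` in conjunctive normal form, without `true` and `false`:
a non-empty conjunction (list) of non-empty disjunctions (lists) of elements of `X`. -/
structure PCNF (X : Type) where
  clauses : List (List X)
  clauses_ne : clauses ≠ []
  clause_ne : ∀ c ∈ clauses, c ≠ []

namespace PCNF

variable {X : Type}

/-- `q` appears in the formula. -/
def Appears (φ : PCNF X) (q : X) : Prop := ∃ c ∈ φ.clauses, q ∈ c

/-- The valuation making exactly the elements of `S` true satisfies the formula. -/
def SatBy (φ : PCNF X) (S : Finset X) : Prop := ∀ c ∈ φ.clauses, ∃ q ∈ c, q ∈ S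

/-- The number of literal occurrences. -/
def size (φ : PCNF X) : ℕ := (φ.clauses.map List.length).sum

/-- The dual formula (conjunctions and disjunctions exchanged), brought back into conjunctive
normal form: its clauses are all ways of picking one literal from every clause of `φ`. -/
def dual (φ : PCNF X) : PCNF X where
  clauses := φ.clauses.sections
  clauses_ne := by
    have key : ∀ l : List (List X), (∀ c ∈ l, c ≠ []) → ∃ f, f ∈ l.sections := by
      intro l
      induction l with
      | nil => intro _; exact ⟨[], by simp [List.sections]⟩
      | cons c l ih =>
        intro h
        obtain ⟨f, hf⟩ := ih (fun d hd => h d (List.mem_cons_of_mem _ hd))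
        obtain ⟨a, ha⟩ := List.exists_mem_of_ne_nil c (h c List.mem_cons_self)
        exact ⟨a :: f, List.mem_sections.2 (List.Forall₂.cons ha (List.mem_sections.1 hf))⟩
    obtain ⟨f, hf⟩ := key φ.clauses φ.clause_ne
    exact List.ne_nil_of_mem hf
  clause_ne := by
    intro c hc h0
    have h := (List.mem_sections.1 hc).length_eq
    subst h0
    exact φ.clauses_ne (List.length_eq_zero_iff.1 h.symm)

end PCNF

/-- An alternating automaton with alphabet `A` and states `Q`. -/
structure AltAut (A Q : Type) where
  init : Q
  δ : Q → A → PCNF Q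
  acc : Finset Q

/-- A position of a word-checking game: the states visited before the current one, the current
state, and the clauses picked so far. -/
structure GamePos (Q : Type) where
  past : List Q
  cur : Q
  picked : List (List Q)

namespace AltAut

variable {A Q : Type}

/-- Weakness: there is a total preorder on the states along which transitions never go up and
whose equivalence classes are entirely accepting or entirely rejecting. -/
def IsWeak (𝒜 : AltAut A Q) : Prop :=
  ∃ le : Q → Q → Prop,
    (∀ a b, le a b ∨ le b a) ∧ (∀ a b c, le a b → le b c → le a c) ∧
    (∀ q x q', (𝒜.δ q x).Appears q' → le q' q) ∧
    (∀ a b, le a b → le b a → (a ∈ 𝒜.acc ↔ b ∈ 𝒜.acc))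

/-- `𝒜` with initial state `q`. -/
def withInit (𝒜 : AltAut A Q) (q : Q) : AltAut A Q := { 𝒜 with init := q }

/-- A strategy of the rejector on `w`: given the non-empty list of states visited so far and the
current index `i`, it picks a clause of `δ (current state) (w i)`. -/
def IsRejStrategy (𝒜 : AltAut A Q) (w : Stream' A) (rej : List Q → ℕ → List Q) : Prop :=
  ∀ h q i, rej (h ++ [q]) i ∈ (𝒜.δ q (w.get i)).clauses

/-- A strategy of the acceptor: given the clauses picked so far and the current index, it picks a
state of the last clause. -/
def IsAccStrategy (acc : List (List Q) → ℕ → Q) : Prop :=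
  ∀ cs c i, c ≠ [] → acc (cs ++ [c]) i ∈ c

/-- The play from `q₀` that results from two strategies, with its history. -/
def gamePos (q₀ : Q) (rej : List Q → ℕ → List Q) (acc : List (List Q) → ℕ → Q) :
    ℕ → GamePos Q
  | 0 => ⟨[], q₀, []⟩
  | i + 1 =>
    let s := gamePos q₀ rej acc i
    let hist := s.past ++ [s.cur]
    let cs := s.picked ++ [rej hist i]
    ⟨hist, acc cs i, cs⟩

/-- The acceptor wins the play: eventually only accepting states are visited. -/
def PlayAccepted (𝒜 : AltAut A Q) (rej : List Q → ℕ → List Q)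
    (acc : List (List Q) → ℕ → Q) : Prop :=
  ∃ N, ∀ i, N ≤ i → (gamePos 𝒜.init rej acc i).cur ∈ 𝒜.acc

/-- The rejector wins the word-checking game on `w`. -/
def Rejects (𝒜 : AltAut A Q) (w : Stream' A) : Prop :=
  ∃ rej, 𝒜.IsRejStrategy w rej ∧ ∀ acc, IsAccStrategy acc → ¬ 𝒜.PlayAccepted rej acc

/-- The language: the words whose word-checking game is won by the acceptor. -/
def language (𝒜 : AltAut A Q) : Set (Stream' A) := {w | ¬ 𝒜.Rejects w}

/-- The dual (complement) automaton. -/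
def dual [Fintype Q] [DecidableEq Q] (𝒜 : AltAut A Q) : AltAut A Q where
  init := 𝒜.init
  δ q x := (𝒜.δ q x).dual
  acc := 𝒜.accᶜ

end AltAut

/-! ### Obligation graphs -/

/-- A nondeterministic Büchi word automaton. -/
structure NBW (A V : Type) where
  init : Set V
  trans : V → A → Set V
  acc : Set V

/-- The vertices in which a run from `v` can end after reading a finite word. -/
def NBW.reach {A V : Type} (G : NBW A V) (v : V) : List A → Set V
  | [] => {v}
  | x :: p => {u | ∃ v' ∈ G.trans v x, u ∈ G.reach v' p}

/-- Vertices `(P, R)` of the breakpoint construction: `P ∪ R` is the set of states that the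
copies of the alternating automaton are in; those in `P` still owe a visit to an accepting state
since the last breakpoint, those in `R` do not. -/
abbrev BPVertex (Q : Type) := Finset Q × Finset Q

/-- The Miyano–Hayashi breakpoint construction. A successor of `(P, R)` consists of a set `S`
satisfying the transition formulas of all states in `P ∪ R`, and of a subset `X ⊆ S` of states
that are to inherit the obligations of `P`; at a breakpoint (`P = ∅`) all of `S` gets a new
obligation. Obligations are dropped at accepting states. -/
def AltAut.miyanoHayashi {A Q : Type} [DecidableEq Q] (ℬ : AltAut A Q) :
    NBW A (BPVertex Q) where
  init := {(∅, {ℬ.init})}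
  trans v x := {v' | ∃ S X : Finset Q, X ⊆ S ∧
    (∀ q ∈ v.1 ∪ v.2, (ℬ.δ q x).SatBy S) ∧
    (v.1 = ∅ → X = S) ∧ (v.1 ≠ ∅ → ∀ q ∈ v.1, (ℬ.δ q x).SatBy X) ∧
    v' = (X \ ℬ.acc, S \ (X \ ℬ.acc))}
  acc := {v | v.1 = ∅}

/-- The obligation graph of `𝒜`: the Miyano–Hayashi construction applied to its dual. -/
def AltAut.obligationGraph {A Q : Type} [Fintype Q] [DecidableEq Q] (𝒜 : AltAut A Q) :
    NBW A (BPVertex Q) := 𝒜.dual.miyanoHayashi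

/-! ### Suffix-language tracking machines -/

/-- The suffix language of `L` after reading `p`. -/
def suffixLang {A : Type} (L : Set (Stream' A)) (p : List A) : Set (Stream' A) :=
  {w | p ++ₛ w ∈ L}

/-- A Moore machine. -/
structure Moore (A S O : Type) where
  init : S
  step : S → A → S
  out : S → O

/-- The state after reading a finite word. -/
def Moore.run {A S O : Type} (M : Moore A S O) (p : List A) : S := p.foldl M.step M.init

/-- `M` is a suffix-language tracking machine of `L`: its outputs are suffix languages of `L`, and
after reading `p` it outputs the suffix language of `L` after `p`. -/
def IsSLTM {A S : Type} (L : Set (Stream' A)) (M : Moore A S (Set (Stream' A))) : Prop :=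
  (∀ s, ∃ p, M.out s = suffixLang L p) ∧ ∀ p, M.out (M.run p) = suffixLang L p

/-- `M`, whose states are sets of vertices of the obligation graph of `𝒜`, is a canonical SLTM for
`𝒜`. -/
def IsCanonicalSLTM {A Q : Type} [Fintype Q] [DecidableEq Q] (𝒜 : AltAut A Q)
    {QS : Set (Set (BPVertex Q))} (M : Moore A QS (Set (Stream' A))) : Prop :=
  IsSLTM 𝒜.language M ∧
  ∀ s : QS, (s : Set (BPVertex Q)) =
    {v | ∃ p, suffixLang 𝒜.language p = M.out s ∧
      ∃ v₀ ∈ 𝒜.obligationGraph.init, v ∈ 𝒜.obligationGraph.reach v₀ p}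

/-! ### Machine model

Programs over binary trees, in the style of the WHILE language. The cost charges, at every
operation, the sizes of the values that are read, copied or built; a multi-tape Turing machine
simulates a program with polynomial overhead, and conversely. -/

/-- Data values: binary trees. -/
inductive Val where
  | leaf : Val
  | node : Val → Val → Val

namespace Val

/-- The number of nodes. -/
def size : Val → ℕ
  | leaf => 1
  | node a b => a.size + b.size + 1

/-- The left child; the left child of a leaf is a leaf. -/
def left : Val → Val
  | leaf => leaf
  | node a _ => a

/-- The right child; the right child of a leaf is a leaf. -/
def right : Val → Val
  | leaf => leaf
  | node _ b => b

end Val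

/-- Programs, each transforming one value into another. -/
inductive Prog where
  /-- return the input -/
  | skip : Prog
  /-- return a leaf -/
  | leaf : Prog
  /-- return the left child -/
  | left : Prog
  /-- return the right child -/
  | right : Prog
  /-- run both programs on the input and pair the results -/
  | pair : Prog → Prog → Prog
  /-- run the first program, then the second one on the result -/
  | seq : Prog → Prog → Prog
  /-- run the first program on the input; if the result is a node, run the second program on the
  input, and if it is a leaf, the third one -/
  | ite : Prog → Prog → Prog → Prog
  /-- as long as the first program yields a node, transform the value by the second one -/
  | loop : Prog → Prog → Prog

/-- `Run f x y t`: on input `x` the program `f` halts with output `y` at cost `t`. -/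
inductive Run : Prog → Val → Val → ℕ → Prop
  | skip (x : Val) : Run Prog.skip x x x.size
  | leaf (x : Val) : Run Prog.leaf x Val.leaf x.size
  | left (x : Val) : Run Prog.left x x.left x.size
  | right (x : Val) : Run Prog.right x x.right x.size
  | pair {f g : Prog} {x a b : Val} {s t : ℕ} :
      Run f x a s → Run g x b t → Run (Prog.pair f g) x (Val.node a b) (x.size + s + t)
  | seq {f g : Prog} {x y z : Val} {s t : ℕ} :
      Run f x y s → Run g y z t → Run (Prog.seq f g) x z (x.size + s + t)
  | ite_node {c f g : Prog} {x a b y : Val} {s t : ℕ} :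
      Run c x (Val.node a b) s → Run f x y t → Run (Prog.ite c f g) x y (x.size + s + t)
  | ite_leaf {c f g : Prog} {x y : Val} {s t : ℕ} :
      Run c x Val.leaf s → Run g x y t → Run (Prog.ite c f g) x y (x.size + s + t)
  | loop_done {c f : Prog} {x : Val} {s : ℕ} :
      Run c x Val.leaf s → Run (Prog.loop c f) x x (x.size + s)
  | loop_step {c f : Prog} {x a b y z : Val} {s t u : ℕ} :
      Run c x (Val.node a b) s → Run f x y t → Run (Prog.loop c f) y z u →
      Run (Prog.loop c f) x z (x.size + s + t + u)

/-! ### Encodings of inputs and outputs -/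

namespace Val

/-- Lists, given an encoding of the entries. -/
def ofList {α : Type} (f : α → Val) : List α → Val
  | [] => leaf
  | a :: l => node (f a) (ofList f l)

/-- Natural numbers, in unary. -/
def ofNat : ℕ → Val
  | 0 => leaf
  | n + 1 => node leaf (ofNat n)

/-- Elements of `Fin n`, in unary. -/
def ofFin {n : ℕ} (i : Fin n) : Val := ofNat i

/-- Truth values. -/
def ofBool : Bool → Val
  | false => leaf
  | true => node leaf leaf

/-- Functions on `Fin n`, as the list of their values. -/
def ofTable {n : ℕ} {α : Type} (f : α → Val) (g : Fin n → α) : Val := ofList f (List.ofFn g)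

end Val

/-- The encoding of an alternating automaton: the numbers of states and letters, the initial
state, the transition table, and the characteristic vector of the accepting states. -/
def AltAut.code {k n : ℕ} (𝒜 : AltAut (Fin k) (Fin n)) : Val :=
  .node (.ofNat n) <| .node (.ofNat k) <| .node (.ofFin 𝒜.init) <|
  .node (.ofTable (Val.ofTable fun φ : PCNF (Fin n) => .ofList (.ofList .ofFin) φ.clauses) 𝒜.δ)
    (.ofTable Val.ofBool fun q => decide (q ∈ 𝒜.acc))

/-- A finite presentation of an SLTM for an automaton with letters `Fin k` and states `Fin n`:
states are numbered and listed as sets of vertices, and a label is a positive Boolean formula in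
conjunctive normal form over the languages of the automaton's states. -/
structure SLTMTable (k n : ℕ) where
  numStates : ℕ
  verts : Fin numStates → List (List (Fin n) × List (Fin n))
  init : Fin numStates
  step : Fin numStates → Fin k → Fin numStates
  label : Fin numStates → List (List (Fin n))

/-- The language that a label stands for. -/
def AltAut.labelLang {A Q : Type} (𝒜 : AltAut A Q) (φ : List (List Q)) : Set (Stream' A) :=
  {w | ∀ c ∈ φ, ∃ q ∈ c, w ∈ (𝒜.withInit q).language}

namespace SLTMTable

variable {k n : ℕ}

/-- The set of vertices that the state numbered `i` consists of. -/
def vertexSet (T : SLTMTable k n) (i : Fin T.numStates) : Set (BPVertex (Fin n)) :=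
  {v | ∃ c ∈ T.verts i, v = (c.1.toFinset, c.2.toFinset)}

/-- The table `T` presents the machine `M`, each state being listed exactly once. -/
def Presents (T : SLTMTable k n) (𝒜 : AltAut (Fin k) (Fin n))
    {QS : Set (Set (BPVertex (Fin n)))} (M : Moore (Fin k) QS (Set (Stream' (Fin k)))) : Prop :=
  ∃ e : Fin T.numStates ≃ QS,
    (∀ i, (e i : Set (BPVertex (Fin n))) = T.vertexSet i) ∧
    e T.init = M.init ∧
    (∀ i x, e (T.step i x) = M.step (e i) x) ∧
    (∀ i, 𝒜.labelLang (T.label i) = M.out (e i))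

/-- The encoding of a table. -/
def code (T : SLTMTable k n) : Val :=
  .node (.ofTable (Val.ofList fun v => .node (.ofList .ofFin v.1) (.ofList .ofFin v.2)) T.verts) <|
  .node (.ofFin T.init) <|
  .node (.ofTable (Val.ofTable Val.ofFin) T.step)
    (.ofTable (Val.ofList (Val.ofList Val.ofFin)) T.label)

end SLTMTable

/-! ### Values as lists of values -/

/-! Call the set of states from which an infinite word is accepted its type. Reading a letter acts
backwards on types by `pre`, so whether `p` followed by `w` is accepted depends only on `p` and on
the type of `w`. A suffix language is therefore given by a set of realised types; there are at most
2^(2^n) such sets, and the set for `p ++ [x]` is computed from the set for `p` (`after_concat`).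
These sets serve as the states of the machine.

Two facts turn this machine into a canonical SLTM with labels. A realised type is excluded after `p`
exactly when some vertex (P, R) reached by `p` has P ∪ R disjoint from it, so the vertices reached
by all words with a common suffix language determine that language
(`after_subset_of_vertsOf_subset`). And since `pre` is monotone, the sets of types are upward closed
among the realised types, so a suffix language is the conjunction, over the excluded types ρ, of
acceptance from some state outside ρ (`mem_langOf_after`).

It remains to decide which sets of states are realised types; `exists_typ_eq_iff` reduces this to
lassos. A loop `v` that takes σ back to σ certifies σ if from every state the player who should win
according to σ can force, within `v` and without leaving the states that he should win, a visit to a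
state good for him: an accepting one for the acceptor, a rejecting one for the rejector. Repeating
`v` gives infinitely many such visits, which suffices for the rejector by definition and for the
acceptor by weakness. Conversely, along any word some type recurs, and the wait for a good visit is
bounded, since otherwise the opponent could avoid good states forever. Only 4^n pairs (type, states
with progress) exist, so loops are found by graph search.

The vertices belonging to each state come from reachability in the product of the machine of type
sets with the obligation graph. All computations are polynomial-time list processing, except for two
power sets: that of the states and that of the realised types. As the input has size 2^(O(n)), the
cost is polynomial in 2^(2^(O(n))). -/

noncomputable instance : DecidableEq Val := Classical.decEq _

namespace Val

/-- The list of values coded by a value. -/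
def toL : Val → List Val
  | leaf => []
  | node a b => a :: toL b

/-- The value coding a list of values. -/
def ofL (l : List Val) : Val := ofList id l

@[simp] theorem ofL_nil : ofL [] = leaf := rfl

@[simp] theorem ofL_cons (a : Val) (l : List Val) : ofL (a :: l) = node a (ofL l) := rfl

@[simp] theorem toL_ofL (l : List Val) : toL (ofL l) = l := by
  induction l with
  | nil => rfl
  | cons a l ih => simp [toL, ih]

@[simp] theorem ofL_toL (v : Val) : ofL (toL v) = v := by
  induction v with
  | leaf => rfl
  | node a b _ ih => simp [toL, ih]

@[simp] theorem toL_leaf : toL leaf = [] := rfl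

@[simp] theorem toL_node (a b : Val) : toL (node a b) = a :: toL b := rfl

@[simp] theorem left_node (a b : Val) : (node a b).left = a := rfl

@[simp] theorem right_node (a b : Val) : (node a b).right = b := rfl

@[simp] theorem left_leaf : leaf.left = leaf := rfl

@[simp] theorem right_leaf : leaf.right = leaf := rfl

theorem ofList_eq {α : Type} (f : α → Val) (l : List α) : ofList f l = ofL (l.map f) := by
  induction l with
  | nil => rfl
  | cons a l ih => simp [ofList, ih]

theorem size_pos (v : Val) : 1 ≤ v.size := by cases v <;> simp [size]

theorem size_ofL (l : List Val) : (ofL l).size = (l.map size).sum + l.length + 1 := by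
  induction l with
  | nil => rfl
  | cons a l ih => simp [size, ih]; ring

theorem size_left_le (v : Val) : v.left.size ≤ v.size := by
  cases v <;> simp [left, size]; omega

theorem size_right_le (v : Val) : v.right.size ≤ v.size := by
  cases v <;> simp [right, size]; omega

theorem length_toL_le (v : Val) : v.toL.length + 1 ≤ v.size := by
  have := size_ofL v.toL
  rw [ofL_toL] at this; omega

theorem size_le_of_mem {a : Val} {l : List Val} (h : a ∈ l) : a.size ≤ (ofL l).size := by
  have := List.single_le_sum (l := l.map size) (by simp) _ (List.mem_map_of_mem (f := size) h)
  rw [size_ofL]; omega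

theorem size_ofL_append (l l' : List Val) :
    (ofL (l ++ l')).size + 1 = (ofL l).size + (ofL l').size := by
  simp [size_ofL]; ring

theorem size_ofL_le_of_sublist {l l' : List Val} (h : l.Sublist l') :
    (ofL l).size ≤ (ofL l').size := by
  have h1 := (h.map size).sum_le_sum (by simp)
  have h2 := h.length_le
  rw [size_ofL, size_ofL]; omega

end Val

open Val

theorem Polynomial.evalNat_mono (p : Polynomial ℕ) {a b : ℕ} (h : a ≤ b) :
    p.eval a ≤ p.eval b := by
  induction p using Polynomial.induction_on' with
  | add p q hp hq => simpa using Nat.add_le_add hp hq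
  | monomial n c => simpa using Nat.mul_le_mul_left c (Nat.pow_le_pow_left h n)

/-- Every operation is charged for what it reads or builds. Hence a cost bound is also a size bound,
and compositions need no separate control of intermediate values. -/
theorem Run.size_le {f : Prog} {x y : Val} {t : ℕ} (h : Run f x y t) :
    x.size ≤ t ∧ y.size ≤ t := by
  induction h with
  | skip x => exact ⟨le_rfl, le_rfl⟩
  | leaf x => exact ⟨le_rfl, x.size_pos⟩
  | left x => exact ⟨le_rfl, x.size_left_le⟩
  | right x => exact ⟨le_rfl, x.size_right_le⟩
  | @pair f g x a b s t _ _ h1 h2 =>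
    have := x.size_pos
    simp only [Val.size]; omega
  | _ => omega

/-! ### Functions computable in polynomial time -/

/-- Types of results of programs. -/
class Enc (β : Type) where
  enc : β → Val

open Enc

instance : Enc Val := ⟨id⟩
instance : Enc Bool := ⟨ofBool⟩
instance : Enc (List Val) := ⟨ofL⟩

@[simp] theorem enc_val (v : Val) : enc v = v := rfl
@[simp] theorem enc_list (l : List Val) : enc l = ofL l := rfl

/-- `f` is computed by a program whose cost on `x` is polynomial in `B x`. -/
def PolyIn {β : Type} [Enc β] (B : Val → ℕ) (f : Val → β) : Prop :=
  ∃ (prog : Prog) (p : Polynomial ℕ), ∀ x, ∃ t, Run prog x (enc (f x)) t ∧ t ≤ p.eval (B x)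

/-- `f` is computable in polynomial time. -/
abbrev PTime {β : Type} [Enc β] (f : Val → β) : Prop := PolyIn Val.size f

/-- A binary function is computable in polynomial time. -/
def PTime2 {β : Type} [Enc β] (F : Val → Val → β) : Prop := PTime fun z => F z.left z.right

/-- A ternary function is computable in polynomial time. -/
def PTime3 {β : Type} [Enc β] (F : Val → Val → Val → β) : Prop :=
  PTime fun z => F z.left z.right.left z.right.right

/-- A quaternary function is computable in polynomial time. -/
def PTime4 {β : Type} [Enc β] (F : Val → Val → Val → Val → β) : Prop :=
  PTime fun z => F z.left z.right.left z.right.right.left z.right.right.right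

section closure

variable {β : Type} [Enc β] {B : Val → ℕ}

theorem PolyIn.exists_size_le {f : Val → β} (hf : PolyIn B f) :
    ∃ p : Polynomial ℕ, ∀ x, x.size ≤ p.eval (B x) ∧ (enc (f x)).size ≤ p.eval (B x) := by
  obtain ⟨_, p, h⟩ := hf
  refine ⟨p, fun x => ?_⟩
  obtain ⟨t, ht, hp⟩ := h x
  have := ht.size_le
  omega

/-- The outer function may be measured by something other than size. This matters for the power set,
whose cost is exponential in the length of its argument. -/
theorem PolyIn.comp_of_le {B' : Val → ℕ} {g : Val → β} {f : Val → Val} (hg : PolyIn B' g)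
    (hf : PolyIn B f) (r : Polynomial ℕ) (hr : ∀ x, B' (f x) ≤ r.eval (B x)) :
    PolyIn B fun x => g (f x) := by
  obtain ⟨G, p, hG⟩ := hg
  obtain ⟨F, q, hF⟩ := hf
  refine ⟨.seq F G, q + q + p.comp r, fun x => ?_⟩
  obtain ⟨s, hs, hs'⟩ := hF x
  obtain ⟨t, ht, ht'⟩ := hG (f x)
  refine ⟨_, .seq hs ht, ?_⟩
  have h1 := hs.size_le.1
  have h2 := p.evalNat_mono (hr x)
  simp only [Polynomial.eval_add, Polynomial.eval_comp]
  omega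

theorem PolyIn.comp {g : Val → β} {f : Val → Val} (hg : PTime g) (hf : PolyIn B f) :
    PolyIn B fun x => g (f x) := by
  obtain ⟨r, hr⟩ := hf.exists_size_le
  exact hg.comp_of_le hf r fun x => (hr x).2

theorem PTime.id : PTime fun x => x := ⟨.skip, .X, fun x => ⟨_, .skip x, by simp⟩⟩

theorem PTime.leaf : PTime fun _ => Val.leaf := ⟨.leaf, .X, fun x => ⟨_, .leaf x, by simp⟩⟩

theorem PolyIn.left {f : Val → Val} (hf : PolyIn B f) : PolyIn B fun x => (f x).left :=
  PolyIn.comp (g := Val.left) ⟨.left, .X, fun x => ⟨_, .left x, by simp⟩⟩ hf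

theorem PolyIn.right {f : Val → Val} (hf : PolyIn B f) : PolyIn B fun x => (f x).right :=
  PolyIn.comp (g := Val.right) ⟨.right, .X, fun x => ⟨_, .right x, by simp⟩⟩ hf

theorem PolyIn.node {f g : Val → Val} (hf : PolyIn B f) (hg : PolyIn B g) :
    PolyIn B fun x => Val.node (f x) (g x) := by
  obtain ⟨F, p, hF⟩ := hf
  obtain ⟨G, q, hG⟩ := hg
  refine ⟨.pair F G, p + p + q, fun x => ?_⟩
  obtain ⟨s, hs, hs'⟩ := hF x
  obtain ⟨t, ht, ht'⟩ := hG x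
  refine ⟨_, .pair hs ht, ?_⟩
  have h1 := hs.size_le.1
  simp only [Polynomial.eval_add]
  omega

theorem PolyIn.app2 {F : Val → Val → β} (hF : PTime2 F) {a b : Val → Val} (ha : PolyIn B a)
    (hb : PolyIn B b) : PolyIn B fun x => F (a x) (b x) :=
  PolyIn.comp hF (ha.node hb)

theorem PolyIn.app3 {F : Val → Val → Val → β} (hF : PTime3 F) {a b c : Val → Val}
    (ha : PolyIn B a) (hb : PolyIn B b) (hc : PolyIn B c) :
    PolyIn B fun x => F (a x) (b x) (c x) :=
  PolyIn.comp hF (ha.node (hb.node hc))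

theorem PolyIn.app4 {F : Val → Val → Val → Val → β} (hF : PTime4 F) {a b c d : Val → Val}
    (ha : PolyIn B a) (hb : PolyIn B b) (hc : PolyIn B c) (hd : PolyIn B d) :
    PolyIn B fun x => F (a x) (b x) (c x) (d x) :=
  PolyIn.comp hF (ha.node (hb.node (hc.node hd)))

theorem PolyIn.cond {b : Val → Bool} {f g : Val → β} (hb : PolyIn B b) (hf : PolyIn B f)
    (hg : PolyIn B g) : PolyIn B fun x => bif b x then f x else g x := by
  obtain ⟨C, r, hC⟩ := hb
  obtain ⟨F, p, hF⟩ := hf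
  obtain ⟨G, q, hG⟩ := hg
  refine ⟨.ite C F G, r + r + p + q, fun x => ?_⟩
  obtain ⟨u, hu, hu'⟩ := hC x
  obtain ⟨s, hs, hs'⟩ := hF x
  obtain ⟨t, ht, ht'⟩ := hG x
  have h1 := hu.size_le.1
  simp only [Polynomial.eval_add]
  cases h : b x with
  | true =>
    rw [h] at hu
    exact ⟨_, .ite_node hu hs, by omega⟩
  | false =>
    rw [h] at hu
    exact ⟨_, .ite_leaf hu ht, by omega⟩

/-- Programs see only encodings, so one program serves all functions, even with different result
types, whose encoded values agree. -/
theorem PolyIn.congr_enc {β' : Type} [Enc β'] {f : Val → β} {g : Val → β'} (hf : PolyIn B f)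
    (h : ∀ x, enc (f x) = enc (g x)) : PolyIn B g := by
  obtain ⟨F, p, hF⟩ := hf
  exact ⟨F, p, fun x => h x ▸ hF x⟩

theorem PolyIn.ofL {f : Val → List Val} (hf : PolyIn B f) : PolyIn B fun x => Val.ofL (f x) :=
  hf.congr_enc fun _ => rfl

theorem PolyIn.toL {f : Val → Val} (hf : PolyIn B f) : PolyIn B fun x => (f x).toL :=
  hf.congr_enc fun x => by simp

theorem PolyIn.ofBool {f : Val → Bool} (hf : PolyIn B f) :
    PolyIn B fun x => Val.ofBool (f x) :=
  hf.congr_enc fun _ => rfl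

/-- Whether a value is a node. -/
def Val.isNode : Val → Bool
  | .leaf => false
  | .node _ _ => true

@[simp] theorem Val.isNode_leaf : Val.leaf.isNode = false := rfl

@[simp] theorem Val.isNode_node (a b : Val) : (Val.node a b).isNode = true := rfl

@[simp] theorem Val.isNode_ofBool (b : Bool) : (Val.ofBool b).isNode = b := by cases b <;> rfl

theorem PTime.true : PTime fun _ => true :=
  (PolyIn.node PTime.leaf PTime.leaf).congr_enc fun _ => rfl

theorem PTime.false : PTime fun _ => false := PTime.leaf.congr_enc fun _ => rfl

theorem PolyIn.isNode {f : Val → Val} (hf : PolyIn B f) : PolyIn B fun x => (f x).isNode := by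
  refine PolyIn.comp (g := Val.isNode) ?_ hf
  refine ⟨.ite .skip (.pair .leaf .leaf) .leaf, 10 * .X, fun x => ?_⟩
  have := x.size_pos
  cases x with
  | leaf => exact ⟨_, .ite_leaf (.skip _) (.leaf _), by simp [Val.size]⟩
  | node a b =>
    exact ⟨_, .ite_node (.skip _) (.pair (.leaf _) (.leaf _)), by simp; omega⟩

theorem PolyIn.not {f : Val → Bool} (hf : PolyIn B f) : PolyIn B fun x => !f x := by
  have := (PolyIn.cond (β := Bool) PTime.id.isNode PTime.false PTime.true).comp hf.ofBool
  refine this.congr_enc fun x => ?_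
  cases f x <;> simp

theorem PolyIn.and {f g : Val → Bool} (hf : PolyIn B f) (hg : PolyIn B g) :
    PolyIn B fun x => f x && g x :=
  (hf.cond hg hf).congr_enc fun x => by cases h : f x <;> simp

theorem PolyIn.or {f g : Val → Bool} (hf : PolyIn B f) (hg : PolyIn B g) :
    PolyIn B fun x => f x || g x :=
  (hf.cond hf hg).congr_enc fun x => by cases h : f x <;> simp

theorem PolyIn.iff {f g : Val → Bool} (hf : PolyIn B f) (hg : PolyIn B g) :
    PolyIn B fun x => f x == g x :=
  (hf.cond hg hg.not).congr_enc fun x => by cases h : f x <;> cases h' : g x <;> simp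

end closure

/-! ### Loops -/

/-- A round costs at most `3 * K`: the test, the body, and the size of the current value, which the
cost of the test dominates. The extra round is the final failing test. -/
theorem Run.loop_iterate {c f : Prog} {C F : Val → Val} {K : ℕ} (N : ℕ) (x : Val)
    (hc : ∀ i ≤ N, ∃ t ≤ K, Run c (F^[i] x) (C (F^[i] x)) t)
    (hf : ∀ i < N, ∃ t ≤ K, Run f (F^[i] x) (F (F^[i] x)) t)
    (hN : ∀ i < N, C (F^[i] x) ≠ Val.leaf) (hend : C (F^[N] x) = Val.leaf) :
    ∃ t ≤ (N + 1) * (3 * K), Run (Prog.loop c f) x (F^[N] x) t := by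
  induction N generalizing x with
  | zero =>
    obtain ⟨t, ht, h⟩ := hc 0 le_rfl
    have h1 := h.size_le.1
    simp only [Function.iterate_zero, _root_.id] at h h1 hend ⊢
    rw [hend] at h
    exact ⟨_, by omega, .loop_done h⟩
  | succ N ih =>
    obtain ⟨u, hu, hu'⟩ := ih (F x) (fun i hi => hc (i + 1) (by omega))
      (fun i hi => hf (i + 1) (by omega)) (fun i hi => hN (i + 1) (by omega)) hend
    obtain ⟨s, hs, h1⟩ := hc 0 (by omega)
    obtain ⟨t, ht, h2⟩ := hf 0 (by omega)
    have h0 := hN 0 (by omega)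
    have h3 := h1.size_le.1
    simp only [Function.iterate_zero, _root_.id] at h1 h2 h3 h0
    cases hC : C x with
    | leaf => exact absurd hC h0
    | node a b =>
      rw [hC] at h1
      exact ⟨x.size + s + t + u, by nlinarith, .loop_step h1 h2 hu'⟩

/-- A polynomial-time body may double the value in every round, so a bound on the number of rounds
is not enough; all intermediate sizes have to be bounded too. -/
theorem PolyIn.loop {B : Val → ℕ} {C F x₀ : Val → Val} (hC : PTime C) (hF : PTime F)
    (h₀ : PolyIn B x₀) (N : Val → ℕ) (hN : ∀ x, ∀ i < N x, C (F^[i] (x₀ x)) ≠ Val.leaf)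
    (hend : ∀ x, C (F^[N x] (x₀ x)) = Val.leaf) (r : Polynomial ℕ)
    (hr : ∀ x, N x ≤ r.eval (B x))
    (hsize : ∀ x, ∀ i ≤ N x, (F^[i] (x₀ x)).size ≤ r.eval (B x)) :
    PolyIn B fun x => F^[N x] (x₀ x) := by
  obtain ⟨c, p, hc⟩ := hC
  obtain ⟨f, q, hf⟩ := hF
  obtain ⟨g, s, hg⟩ := h₀
  refine ⟨.seq g (.loop c f), s + s + (r + 1) * (3 * (p.comp r + q.comp r)), fun x => ?_⟩
  obtain ⟨t₀, hg1, hg2⟩ := hg x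
  obtain ⟨t, ht, hrun⟩ := Run.loop_iterate (c := c) (f := f) (C := C) (F := F)
    (K := (p.comp r + q.comp r).eval (B x)) (N x) (x₀ x)
    (fun i hi => by
      obtain ⟨t, h1, h2⟩ := hc (F^[i] (x₀ x))
      have := p.evalNat_mono (hsize x i hi)
      exact ⟨t, by simp only [Polynomial.eval_add, Polynomial.eval_comp]; omega, h1⟩)
    (fun i hi => by
      obtain ⟨t, h1, h2⟩ := hf (F^[i] (x₀ x))
      have := q.evalNat_mono (hsize x i hi.le)
      exact ⟨t, by simp only [Polynomial.eval_add, Polynomial.eval_comp]; omega, h1⟩)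
    (hN x) (hend x)
  refine ⟨_, .seq hg1 hrun, ?_⟩
  have h1 := hg1.size_le.1
  have h2 : (N x + 1) * (3 * (p.comp r + q.comp r).eval (B x)) ≤
      (r.eval (B x) + 1) * (3 * (p.comp r + q.comp r).eval (B x)) :=
    Nat.mul_le_mul_right _ (by have := hr x; omega)
  simp only [Polynomial.eval_add, Polynomial.eval_mul, Polynomial.eval_one,
    Polynomial.eval_ofNat] at h2 ht ⊢
  omega

/-- One step of a fold; the arguments of the fold are parametrised by the value `y`. -/
def foldStep (g : Val → Val → Val → Val) (st : Val) : Val :=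
  .node st.left (.node (g st.right.left st.right.right.left st.left) st.right.right.right)

/-- The loop state consists of the parameter, the accumulator and the entries still to be read; the
last of these doubles as the loop test. -/
theorem foldStep_iterate (g : Val → Val → Val → Val) (x s : Val) (l l' : List Val) :
    (foldStep g)^[l.length] (.node x (.node s (ofL (l ++ l')))) =
      .node x (.node (l.foldl (fun s b => g s b x) s) (ofL l')) := by
  induction l generalizing s with
  | nil => rfl
  | cons a l ih => simpa [foldStep] using ih (g s a x)

theorem PolyIn.foldl {B : Val → ℕ} {l : Val → List Val} {s₀ : Val → Val}
    {g : Val → Val → Val → Val} (hB : ∀ x, x.size ≤ B x) (hl : PolyIn B l) (hs : PolyIn B s₀)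
    (hg : PTime3 g) (r : Polynomial ℕ)
    (hr : ∀ x l₁ l₂, l x = l₁ ++ l₂ →
      (l₁.foldl (fun s b => g s b x) (s₀ x)).size ≤ r.eval (B x)) :
    PolyIn B fun x => (l x).foldl (fun s b => g s b x) (s₀ x) := by
  have hid : PolyIn B fun x => x := ⟨.skip, .X, fun x => ⟨_, .skip x, by simpa using hB x⟩⟩
  have h0 : PolyIn B fun x => Val.node x (.node (s₀ x) (Val.ofL (l x))) :=
    hid.node (hs.node hl.ofL)
  have hF : PTime (foldStep g) :=
    PTime.id.left.node ((PolyIn.app3 hg PTime.id.right.left PTime.id.right.right.left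
      PTime.id.left).node PTime.id.right.right.right)
  obtain ⟨q, hq⟩ := hl.exists_size_le
  have key : ∀ x, ∀ i ≤ (l x).length, ∃ l₁ l₂, l x = l₁ ++ l₂ ∧ l₁.length = i ∧
      (foldStep g)^[i] (.node x (.node (s₀ x) (Val.ofL (l x)))) =
        .node x (.node (l₁.foldl (fun s b => g s b x) (s₀ x)) (Val.ofL l₂)) := by
    intro x i hi
    refine ⟨(l x).take i, (l x).drop i, (List.take_append_drop i _).symm, by simpa using hi, ?_⟩
    have := foldStep_iterate g x (s₀ x) ((l x).take i) ((l x).drop i)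
    rwa [List.take_append_drop, List.length_take, min_eq_left hi] at this
  have := (PolyIn.loop (C := fun st => st.right.right) (F := foldStep g)
    (PTime.id.right.right) hF h0 (fun x => (l x).length) ?_ ?_ (q + q + r + 2) ?_ ?_).right.left
  · refine this.congr_enc fun x => ?_
    obtain ⟨l₁, l₂, h1, h2, h3⟩ := key x _ le_rfl
    have : l₂ = [] := List.length_eq_zero_iff.1 (by have := congrArg List.length h1; simp at this; omega)
    subst this
    rw [List.append_nil] at h1
    rw [h3, ← h1]; rfl
  · intro x i hi
    obtain ⟨l₁, l₂, h1, h2, h3⟩ := key x i hi.le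
    rw [h3]
    cases l₂ with
    | nil => rw [h1] at hi; simp [h2] at hi
    | cons a l => simp
  · intro x
    obtain ⟨l₁, l₂, h1, h2, h3⟩ := key x _ le_rfl
    have : l₂ = [] := List.length_eq_zero_iff.1 (by have := congrArg List.length h1; simp at this; omega)
    rw [h3, this]; rfl
  · intro x
    have := (hq x).2
    rw [enc_list, size_ofL] at this
    simp only [Polynomial.eval_add]; omega
  · intro x i hi
    obtain ⟨l₁, l₂, h1, h2, h3⟩ := key x i hi
    have h4 := hr x l₁ l₂ h1
    have h5 := hq x
    have h6 := size_ofL_append l₁ l₂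
    have h7 := (Val.ofL l₁).size_pos
    rw [← h1] at h6
    rw [enc_list] at h5
    rw [h3]
    simp only [Val.size, Polynomial.eval_add, Polynomial.eval_ofNat]; omega

/-! ### List operations in polynomial time -/

theorem PTime.foldl {l : Val → List Val} {s₀ : Val → Val} {g : Val → Val → Val → Val}
    (hl : PTime l) (hs : PTime s₀) (hg : PTime3 g) (r : Polynomial ℕ)
    (hr : ∀ x l₁ l₂, l x = l₁ ++ l₂ →
      (l₁.foldl (fun s b => g s b x) (s₀ x)).size ≤ r.eval x.size) :
    PTime fun x => (l x).foldl (fun s b => g s b x) (s₀ x) :=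
  PolyIn.foldl (fun _ => le_rfl) hl hs hg r hr

theorem Val.foldl_node (l : List Val) (s : Val) :
    l.foldl (fun s b => Val.node b s) s = Val.ofL (l.reverse ++ s.toL) := by
  induction l generalizing s with
  | nil => simp
  | cons a l ih => rw [List.foldl_cons, ih]; simp

/-- Folding with `node` moves entries one at a time onto the front of the accumulator and so
reverses them. This is the primitive operation from which reversal and concatenation are derived. -/
theorem PTime.reverse_append {l l' : Val → List Val} (hl : PTime l) (hl' : PTime l') :
    PTime fun x => (l x).reverse ++ l' x := by
  obtain ⟨p, hp⟩ := hl.exists_size_le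
  obtain ⟨q, hq⟩ := hl'.exists_size_le
  have h := PTime.foldl (s₀ := fun x => Val.ofL (l' x)) (g := fun s b _ => .node b s) hl hl'.ofL
    (PTime.id.right.left.node PTime.id.left) (p + q) ?_
  · exact h.congr_enc fun x => by simp [foldl_node]
  · intro x l₁ l₂ h
    have h1 := (hp x).2
    have h2 := (hq x).2
    have h3 := size_ofL_le_of_sublist (List.sublist_append_left l₁ l₂)
    have h4 := size_ofL_append l₁.reverse (l' x)
    have h5 : (Val.ofL l₁.reverse).size = (Val.ofL l₁).size := by simp [size_ofL]
    rw [← h] at h3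
    simp only [enc_list] at h1 h2
    simp only [foldl_node, toL_ofL, Polynomial.eval_add]
    omega

theorem PTime.nil : PTime fun _ => ([] : List Val) := PTime.leaf.congr_enc fun _ => rfl

theorem PTime.reverse {l : Val → List Val} (hl : PTime l) : PTime fun x => (l x).reverse :=
  (hl.reverse_append PTime.nil).congr_enc fun x => by simp

theorem PTime.append {l l' : Val → List Val} (hl : PTime l) (hl' : PTime l') :
    PTime fun x => l x ++ l' x :=
  (hl.reverse.reverse_append hl').congr_enc fun x => by simp

theorem Val.size_ofL_flatMap_le (l : List Val) (f : Val → List Val) (M : ℕ)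
    (h : ∀ a ∈ l, (Val.ofL (f a)).size ≤ M) :
    (Val.ofL (l.flatMap f)).size ≤ l.length * M + 1 := by
  induction l with
  | nil => simp [Val.size]
  | cons a l ih =>
    have h1 := ih fun b hb => h b (List.mem_cons_of_mem _ hb)
    have h2 := h a List.mem_cons_self
    have h3 := size_ofL_append (f a) (l.flatMap f)
    rw [List.flatMap_cons, List.length_cons, Nat.add_mul, one_mul]
    omega

theorem PTime.flatMap {l : Val → List Val} {f : Val → Val → List Val} (hl : PTime l)
    (hf : PTime fun z => f z.left z.right) : PTime fun x => (l x).flatMap fun a => f a x := by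
  obtain ⟨p, hp⟩ := hl.exists_size_le
  obtain ⟨q, hq⟩ := PolyIn.exists_size_le hf
  have key : ∀ x (l₁ : List Val) (s : Val),
      l₁.foldl (fun s b => Val.ofL ((f b x).reverse ++ s.toL)) s =
        Val.ofL ((l₁.flatMap fun a => f a x).reverse ++ s.toL) := by
    intro x l₁
    induction l₁ with
    | nil => simp
    | cons a l ih => intro s; rw [List.foldl_cons, ih]; simp
  have h := PTime.foldl (s₀ := fun x => Val.leaf)
    (g := fun s b x => Val.ofL ((f b x).reverse ++ s.toL)) hl PTime.leaf
    (PolyIn.ofL (PTime.reverse_append (PolyIn.app2 hf PTime.id.right.left PTime.id.right.right)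
      -- At most `p` entries are treated; each is paired with the parameter in a node of size at
      -- most `p + X + 1` before `f` is applied.
      PTime.id.left.toL)) (p * q.comp (p + .X + 1) + 1) ?_
  · exact (PTime.reverse h.toL).congr_enc fun x => by simp [key]
  · intro x l₁ l₂ h
    have h1 := (hp x).2
    rw [key, toL_leaf, List.append_nil]
    have h5 : (Val.ofL (l₁.flatMap fun a => f a x).reverse).size =
        (Val.ofL (l₁.flatMap fun a => f a x)).size := by simp [size_ofL]
    rw [h5]
    have h6 := size_ofL_flatMap_le l₁ (fun a => f a x) (q.eval (p.eval x.size + x.size + 1)) ?_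
    · have h7 := length_toL_le (Val.ofL (l x))
      have h8 : l₁.length ≤ p.eval x.size := by
        rw [enc_list] at h1
        rw [toL_ofL] at h7
        have := congrArg List.length h
        simp only [List.length_append] at this
        omega
      simp only [Polynomial.eval_add, Polynomial.eval_mul, Polynomial.eval_comp,
        Polynomial.eval_X, Polynomial.eval_one]
      exact h6.trans (Nat.add_le_add_right (Nat.mul_le_mul_right _ h8) _)
    · intro a ha
      refine ((hq (.node a x)).2).trans (q.evalNat_mono ?_)
      have := size_le_of_mem (l := l x) (a := a) (by rw [h]; exact List.mem_append_left _ ha)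
      simp only [enc_list] at h1
      simp only [Val.size]; omega

theorem PTime.map {l : Val → List Val} {f : Val → Val → Val} (hl : PTime l) (hf : PTime fun z => f z.left z.right) :
    PTime fun x => (l x).map fun a => f a x :=
  (hl.flatMap (f := fun a x => [f a x]) ((PolyIn.node hf PTime.leaf).congr_enc fun _ => rfl)
    ).congr_enc fun x => by
      congr 1
      induction l x with
      | nil => rfl
      | cons a l ih => simp [ih]

theorem PTime.filter {l : Val → List Val} {p : Val → Val → Bool} (hl : PTime l)
    (hp : PTime fun z => p z.left z.right) : PTime fun x => (l x).filter fun a => p a x :=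
  (hl.flatMap (f := fun a x => bif p a x then [a] else [])
    (PolyIn.cond hp ((PTime.id.left.node PTime.leaf).congr_enc fun _ => rfl) PTime.nil)
    ).congr_enc fun x => by
      congr 1
      induction l x with
      | nil => rfl
      | cons a l ih => cases h : p a x <;> simp [h, ih]

theorem PTime.any {l : Val → List Val} {p : Val → Val → Bool} (hl : PTime l)
    (hp : PTime fun z => p z.left z.right) : PTime fun x => (l x).any fun a => p a x :=
  (hl.filter hp).ofL.isNode.congr_enc fun x => by
    congr 1
    induction l x with
    | nil => rfl
    | cons a l ih => cases h : p a x <;> simp [h, ih]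

theorem PTime.all {l : Val → List Val} {p : Val → Val → Bool} (hl : PTime l)
    (hp : PTime fun z => p z.left z.right) : PTime fun x => (l x).all fun a => p a x :=
  (hl.any (p := fun a x => !p a x) (PolyIn.not hp)).not.congr_enc fun x => by
    rw [List.all_eq_not_any_not]

/-! ### Equality -/

/-- One step of the comparison of the pairs on a stack. -/
def Val.eqStep (st : Val) : Val :=
  bif st.right.left.left.isNode then
    bif st.right.left.right.isNode then
      .node st.left (.node (.node st.right.left.left.left st.right.left.right.left)
        (.node (.node st.right.left.left.right st.right.left.right.right) st.right.right))
    else .node (.node .leaf .leaf) .leaf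
  else
    bif st.right.left.right.isNode then .node (.node .leaf .leaf) .leaf
    else .node st.left st.right.right

/-- The right child is a stack of pairs still to be compared, the left child a flag for a mismatch.
The total size of the first components drops in every round without mismatch, since two leaves are
popped and two nodes are replaced by the pairs of their children; the state itself never grows. -/
theorem Val.eqStep_iterate (m : ℕ) (S : List (Val × Val)) (hm : (S.map (·.1.size)).sum ≤ m) :
    ∃ N ≤ m, ∀ st, st = Val.node .leaf (Val.ofL (S.map fun e => .node e.1 e.2)) →
      (∀ i < N, (eqStep^[i] st).right ≠ .leaf) ∧ (eqStep^[N] st).right = .leaf ∧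
      ((eqStep^[N] st).left = .leaf ↔ ∀ e ∈ S, e.1 = e.2) ∧
      ∀ i ≤ N, (eqStep^[i] st).size ≤ st.size := by
  have one : ∀ (N : ℕ) (st : Val) (φ : Val → Prop), st.right ≠ .leaf →
      (eqStep st).size ≤ st.size → ((∀ i < N, (eqStep^[i] (eqStep st)).right ≠ .leaf) ∧
        (eqStep^[N] (eqStep st)).right = .leaf ∧ φ (eqStep^[N] (eqStep st)) ∧
        ∀ i ≤ N, (eqStep^[i] (eqStep st)).size ≤ (eqStep st).size) →
      (∀ i < N + 1, (eqStep^[i] st).right ≠ .leaf) ∧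
        (eqStep^[N + 1] st).right = .leaf ∧ φ (eqStep^[N + 1] st) ∧
        ∀ i ≤ N + 1, (eqStep^[i] st).size ≤ st.size := by
    rintro N st φ h1 h2 ⟨h3, h4, h5, h6⟩
    refine ⟨?_, h4, h5, ?_⟩
    · rintro (_ | i) hi
      · exact h1
      · exact h3 i (by omega)
    · rintro (_ | i) hi
      · exact le_rfl
      · exact (h6 i (by omega)).trans h2
  induction m generalizing S with
  | zero =>
    cases S with
    | nil => exact ⟨0, le_rfl, by rintro _ rfl; simp⟩
    | cons e S => have := e.1.size_pos; simp at hm; omega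
  | succ m ih =>
    cases S with
    | nil => exact ⟨0, by omega, by rintro _ rfl; simp⟩
    | cons e S =>
      obtain ⟨a, b⟩ := e
      -- A mismatch sets the flag and empties the stack, which ends the loop; the resulting state
      -- has size 5.
      have hfail : ∀ st, eqStep st = Val.node (.node .leaf .leaf) .leaf → st.right ≠ .leaf →
          5 ≤ st.size → (∀ i < 0 + 1, (eqStep^[i] st).right ≠ .leaf) ∧
          (eqStep^[0 + 1] st).right = .leaf ∧ (eqStep^[0 + 1] st).left ≠ .leaf ∧
          ∀ i ≤ 0 + 1, (eqStep^[i] st).size ≤ st.size := by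
        intro st h1 h2 h3
        refine one 0 st (fun v => v.left ≠ .leaf) h2 ?_ ?_
        · rw [h1]; exact h3
        · rw [h1]; simp
      have hsz := size_pos
      cases a with
      | leaf =>
        cases b with
        | leaf =>
          obtain ⟨N, hN, h⟩ := ih S (by simp [Val.size] at hm; omega)
          refine ⟨N + 1, by omega, fun st hst => ?_⟩
          have hs : eqStep st = Val.node .leaf (Val.ofL (S.map fun e => .node e.1 e.2)) := by
            rw [hst]; simp [eqStep]
          refine one N st (fun v => v.left = .leaf ↔ _) ?_ ?_ ?_
          · rw [hst]; simp
          · rw [hs, hst]; simp [Val.size]; omega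
          · simpa using h _ hs
        | node b₁ b₂ =>
          refine ⟨1, by omega, fun st hst => ?_⟩
          obtain ⟨h1, h2, h3, h4⟩ := hfail st (by rw [hst]; simp [eqStep]) (by rw [hst]; simp)
            (by rw [hst]; simp [Val.size]; omega)
          exact ⟨h1, h2, by simpa using h3, h4⟩
      | node a₁ a₂ =>
        cases b with
        | leaf =>
          refine ⟨1, by omega, fun st hst => ?_⟩
          obtain ⟨h1, h2, h3, h4⟩ := hfail st (by rw [hst]; simp [eqStep]) (by rw [hst]; simp)
            (by rw [hst]; simp [Val.size]; omega)
          exact ⟨h1, h2, by simpa using h3, h4⟩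
        | node b₁ b₂ =>
          obtain ⟨N, hN, h⟩ := ih ((a₁, b₁) :: (a₂, b₂) :: S) (by
            simp [Val.size] at hm ⊢; omega)
          refine ⟨N + 1, by omega, fun st hst => ?_⟩
          have hs : eqStep st = Val.node .leaf (Val.ofL
              (((a₁, b₁) :: (a₂, b₂) :: S).map fun e => .node e.1 e.2)) := by
            rw [hst]; simp [eqStep]
          refine one N st (fun v => v.left = .leaf ↔ _) ?_ ?_ ?_
          · rw [hst]; simp
          · rw [hs, hst]; simp [Val.size]; omega
          · simpa [and_assoc] using h _ hs

theorem PTime.eqStep : PTime Val.eqStep := by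
  unfold Val.eqStep
  have h := PTime.id.right.left
  have hf : PTime fun _ => Val.node (.node .leaf .leaf) .leaf :=
    (PTime.leaf.node PTime.leaf).node PTime.leaf
  exact h.left.isNode.cond (h.right.isNode.cond (PTime.id.left.node
    ((h.left.left.node h.right.left).node ((h.left.right.node h.right.right).node
      PTime.id.right.right))) hf) (h.right.isNode.cond hf (PTime.id.left.node PTime.id.right.right))

theorem PTime.eq {f g : Val → Val} (hf : PTime f) (hg : PTime g) :
    PTime fun x => decide (f x = g x) := by
  have hx := fun x => eqStep_iterate _ [(f x, g x)] le_rfl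
  choose N hN h using hx
  have h' := fun x => h x _ rfl
  obtain ⟨p, hp⟩ := hf.exists_size_le
  obtain ⟨q, hq⟩ := hg.exists_size_le
  have := (PolyIn.loop (C := fun st => st.right) (F := Val.eqStep)
    (x₀ := fun x => Val.node .leaf (.node (.node (f x) (g x)) .leaf)) PTime.id.right PTime.eqStep
    (PTime.leaf.node ((hf.node hg).node PTime.leaf)) N (fun x => (h' x).1) (fun x => (h' x).2.1)
    (p + q + 6) (fun x => ?_) (fun x i hi => ?_)).left.isNode.not
  · refine this.congr_enc fun x => ?_
    congr 1
    have h3 := (h' x).2.2.1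
    simp only [List.mem_singleton, forall_eq] at h3
    by_cases hfg : f x = g x
    · have := h3.2 hfg
      simp only [List.map_cons, List.map_nil, ofL_cons, ofL_nil] at this
      rw [this]; simp [hfg]
    · have := mt h3.1 hfg
      simp only [List.map_cons, List.map_nil, ofL_cons, ofL_nil] at this
      revert this
      cases (Val.eqStep^[N x] (Val.node .leaf (.node (.node (f x) (g x)) .leaf))).left <;>
        simp [hfg]
  · have h1 := hN x
    have h2 := (hp x).2
    simp only [List.map_cons, List.map_nil, List.sum_cons, List.sum_nil, enc_val] at h1 h2
    simp only [Polynomial.eval_add]; omega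
  · have h1 := (h' x).2.2.2 i hi
    have h2 := (hp x).2
    have h3 := (hq x).2
    simp only [List.map_cons, List.map_nil, ofL_cons, ofL_nil, enc_val] at h1 h2 h3
    refine h1.trans ?_
    simp only [Val.size, Polynomial.eval_add, Polynomial.eval_ofNat]; omega

/-! ### Numbers, indices, reachability -/

/-- The entry of a coded list with a given index. -/
def Val.nth (l i : Val) : Val := (i.toL.foldl (fun s _ => s.right) l).left

theorem PTime2.nth : PTime2 Val.nth := by
  have key : ∀ (l : List Val) (s : Val), (l.foldl (fun s _ => s.right) s).size ≤ s.size := by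
    intro l
    induction l with
    | nil => intro s; exact le_rfl
    | cons a l ih => intro s; exact (ih _).trans (size_right_le s)
  exact (PTime.foldl (g := fun s _ _ => s.right) PTime.id.right.toL PTime.id.left
    PTime.id.left.right .X fun x l₁ _ _ => by
      simpa using (key l₁ x.left).trans x.size_left_le).left

theorem Val.toL_ofNat (n : ℕ) : (Val.ofNat n).toL = List.replicate n Val.leaf := by
  induction n with
  | zero => rfl
  | succ n ih => rw [Val.ofNat, toL_node, ih, List.replicate_succ]

theorem Val.nth_ofNat (l : List Val) (i : ℕ) :
    Val.nth (Val.ofL l) (Val.ofNat i) = l[i]?.getD .leaf := by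
  unfold Val.nth
  induction i generalizing l with
  | zero => cases l <;> simp [Val.ofNat]
  | succ i ih =>
    cases l with
    | nil => simpa [Val.ofNat] using ih []
    | cons a l => simpa [Val.ofNat] using ih l

theorem Val.size_ofNat (n : ℕ) : (Val.ofNat n).size = 2 * n + 1 := by
  induction n with
  | zero => rfl
  | succ n ih => simp only [Val.ofNat, Val.size, ih]; ring

theorem Val.ofNat_injective : Function.Injective Val.ofNat := fun m n h => by
  have := congrArg Val.size h
  rw [size_ofNat, size_ofNat] at this
  omega

/-- The list of the numbers below a number. -/
def Val.range (v : Val) : List Val :=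
  (v.toL.foldl (fun s _ => Val.node (bif s.isNode then .node .leaf s.left else .leaf) s)
    .leaf).toL.reverse

/-- The numbers are accumulated in descending order, so that the next one is the successor of the
head. -/
theorem Val.range_aux (l : List Val) :
    l.foldl (fun s _ => Val.node (bif s.isNode then .node .leaf s.left else .leaf) s) .leaf =
      Val.ofL ((List.range l.length).map Val.ofNat).reverse := by
  induction l using List.reverseRecOn with
  | nil => rfl
  | append_singleton l a ih =>
    rw [List.foldl_concat, ih, List.length_append, List.length_singleton, List.range_succ]
    cases l.length with
    | zero => rfl
    | succ n => simp [List.range_succ, Val.ofNat]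

theorem Val.range_eq (v : Val) : v.range = (List.range v.toL.length).map Val.ofNat := by
  rw [Val.range, range_aux, toL_ofL, List.reverse_reverse]

theorem PTime.range {f : Val → Val} (hf : PTime f) : PTime fun x => (f x).range := by
  obtain ⟨p, hp⟩ := hf.exists_size_le
  refine PTime.reverse (PTime.foldl
    (g := fun s _ _ => Val.node (bif s.isNode then .node .leaf s.left else .leaf) s)
    hf.toL PTime.leaf ((PolyIn.cond PTime.id.left.isNode (PTime.leaf.node PTime.id.left.left)
      PTime.leaf).node PTime.id.left) (p * (2 * p + 2) + 1) ?_).toL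
  intro x l₁ l₂ h
  have h1 := congrArg List.length h
  have h2 := length_toL_le (f x)
  have h3 := (hp x).2
  rw [List.length_append] at h1
  rw [range_aux, size_ofL, List.map_reverse, List.sum_reverse, List.length_reverse,
    List.length_map, List.length_range]
  have h4 : ((List.map Val.ofNat (List.range l₁.length)).map Val.size).sum ≤
      l₁.length * (2 * l₁.length + 1) := by
    have := List.sum_le_card_nsmul ((List.map Val.ofNat (List.range l₁.length)).map Val.size)
      (2 * l₁.length + 1) (by simp [size_ofNat]; omega)
    simpa using this
  simp only [Polynomial.eval_add, Polynomial.eval_mul, Polynomial.eval_ofNat,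
    Polynomial.eval_one, enc_val] at h3 ⊢
  have h5 : l₁.length ≤ p.eval x.size := by omega
  nlinarith

/-- The index of a value in a list, in unary. -/
noncomputable def Val.idx (l : List Val) (a : Val) : Val :=
  l.reverse.foldl (fun s b => bif decide (b = a) then .leaf else .node .leaf s) .leaf

/-- The fold runs from the end of the list and resets the counter at every match, so the first
occurrence decides; without a match the counter is the length, as for `List.idxOf`. -/
theorem Val.idx_eq (l : List Val) (a : Val) : Val.idx l a = Val.ofNat (l.idxOf a) := by
  rw [Val.idx, List.foldl_reverse]
  induction l with
  | nil => rfl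
  | cons b l ih =>
    rw [List.foldr_cons, ih, List.idxOf_cons]
    by_cases h : b = a
    · simp [h, Val.ofNat]
    · have : (b == a) = false := by simpa using h
      simp [h, this, Val.ofNat]

theorem PTime.idx {l : Val → List Val} {a : Val → Val} (hl : PTime l) (ha : PTime a) :
    PTime fun x => Val.idx (l x) (a x) := by
  have h2 : PTime2 fun a l => Val.idx l.toL a := by
    refine PTime.foldl (g := fun s b x => bif decide (b = x.left) then .leaf else .node .leaf s)
      (PTime.reverse PTime.id.right.toL) PTime.leaf (PolyIn.cond (PTime.eq PTime.id.right.left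
        PTime.id.right.right.left) PTime.leaf (PTime.leaf.node PTime.id.left)) (2 * .X + 1) ?_
    intro x l₁ l₂ h
    have h1 := Val.idx_eq l₁.reverse x.left
    rw [Val.idx, List.reverse_reverse] at h1
    rw [h1, size_ofNat]
    have h3 := congrArg List.length h
    have h4 := length_toL_le x.right
    have h5 := size_right_le x
    have h6 := List.idxOf_le_length (a := x.left) (l := l₁.reverse)
    simp only [List.length_append, List.length_reverse] at h3 h6
    simp only [Polynomial.eval_add, Polynomial.eval_mul, Polynomial.eval_ofNat,
      Polynomial.eval_one, Polynomial.eval_X]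
    omega
  exact (PolyIn.app2 h2 ha hl.ofL).congr_enc fun x => by simp

/-- The elements of `U` that can be reached inside `U` from start vertices along edges. -/
def reachList {α : Type} (U : List α) (start : α → Bool) (edge : α → α → Bool) : List α :=
  U.foldl (fun R _ => U.filter fun y => start y || R.any fun z => edge z y) []

/-- This transfers the search on codes to a search on the coded objects. Agreement on `U` suffices
because every stage is a filtering of `U`. -/
theorem reachList_map {α β : Type} (e : α → β) (U : List α) (start : α → Bool)
    (edge : α → α → Bool) (start' : β → Bool) (edge' : β → β → Bool)
    (hs : ∀ a ∈ U, start' (e a) = start a)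
    (he : ∀ a ∈ U, ∀ b ∈ U, edge' (e a) (e b) = edge a b) :
    reachList (U.map e) start' edge' = (reachList U start edge).map e := by
  unfold reachList
  rw [List.foldl_map]
  have key : ∀ (l : List α) (R : List α), (∀ a ∈ R, a ∈ U) →
      l.foldl (fun R _ => (U.map e).filter fun y => start' y || R.any fun z => edge' z y)
        (R.map e) =
      (l.foldl (fun R _ => U.filter fun y => start y || R.any fun z => edge z y) R).map e := by
    intro l
    induction l with
    | nil => intro R _; rfl
    | cons a l ih =>
      intro R hR
      rw [List.foldl_cons, List.foldl_cons, ← ih _ fun a ha => (List.mem_filter.1 ha).1]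
      congr 1
      rw [List.filter_map]
      congr 1
      refine List.filter_congr fun y hy => ?_
      rw [Function.comp_apply, hs y hy, List.any_map]
      congr 1
      rw [Bool.eq_iff_iff, List.any_eq_true, List.any_eq_true]
      refine exists_congr fun z => and_congr_right fun hz => ?_
      rw [Function.comp_apply, he z (hR z hz) y hy]
  exact key U [] (by simp)

/-- Reachability from start vertices along edges. -/
inductive Reaches {α : Type} (start : α → Prop) (edge : α → α → Prop) : α → Prop
  | base {a : α} : start a → Reaches start edge a
  | step {a b : α} : Reaches start edge a → edge a b → Reaches start edge b

/-- The stages increase, and a stage that adds nothing is final. Otherwise each round adds a new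
element of `U`, so `U.length` rounds reach the fixed point. -/
theorem mem_reachList {α : Type} {U : List α} {start : α → Bool} {edge : α → α → Bool}
    (hs : ∀ a, start a = true → a ∈ U) (he : ∀ a b, edge a b = true → b ∈ U) {a : α} :
    a ∈ reachList U start edge ↔ Reaches (fun a => start a = true)
      (fun a b => edge a b = true) a := by
  classical
  set F : List α → List α := fun R => U.filter fun y => start y || R.any fun z => edge z y with hF
  have mem_F : ∀ R y, y ∈ F R ↔ start y = true ∨ ∃ z ∈ R, edge z y = true := by
    intro R y
    simp only [hF, List.mem_filter, Bool.or_eq_true, List.any_eq_true]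
    refine and_iff_right_of_imp ?_
    rintro (h | ⟨z, -, h⟩)
    · exact hs y h
    · exact he z y h
  have hcl : reachList U start edge = F^[U.length] [] := by
    unfold reachList
    have : ∀ (l R : List α), l.foldl (fun R _ => F R) R = F^[l.length] R := by
      intro l
      induction l with
      | nil => intro R; rfl
      | cons a l ih => intro R; exact ih _
    exact this U []
  have sub : ∀ i, F^[i] [] ⊆ F^[i + 1] [] := by
    intro i
    induction i with
    | zero => simp
    | succ i ih =>
      intro y hy
      rw [Function.iterate_succ_apply', mem_F] at hy ⊢
      exact hy.imp_right fun ⟨z, hz, h⟩ => ⟨z, ih hz, h⟩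
  have grow : ∀ i, (∃ j ≤ i, F^[j + 1] [] ⊆ F^[j] []) ∨ i ≤ (F^[i] []).toFinset.card := by
    intro i
    induction i with
    | zero => exact Or.inr (Nat.zero_le _)
    | succ i ih =>
      rcases ih with ⟨j, hj, h⟩ | h
      · exact Or.inl ⟨j, by omega, h⟩
      · by_cases h' : F^[i + 1] [] ⊆ F^[i] []
        · exact Or.inl ⟨i, by omega, h'⟩
        · right
          have : (F^[i] []).toFinset ⊂ (F^[i + 1] []).toFinset := by
            rw [Finset.ssubset_iff_subset_ne]
            refine ⟨fun y hy => by simpa using sub i (by simpa using hy), fun he => h' fun y hy => ?_⟩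
            have : y ∈ (F^[i + 1] []).toFinset := by simpa using hy
            rw [← he] at this; simpa using this
          have := Finset.card_lt_card this
          omega
  have stable : ∀ j k, F^[j + 1] [] ⊆ F^[j] [] → F^[j + k + 1] [] ⊆ F^[j + k] [] := by
    intro j k h
    induction k with
    | zero => exact h
    | succ k ih =>
      intro y hy
      rw [show j + (k + 1) = j + k + 1 by ring] at hy ⊢
      rw [Function.iterate_succ_apply', mem_F] at hy ⊢
      exact hy.imp_right fun ⟨z, hz, h⟩ => ⟨z, ih hz, h⟩
  -- Either growth stopped earlier, or the stage already contains every entry of `U`.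
  have fin : F^[U.length + 1] [] ⊆ F^[U.length] [] := by
    rcases grow U.length with ⟨j, hj, h⟩ | h
    · obtain ⟨k, hk⟩ := Nat.exists_eq_add_of_le hj
      rw [hk]; exact stable j k h
    · have hU : ∀ i y, y ∈ F^[i] [] → y ∈ U := by
        rintro (_ | i) y hy
        · simp at hy
        · rw [Function.iterate_succ_apply'] at hy
          exact (List.mem_filter.1 hy).1
      intro y hy
      have h1 : (F^[U.length] []).toFinset ⊆ U.toFinset := fun y hy => by
        simpa using hU _ y (by simpa using hy)
      have h2 := Finset.eq_of_subset_of_card_le h1 (U.toFinset_card_le.trans h)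
      have : y ∈ U.toFinset := by simpa using hU _ y hy
      rw [← h2] at this; simpa using this
  rw [hcl]
  constructor
  · have : ∀ i y, y ∈ F^[i] [] → Reaches (fun a => start a = true)
        (fun a b => edge a b = true) y := by
      intro i
      induction i with
      | zero => simp
      | succ i ih =>
        intro y hy
        rw [Function.iterate_succ_apply', mem_F] at hy
        rcases hy with h | ⟨z, hz, h⟩
        · exact .base h
        · exact .step (ih z hz) h
    exact this _ a
  · intro h
    induction h with
    | base h => exact fin (by rw [Function.iterate_succ_apply', mem_F]; exact Or.inl h)
    | step _ h ih =>
      exact fin (by rw [Function.iterate_succ_apply', mem_F]; exact Or.inr ⟨_, ih, h⟩)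

theorem PTime.reachList {U : Val → List Val} {start : Val → Val → Bool}
    {edge : Val → Val → Val → Bool} (hU : PTime U)
    (hs : PTime fun z => start z.left z.right)
    (he : PTime fun z => edge z.left z.right.left z.right.right) :
    PTime fun x => reachList (U x) (fun y => start y x) fun z y => edge z y x := by
  obtain ⟨p, hp⟩ := hU.exists_size_le
  have key : ∀ x (l R : List Val), Val.ofL (l.foldl (fun R _ => (U x).filter fun y =>
        start y x || R.any fun z => edge z y x) R) =
      l.foldl (fun s _ => Val.ofL ((U x).filter fun y =>
        start y x || s.toL.any fun z => edge z y x)) (Val.ofL R) := by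
    intro x l
    induction l with
    | nil => intro R; rfl
    | cons a l ih => intro R; rw [List.foldl_cons, ih, List.foldl_cons, toL_ofL]
  have h := PTime.foldl (s₀ := fun _ => Val.leaf) (g := fun s _ x => Val.ofL ((U x).filter fun y =>
      start y x || s.toL.any fun z => edge z y x)) hU PTime.leaf ?_ (p + 1) ?_
  · exact h.congr_enc fun x => (key x (U x) []).symm
  · refine PolyIn.ofL (PTime.filter (PolyIn.comp hU PTime.id.right.right)
      (p := fun y z => start y z.right.right || z.left.toL.any fun w => edge w y z.right.right) ?_)
    refine (PolyIn.app2 hs PTime.id.left PTime.id.right.right.right).or ?_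
    exact PTime.any PTime.id.right.left.toL (p := fun w z => edge w z.left z.right.right.right)
      (PolyIn.app3 he PTime.id.left PTime.id.right.left PTime.id.right.right.right.right)
  · intro x l₁ l₂ _
    have h1 := (hp x).2
    rw [← ofL_nil, ← key]
    -- Each stage is filtered out of `U` afresh, so the accumulator does not grow with the number of
    -- rounds.
    have : (l₁.foldl (fun R _ => (U x).filter fun y =>
        start y x || R.any fun z => edge z y x) []).Sublist (U x) := by
      induction l₁ using List.reverseRecOn with
      | nil => exact List.nil_sublist _
      | append_singleton l a _ => rw [List.foldl_concat]; exact List.filter_sublist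
    have := size_ofL_le_of_sublist this
    simp only [enc_list] at h1
    simp only [Polynomial.eval_add, Polynomial.eval_one]
    omega

/-! ### Power sets -/

/-- The coded sublists of a list. -/
def Val.subs (l : List Val) : List Val :=
  (l.reverse.foldl (fun s b => Val.ofL (s.toL ++ s.toL.map (Val.node b)))
    (.node .leaf .leaf)).toL

theorem Val.subs_aux (l : List Val) :
    l.reverse.foldl (fun s b => Val.ofL (s.toL ++ s.toL.map (Val.node b))) (.node .leaf .leaf) =
      Val.ofL (l.sublists'.map Val.ofL) := by
  rw [List.foldl_reverse]
  induction l with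
  | nil => rfl
  | cons a l ih => rw [List.foldr_cons, ih]; simp [Function.comp_def]

theorem Val.subs_eq (l : List Val) : Val.subs l = l.sublists'.map Val.ofL := by
  rw [Val.subs, subs_aux, toL_ofL]

theorem Val.size_sublists' (l : List Val) :
    (Val.ofL (l.sublists'.map Val.ofL)).size ≤ 2 ^ l.length * ((Val.ofL l).size + 2) := by
  rw [size_ofL]
  have h1 : ((l.sublists'.map Val.ofL).map Val.size).sum ≤ 2 ^ l.length * (Val.ofL l).size := by
    have := List.sum_le_card_nsmul ((l.sublists'.map Val.ofL).map Val.size) (Val.ofL l).size (by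
      intro m hm
      simp only [List.map_map, List.mem_map, List.mem_sublists'] at hm
      obtain ⟨s, hs, rfl⟩ := hm
      exact size_ofL_le_of_sublist hs)
    simpa using this
  have h2 : 1 ≤ 2 ^ l.length := Nat.one_le_two_pow
  simp only [List.length_map, List.length_sublists']
  nlinarith

/-- This is the one operation that is not polynomial in the size of its argument. Its measure bounds
the coded power set of the whole list, and hence that of each part treated so far. -/
theorem PolyIn.subs :
    PolyIn (fun v => 2 ^ v.toL.length * (v.size + 2)) fun v => Val.subs v.toL := by
  have hB : ∀ v : Val, v.size ≤ 2 ^ v.toL.length * (v.size + 2) := fun v => by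
    have h2 : 1 ≤ 2 ^ v.toL.length := Nat.one_le_two_pow
    nlinarith
  have lift : ∀ {β : Type} [Enc β] {f : Val → β}, PTime f →
      PolyIn (fun v => 2 ^ v.toL.length * (v.size + 2)) f := by
    intro β _ f hf
    exact PolyIn.comp (f := fun x => x) hf ⟨.skip, .X, fun x => ⟨_, .skip x, by simpa using hB x⟩⟩
  refine PolyIn.toL (PolyIn.foldl
    (g := fun s b _ => Val.ofL (s.toL ++ s.toL.map (Val.node b))) hB
    (lift (PTime.reverse PTime.id.toL)) (lift (PTime.leaf.node PTime.leaf)) ?_ .X ?_)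
  · exact PolyIn.ofL (PTime.append PTime.id.left.toL
      (PTime.map (f := fun a z => Val.node z.right.left a) PTime.id.left.toL
        (PTime.id.right.right.left.node PTime.id.left)))
  · intro v l₁ l₂ h
    have h1 := subs_aux l₁.reverse
    rw [List.reverse_reverse] at h1
    rw [h1, Polynomial.eval_X]
    have h2 := congrArg List.reverse h
    rw [List.reverse_append, List.reverse_reverse] at h2
    have h3 : l₁.reverse.length ≤ v.toL.length := by rw [h2]; simp
    have h4 : (Val.ofL l₁.reverse).size ≤ v.size := by
      conv_rhs => rw [← ofL_toL v, h2]
      exact size_ofL_le_of_sublist (List.sublist_append_right _ _)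
    exact (size_sublists' _).trans (Nat.mul_le_mul (Nat.pow_le_pow_right (by norm_num) h3)
      (by omega))

/-! ### Word-checking games -/

namespace AltAut

variable {A Q : Type}

/-- Rejector strategies may be given as functions of infinite plays of which they only look at
the initial segment that has been played. -/
theorem rejects_iff (𝒜 : AltAut A Q) (q : Q) (w : Stream' A) :
    (𝒜.withInit q).Rejects w ↔ ∃ σ : ℕ → (ℕ → Q) → List Q,
      (∀ i ρ ρ', (∀ j ≤ i, ρ j = ρ' j) → σ i ρ = σ i ρ') ∧
      (∀ i ρ, σ i ρ ∈ (𝒜.δ (ρ i) (w.get i)).clauses) ∧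
      ∀ ρ, ρ 0 = q → (∀ i, ρ (i + 1) ∈ σ i ρ) → ¬ ∃ N, ∀ i, N ≤ i → ρ i ∈ 𝒜.acc := by
  classical
  constructor
  · rintro ⟨rej, hrej, hwin⟩
    refine ⟨fun i ρ => rej ((List.range i).map ρ ++ [ρ i]) i, ?_, fun i ρ => hrej _ _ _, ?_⟩
    · intro i ρ ρ' h
      have : (List.range i).map ρ = (List.range i).map ρ' :=
        List.map_congr_left fun j hj => h j (List.mem_range.1 hj).le
      simp only [this, h i le_rfl]
    · rintro ρ h0 hρ ⟨N, hN⟩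
      -- The given play `ρ` is built into the acceptor's strategy. The head of the clause is a
      -- default that keeps the strategy legal where `ρ` cannot be followed.
      set acc : List (List Q) → ℕ → Q := fun cs i =>
        if ρ (i + 1) ∈ cs.getLastD [] then ρ (i + 1) else (cs.getLastD []).headD (ρ 0) with hacc
      have hA : IsAccStrategy acc := by
        intro cs c i hc
        simp only [hacc, List.getLastD_concat]
        split_ifs with h
        · exact h
        · cases c with
          | nil => exact absurd rfl hc
          | cons a c => simp
      refine hwin acc hA ⟨N, fun i hi => ?_⟩
      have key : ∀ i, (gamePos q rej acc i).past = (List.range i).map ρ ∧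
          (gamePos q rej acc i).cur = ρ i := by
        intro i
        induction i with
        | zero => exact ⟨rfl, h0.symm⟩
        | succ i ih =>
          obtain ⟨h1, h2⟩ := ih
          refine ⟨?_, ?_⟩
          · simp [gamePos, h1, h2, List.range_succ]
          · have := hρ i
            have h3 : (gamePos q rej acc (i + 1)).cur = acc ((gamePos q rej acc i).picked ++
              [rej ((gamePos q rej acc i).past ++ [(gamePos q rej acc i).cur]) i]) i := rfl
            rw [h3, h1, h2]
            simp only [hacc, List.getLastD_concat]
            exact if_pos this
      change (gamePos q rej acc i).cur ∈ 𝒜.acc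
      rw [(key i).2]; exact hN i hi
  · rintro ⟨σ, hloc, hval, hwin⟩
    have hdef : ∀ q i, ∃ c, c ∈ (𝒜.δ q (w.get i)).clauses := fun q i =>
      List.exists_mem_of_ne_nil _ (𝒜.δ q (w.get i)).clauses_ne
    choose d hd using hdef
    -- A history in a genuine play has length `i + 1` at index `i`. On all others an arbitrary
    -- clause keeps the strategy legal.
    set rej : List Q → ℕ → List Q := fun h i =>
      if h.length = i + 1 then σ i (fun j => h.getD j q) else d (h.getLastD q) i with hrej
    refine ⟨rej, ?_, ?_⟩
    · intro h q' i
      change rej (h ++ [q']) i ∈ (𝒜.δ q' (w.get i)).clauses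
      by_cases hl : h.length = i
      · have := hval i fun j => (h ++ [q']).getD j q
        have h' : (h ++ [q']).getD i q = q' := by simp [List.getD, ← hl]
        rw [h'] at this
        simpa [hrej, hl] using this
      · simpa [hrej, hl] using hd q' i
    · rintro acc hacc ⟨N, hN⟩
      refine hwin (fun i => (gamePos q rej acc i).cur) rfl (fun i => ?_) ⟨N, fun i hi => hN i hi⟩
      have key : ∀ i, (gamePos q rej acc i).past =
          (List.range i).map fun i => (gamePos q rej acc i).cur := by
        intro i
        induction i with
        | zero => rfl
        | succ i ih => rw [List.range_succ, List.map_append, ← ih]; rfl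
      have h1 : rej ((gamePos q rej acc i).past ++ [(gamePos q rej acc i).cur]) i =
          σ i fun i => (gamePos q rej acc i).cur := by
        rw [key]
        simp only [hrej, List.length_append, List.length_map, List.length_range,
          List.length_singleton, if_true]
        refine hloc _ _ _ fun j hj => ?_
        rcases hj.lt_or_eq with hj | rfl
        · simp [List.getD, List.getElem?_append, hj]
        · simp [List.getD]
      have h2 : (gamePos q rej acc (i + 1)).cur = acc ((gamePos q rej acc i).picked ++
          [rej ((gamePos q rej acc i).past ++ [(gamePos q rej acc i).cur]) i]) i := rfl
      change (gamePos q rej acc (i + 1)).cur ∈ _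
      rw [h2, h1]
      exact hacc _ _ _ ((𝒜.δ _ (w.get i)).clause_ne _
        (hval i fun i => (gamePos q rej acc i).cur))

/-- The rejector wins from all states in `K 0` if, as long as the play is in `K`, he can force it
to stay in `K` or to reach a position that he wins, and wins all plays that stay in `K`. -/
theorem rejects_of_invariant (𝒜 : AltAut A Q) (w : Stream' A) (K : ℕ → Set Q)
    (cl : ℕ → Q → List Q) (hcl : ∀ i, ∀ q ∈ K i, cl i q ∈ (𝒜.δ q (w.get i)).clauses ∧
      ∀ q' ∈ cl i q, q' ∈ K (i + 1) ∨ (𝒜.withInit q').Rejects (w.drop (i + 1)))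
    (hK : ∀ ρ : ℕ → Q, (∀ i, ρ i ∈ K i ∧ ρ (i + 1) ∈ cl i (ρ i)) →
      ¬ ∃ N, ∀ i, N ≤ i → ρ i ∈ 𝒜.acc) (q : Q) (hq : q ∈ K 0) :
    (𝒜.withInit q).Rejects w := by
  classical
  -- A strategy for the game on the suffix is fixed for every time and state, always legal, and
  -- winning wherever the rejector can win.
  have hr : ∀ m q', ∃ σ : ℕ → (ℕ → Q) → List Q,
      (∀ i ρ ρ', (∀ j ≤ i, ρ j = ρ' j) → σ i ρ = σ i ρ') ∧
      (∀ i ρ, σ i ρ ∈ (𝒜.δ (ρ i) (w.get (m + i))).clauses) ∧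
      ((𝒜.withInit q').Rejects (w.drop m) → ∀ ρ, ρ 0 = q' → (∀ i, ρ (i + 1) ∈ σ i ρ) →
        ¬ ∃ N, ∀ i, N ≤ i → ρ i ∈ 𝒜.acc) := by
    intro m q'
    by_cases h : (𝒜.withInit q').Rejects (w.drop m)
    · obtain ⟨σ, h1, h2, h3⟩ := (rejects_iff 𝒜 q' (w.drop m)).1 h
      refine ⟨σ, h1, fun i ρ => ?_, fun _ => h3⟩
      have := h2 i ρ
      rwa [Stream'.get_drop] at this
    · have hdef : ∀ q i, ∃ c, c ∈ (𝒜.δ q (w.get (m + i))).clauses := fun q i =>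
        List.exists_mem_of_ne_nil _ (𝒜.δ q (w.get (m + i))).clauses_ne
      choose d hd using hdef
      exact ⟨fun i ρ => d (ρ i) i, fun i ρ ρ' h => by simp [h i le_rfl], fun i ρ => hd _ _,
        fun h' => absurd h' h⟩
  choose rs hloc hval hwin using hr
  rw [rejects_iff]
  -- The rejector plays `cl` inside `K` and switches for good, at the first exit from `K`, to the
  -- strategy fixed for that time and state.
  refine ⟨fun i ρ => if h : ∃ m ≤ i, ρ m ∉ K m then
      rs (Nat.find h) (ρ (Nat.find h)) (i - Nat.find h) (fun j => ρ (Nat.find h + j))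
    else cl i (ρ i), ?_, ?_, ?_⟩
  · intro i ρ ρ' h
    have hP : ∀ m, (m ≤ i ∧ ρ m ∉ K m) ↔ (m ≤ i ∧ ρ' m ∉ K m) := fun m =>
      and_congr_right fun hm => by rw [h m hm]
    by_cases hm : ∃ m ≤ i, ρ m ∉ K m
    · have hm' : ∃ m ≤ i, ρ' m ∉ K m := by simpa only [hP] using hm
      have hf : Nat.find hm = Nat.find hm' := by
        congr 1; funext m; exact propext (hP m)
      have hle := (Nat.find_spec hm).1
      simp only [dif_pos hm, dif_pos hm']
      rw [← hf, h _ hle]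
      exact hloc _ _ _ _ _ fun j hj => h _ (by omega)
    · have hm' : ¬ ∃ m ≤ i, ρ' m ∉ K m := by simpa only [hP] using hm
      simp only [dif_neg hm, dif_neg hm', h i le_rfl]
  · intro i ρ
    by_cases hm : ∃ m ≤ i, ρ m ∉ K m
    · have hle := (Nat.find_spec hm).1
      have := hval (Nat.find hm) (ρ (Nat.find hm)) (i - Nat.find hm)
        fun j => ρ (Nat.find hm + j)
      simp only [dif_pos hm]
      beta_reduce at this
      rwa [show Nat.find hm + (i - Nat.find hm) = i by omega] at this
    · simp only [dif_neg hm]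
      push Not at hm
      exact (hcl i (ρ i) (hm i le_rfl)).1
  · intro ρ h0 hρ
    by_cases hm : ∃ m, ρ m ∉ K m
    · have hspec := Nat.find_spec hm
      have hmin : ∀ j < Nat.find hm, ρ j ∈ K j := fun j hj => not_not.1 (Nat.find_min hm hj)
      set m := Nat.find hm
      have hm0 : m ≠ 0 := fun h => hspec (by rw [h, h0]; exact hq)
      obtain ⟨n, hn⟩ := Nat.exists_eq_succ_of_ne_zero hm0
      have h1 := hρ n
      beta_reduce at h1
      rw [dif_neg (by push Not; exact fun j hj => hmin j (by omega))] at h1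
      have h2 := (hcl n (ρ n) (hmin n (by omega))).2 _ h1
      rw [show n + 1 = m by omega] at h2
      have h3 := h2.resolve_left hspec
      have hfind : ∀ i (h : ∃ m' ≤ m + i, ρ m' ∉ K m'), Nat.find h = m := fun i h => by
        rw [Nat.find_eq_iff]
        exact ⟨⟨by omega, hspec⟩, fun j hj hj' => hj'.2 (hmin j hj)⟩
      have h4 := hwin m (ρ m) h3 (fun j => ρ (m + j)) rfl (fun i => by
        have h5 := hρ (m + i)
        beta_reduce at h5
        have h6 : ∃ m' ≤ m + i, ρ m' ∉ K m' := ⟨m, by omega, hspec⟩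
        rw [dif_pos h6] at h5
        simp only [hfind i h6] at h5
        rwa [show m + i - m = i by omega] at h5)
      rintro ⟨N, hN⟩
      exact h4 ⟨N, fun i hi => hN _ (by omega)⟩
    · push Not at hm
      refine hK ρ fun i => ⟨hm i, ?_⟩
      have h1 := hρ i
      beta_reduce at h1
      rwa [dif_neg (by push Not; exact fun j _ => hm j)] at h1

/-- The rejector does not win from any state in `K 0` if, as long as the play is in `K`, the
acceptor can force it to stay in `K` or to reach a position that the rejector does not win, and
wins all plays that stay in `K`. -/
theorem not_rejects_of_invariant (𝒜 : AltAut A Q) (w : Stream' A) (K : ℕ → Set Q)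
    (nx : ℕ → Q → List Q → Q) (hnx : ∀ i, ∀ q ∈ K i, ∀ c ∈ (𝒜.δ q (w.get i)).clauses,
      nx i q c ∈ c ∧
        (nx i q c ∈ K (i + 1) ∨ ¬ (𝒜.withInit (nx i q c)).Rejects (w.drop (i + 1))))
    (hK : ∀ ρ : ℕ → Q,
      (∀ i, ρ i ∈ K i ∧ ∃ c ∈ (𝒜.δ (ρ i) (w.get i)).clauses, ρ (i + 1) = nx i (ρ i) c) →
      ∃ N, ∀ i, N ≤ i → ρ i ∈ 𝒜.acc) (q : Q) (hq : q ∈ K 0) :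
    ¬ (𝒜.withInit q).Rejects w := by
  classical
  rw [rejects_iff]
  rintro ⟨σ, hloc, hval, hwin⟩
  -- `P i` is correct up to time `i` only. As `σ` looks at no later entries, the diagonal of `P` is
  -- the play of `nx` against `σ`.
  set P : ℕ → ℕ → Q := fun i => Nat.rec (fun _ => q)
    (fun i Pi => Function.update Pi (i + 1) (nx i (Pi i) (σ i Pi))) i with hP
  have hPs : ∀ i, P (i + 1) = Function.update (P i) (i + 1) (nx i (P i i) (σ i (P i))) :=
    fun i => rfl
  set ρ : ℕ → Q := fun i => P i i with hρ
  have hagree : ∀ i, ∀ j ≤ i, P i j = ρ j := by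
    intro i
    induction i with
    | zero => intro j hj; obtain rfl : j = 0 := by omega
              rfl
    | succ i ih =>
      intro j hj
      rcases hj.lt_or_eq with hj | rfl
      · rw [hPs, Function.update_of_ne (by omega)]; exact ih j (by omega)
      · rfl
  have hstep : ∀ i, ρ (i + 1) = nx i (ρ i) (σ i ρ) := by
    intro i
    have : σ i (P i) = σ i ρ := hloc _ _ _ (hagree i)
    rw [← this]
    change P (i + 1) (i + 1) = _
    rw [hPs, Function.update_self]
  by_cases hm : ∃ m, ρ m ∉ K m
  · have hspec := Nat.find_spec hm
    have hmin : ∀ j < Nat.find hm, ρ j ∈ K j := fun j hj => not_not.1 (Nat.find_min hm hj)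
    set m := Nat.find hm
    have hm0 : m ≠ 0 := fun h => hspec (by rw [h]; exact hq)
    obtain ⟨n, hn⟩ := Nat.exists_eq_succ_of_ne_zero hm0
    have h1 := hnx n (ρ n) (hmin n (by omega)) _ (hval n ρ)
    rw [← hstep, show n + 1 = m by omega] at h1
    refine h1.2.resolve_left hspec ?_
    rw [rejects_iff]
    -- Prefixing the history up to the exit turns `σ` into a winning strategy of the rejector from
    -- the exit state, where he was assumed not to win.
    set sp : (ℕ → Q) → ℕ → Q := fun ρ' j => if j < m then ρ j else ρ' (j - m) with hsp
    refine ⟨fun i ρ' => σ (m + i) (sp ρ'), fun i ρ' ρ'' h => hloc _ _ _ fun j hj => ?_,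
      fun i ρ' => ?_, fun ρ' h0 hρ' => ?_⟩
    · simp only [hsp]
      split_ifs
      · rfl
      · exact h _ (by omega)
    · have := hval (m + i) (sp ρ')
      rw [Stream'.get_drop]
      rwa [show sp ρ' (m + i) = ρ' i by simp [hsp]] at this
    · rintro ⟨N, hN⟩
      have hsp0 : ∀ j ≤ m, sp ρ' j = ρ j := fun j hj => by
        rcases hj.lt_or_eq with hj | rfl
        · simp [hsp, hj]
        · simp [hsp, h0]
      refine hwin (sp ρ') (hsp0 0 (by omega)) (fun i => ?_) ⟨m + N, fun i hi => ?_⟩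
      · by_cases hi : i < m
        · rw [hsp0 (i + 1) (by omega), hloc i (sp ρ') ρ fun j hj => hsp0 j (by omega), hstep]
          exact (hnx i (ρ i) (hmin i hi) _ (hval i ρ)).1
        · have := hρ' (i - m)
          beta_reduce at this
          rw [show m + (i - m) = i by omega] at this
          rwa [show sp ρ' (i + 1) = ρ' (i - m + 1) by
            simp only [hsp]; rw [if_neg (by omega)]; congr 1; omega]
      · have := hN (i - m) (by omega)
        rwa [show sp ρ' i = ρ' (i - m) by simp only [hsp]; rw [if_neg (by omega)]]
  · push Not at hm
    refine hwin ρ rfl (fun i => ?_) (hK ρ fun i => ⟨hm i, _, hval i ρ, hstep i⟩)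
    rw [hstep]
    exact (hnx i (ρ i) (hm i) _ (hval i ρ)).1

/-- Both directions use an invariant that holds only at time 0. Every play leaves it after one move,
so its infinite-play condition is vacuous. -/
theorem rejects_cons (𝒜 : AltAut A Q) (q : Q) (x : A) (w : Stream' A) :
    (𝒜.withInit q).Rejects (Stream'.cons x w) ↔
      ∃ c ∈ (𝒜.δ q x).clauses, ∀ q' ∈ c, (𝒜.withInit q').Rejects w := by
  classical
  constructor
  · intro h
    by_contra hc
    push Not at hc
    have h' : ∀ c, ∃ q', c ∈ (𝒜.δ q x).clauses → q' ∈ c ∧ ¬ (𝒜.withInit q').Rejects w := by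
      intro c
      by_cases hc' : c ∈ (𝒜.δ q x).clauses
      · obtain ⟨q', h1, h2⟩ := hc c hc'
        exact ⟨q', fun _ => ⟨h1, h2⟩⟩
      · exact ⟨q, fun h => absurd h hc'⟩
    choose f hf using h'
    refine not_rejects_of_invariant 𝒜 (Stream'.cons x w) (fun i => {q' | i = 0 ∧ q' = q})
      (fun _ _ c => f c) ?_ ?_ q ⟨rfl, rfl⟩ h
    · rintro _ _ ⟨rfl, rfl⟩ c hc
      exact ⟨(hf c hc).1, Or.inr (hf c hc).2⟩
    · intro ρ hρ
      exact absurd (hρ 1).1.1 one_ne_zero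
  · rintro ⟨c, hc, h⟩
    refine rejects_of_invariant 𝒜 (Stream'.cons x w) (fun i => {q' | i = 0 ∧ q' = q})
      (fun _ _ => c) ?_ ?_ q ⟨rfl, rfl⟩
    · rintro _ _ ⟨rfl, rfl⟩
      exact ⟨hc, fun q' hq' => Or.inr (h q' hq')⟩
    · intro ρ hρ
      exact absurd (hρ 1).1.1 one_ne_zero

end AltAut

/-! ### Types of words -/

namespace PCNF

variable {X : Type}

theorem SatBy.mono {φ : PCNF X} {S T : Finset X} (h : φ.SatBy S) (hST : S ⊆ T) : φ.SatBy T :=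
  fun c hc => (h c hc).imp fun _ hq => ⟨hq.1, hST hq.2⟩

theorem not_satBy {φ : PCNF X} {S : Finset X} :
    ¬ φ.SatBy S ↔ ∃ c ∈ φ.clauses, ∀ q ∈ c, q ∉ S := by
  simp [SatBy]

end PCNF

namespace AltAut

variable {A Q : Type}

/-- Along a play of a weak automaton, visiting accepting states infinitely often amounts to
visiting only accepting states from some point on. -/
theorem IsWeak.eventually_acc [Finite Q] {𝒜 : AltAut A Q} (h𝒜 : 𝒜.IsWeak) (w : Stream' A)
    (ρ : ℕ → Q) (hρ : ∀ i, (𝒜.δ (ρ i) (w.get i)).Appears (ρ (i + 1)))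
    (hinf : ∀ N, ∃ i ≥ N, ρ i ∈ 𝒜.acc) : ∃ N, ∀ i, N ≤ i → ρ i ∈ 𝒜.acc := by
  obtain ⟨le, htot, htr, hδ, hacc⟩ := h𝒜
  have hle : ∀ i j, i ≤ j → le (ρ j) (ρ i) := by
    intro i j h
    induction j, h using Nat.le_induction with
    | base => exact (htot _ _).elim id id
    | succ j _ ih => exact htr _ _ _ (hδ _ _ _ (hρ j)) ih
  -- Plays descend in the preorder, so between two visits to a recurring state they stay in its
  -- equivalence class, where acceptance is constant.
  obtain ⟨q, hq⟩ := Finite.exists_infinite_fiber ρ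
  have hq' : ∀ N, ∃ i ≥ N, ρ i = q := by
    intro N
    obtain ⟨i, hi, hN⟩ := (Set.infinite_coe_iff.1 hq).exists_gt N
    exact ⟨i, hN.le, hi⟩
  obtain ⟨i₀, -, h₀⟩ := hq' 0
  have heq : ∀ j ≥ i₀, ρ j ∈ 𝒜.acc ↔ q ∈ 𝒜.acc := by
    intro j hj
    obtain ⟨k, hk, hkq⟩ := hq' j
    exact hacc _ _ (h₀ ▸ hle _ _ hj) (hkq ▸ hle _ _ hk)
  obtain ⟨j, hj, hjF⟩ := hinf i₀
  exact ⟨i₀, fun i hi => (heq i hi).2 ((heq j hj).1 hjF)⟩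

/-! ### Types and their backward propagation -/

variable [Fintype Q]

open Classical in
/-- The states whose transition formulas for a letter are satisfied by a set. -/
noncomputable def pre (𝒜 : AltAut A Q) (x : A) (τ : Finset Q) : Finset Q :=
  Finset.univ.filter fun q => (𝒜.δ q x).SatBy τ

/-- The iteration of `pre` along a finite word, from its end. -/
noncomputable def preWord (𝒜 : AltAut A Q) (p : List A) (τ : Finset Q) : Finset Q :=
  p.foldr 𝒜.pre τ

open Classical in
/-- The type of a word: the set of states from which it is accepted. -/
noncomputable def typ (𝒜 : AltAut A Q) (w : Stream' A) : Finset Q :=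
  Finset.univ.filter fun q => w ∈ (𝒜.withInit q).language

@[simp] theorem mem_pre {𝒜 : AltAut A Q} {x : A} {τ : Finset Q} {q : Q} :
    q ∈ 𝒜.pre x τ ↔ (𝒜.δ q x).SatBy τ := by simp [pre]

theorem mem_typ {𝒜 : AltAut A Q} {w : Stream' A} {q : Q} :
    q ∈ 𝒜.typ w ↔ ¬ (𝒜.withInit q).Rejects w := by
  classical
  rw [typ, Finset.mem_filter_univ]; rfl

theorem typ_cons (𝒜 : AltAut A Q) (x : A) (w : Stream' A) :
    𝒜.typ (Stream'.cons x w) = 𝒜.pre x (𝒜.typ w) := by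
  ext q
  rw [mem_typ, rejects_cons, mem_pre]
  simp [PCNF.SatBy, mem_typ]

theorem typ_eq_pre (𝒜 : AltAut A Q) (w : Stream' A) :
    𝒜.typ w = 𝒜.pre w.head (𝒜.typ w.tail) := by
  rw [← typ_cons, Stream'.eta]

theorem typ_append (𝒜 : AltAut A Q) (p : List A) (w : Stream' A) :
    𝒜.typ (p ++ₛ w) = 𝒜.preWord p (𝒜.typ w) := by
  induction p with
  | nil => rfl
  | cons x p ih => rw [Stream'.cons_append_stream, typ_cons, ih]; rfl

open Classical in
/-- The types of infinite words. -/
noncomputable def types (𝒜 : AltAut A Q) : Finset (Finset Q) :=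
  Finset.univ.filter fun τ => ∃ w, 𝒜.typ w = τ

@[simp] theorem mem_types {𝒜 : AltAut A Q} {τ : Finset Q} :
    τ ∈ 𝒜.types ↔ ∃ w, 𝒜.typ w = τ := by simp [types]

theorem typ_mem_types (𝒜 : AltAut A Q) (w : Stream' A) : 𝒜.typ w ∈ 𝒜.types :=
  mem_types.2 ⟨w, rfl⟩

theorem pre_mono (𝒜 : AltAut A Q) (x : A) {τ τ' : Finset Q} (h : τ ⊆ τ') :
    𝒜.pre x τ ⊆ 𝒜.pre x τ' := fun q hq => by
  rw [mem_pre] at hq ⊢; exact hq.mono h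

theorem preWord_mono (𝒜 : AltAut A Q) (p : List A) {τ τ' : Finset Q} (h : τ ⊆ τ') :
    𝒜.preWord p τ ⊆ 𝒜.preWord p τ' := by
  induction p with
  | nil => exact h
  | cons x p ih => exact 𝒜.pre_mono x ih

theorem preWord_append (𝒜 : AltAut A Q) (p p' : List A) (τ : Finset Q) :
    𝒜.preWord (p ++ p') τ = 𝒜.preWord p (𝒜.preWord p' τ) := List.foldr_append

/-! ### Progress certificates for realised types -/

variable [DecidableEq Q]

open Classical in
/-- Backward propagation of a type together with the set of states from which the player who
should win can force a visit to a state that is good for them. -/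
noncomputable def pstep (𝒜 : AltAut A Q) (x : A) (z : Finset Q × Finset Q) :
    Finset Q × Finset Q :=
  (𝒜.pre x z.1, Finset.univ.filter fun q => (q ∈ 𝒜.pre x z.1 ↔ q ∈ 𝒜.acc) ∨
    (q ∈ 𝒜.pre x z.1 ∧ (𝒜.δ q x).SatBy (z.2 ∩ z.1)) ∨
    (q ∉ 𝒜.pre x z.1 ∧ ¬ (𝒜.δ q x).SatBy (z.1 ∪ z.2ᶜ)))

open Classical in
/-- A type together with the set of states that are good for the player who should win. -/
noncomputable def pinit (𝒜 : AltAut A Q) (τ : Finset Q) : Finset Q × Finset Q :=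
  (τ, Finset.univ.filter fun q => (q ∈ τ ↔ q ∈ 𝒜.acc))

/-- The iteration of `pstep` along a finite word, from its end. -/
noncomputable def pword (𝒜 : AltAut A Q) (p : List A) (z : Finset Q × Finset Q) :
    Finset Q × Finset Q := p.foldr 𝒜.pstep z

theorem pword_fst (𝒜 : AltAut A Q) (p : List A) (z : Finset Q × Finset Q) :
    (𝒜.pword p z).1 = 𝒜.preWord p z.1 := by
  induction p with
  | nil => rfl
  | cons x p ih => exact congrArg (𝒜.pre x) ih

/-- Breakpoints `b` cut the word into segments. `D` marks the states whose designated winner can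
still force a good visit by the next breakpoint; `D'` agrees with it except at breakpoints, where
`D` is everything while `D'` holds only the good states at which a segment may end. Hence good
visits recur forever, and the designated winners do win. -/
theorem typ_eq_of_progress {𝒜 : AltAut A Q} (h𝒜 : 𝒜.IsWeak) (w : Stream' A)
    (τ D D' : ℕ → Finset Q) (b : ℕ → Prop) (hb : ∀ N, ∃ i ≥ N, b i)
    (h1 : ∀ i, b i → D i = Finset.univ ∧ D' i = (𝒜.pinit (τ i)).2)
    (h2 : ∀ i, ¬ b i → D' i = D i)
    (hstep : ∀ i, (τ i, D i) = 𝒜.pstep (w.get i) (τ (i + 1), D' (i + 1))) :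
    𝒜.typ w = τ 0 := by
  classical
  have hτ : ∀ i, τ i = 𝒜.pre (w.get i) (τ (i + 1)) := fun i => congrArg Prod.fst (hstep i)
  have hD : ∀ i q, q ∈ D i ↔ (q ∈ τ i ↔ q ∈ 𝒜.acc) ∨
      (q ∈ τ i ∧ (𝒜.δ q (w.get i)).SatBy (D' (i + 1) ∩ τ (i + 1))) ∨
      (q ∉ τ i ∧ ¬ (𝒜.δ q (w.get i)).SatBy (τ (i + 1) ∪ (D' (i + 1))ᶜ)) := by
    intro i q
    rw [show D i = (𝒜.pstep (w.get i) (τ (i + 1), D' (i + 1))).2 from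
      congrArg Prod.snd (hstep i), hτ i]
    simp [pstep]
  -- Without good visits after `N`, the play would remain in `D` from some breakpoint on and enter
  -- `D'` at the next breakpoint, which is a good visit.
  have visit : ∀ ρ : ℕ → Q, (∀ i, ρ i ∈ D i → ¬ (ρ i ∈ τ i ↔ ρ i ∈ 𝒜.acc) →
      ρ (i + 1) ∈ D' (i + 1)) → ∀ N, ∃ i ≥ N, (ρ i ∈ τ i ↔ ρ i ∈ 𝒜.acc) := by
    intro ρ hρ N
    by_contra hno
    push Not at hno
    have hno' : ∀ i ≥ N, ¬ (ρ i ∈ τ i ↔ ρ i ∈ 𝒜.acc) := fun i hi h => by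
      have := hno i hi; tauto
    obtain ⟨i, hi, hbi⟩ := hb N
    have key : ∀ j ≥ i, ρ j ∈ D j := by
      intro j hj
      induction j, hj using Nat.le_induction with
      | base => rw [(h1 i hbi).1]; exact Finset.mem_univ _
      | succ j hj ih =>
        have := hρ j ih (hno' j (by omega))
        by_cases hbj : b (j + 1)
        · rw [(h1 _ hbj).1]; exact Finset.mem_univ _
        · rwa [h2 _ hbj] at this
    obtain ⟨j, hj, hbj⟩ := hb (i + 1)
    obtain ⟨k, rfl⟩ := Nat.exists_eq_add_of_le' hj
    rw [show k + (i + 1) = k + i + 1 by ring] at hbj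
    have := hρ (k + i) (key _ (by omega)) (hno' _ (by omega))
    rw [(h1 _ hbj).2] at this
    exact hno' (k + i + 1) (by omega) (by simpa [pinit] using this)
  ext q
  constructor
  · contrapose!
    intro hq
    rw [mem_typ, not_not]
    -- The rejector always keeps outside the types, and whenever some clause allows it he also keeps
    -- inside `D'`.
    have hex : ∀ i q, ∃ c, q ∉ τ i → c ∈ (𝒜.δ q (w.get i)).clauses ∧ (∀ q' ∈ c, q' ∉ τ (i + 1)) ∧
        (¬ (𝒜.δ q (w.get i)).SatBy (τ (i + 1) ∪ (D' (i + 1))ᶜ) → ∀ q' ∈ c, q' ∈ D' (i + 1)) := by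
      intro i q
      by_cases hs : (𝒜.δ q (w.get i)).SatBy (τ (i + 1) ∪ (D' (i + 1))ᶜ)
      · by_cases hq : q ∈ τ i
        · exact ⟨[], fun h => absurd hq h⟩
        · have hq' := hq
          rw [hτ, mem_pre, PCNF.not_satBy] at hq'
          obtain ⟨c, hc, h⟩ := hq'
          exact ⟨c, fun _ => ⟨hc, h, fun h => absurd hs h⟩⟩
      · obtain ⟨c, hc, h⟩ := PCNF.not_satBy.1 hs
        simp only [Finset.mem_union, Finset.mem_compl, not_or, not_not] at h
        exact ⟨c, fun _ => ⟨hc, fun q' hq' => (h q' hq').1, fun _ q' hq' => (h q' hq').2⟩⟩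
    choose cl hcl using hex
    refine rejects_of_invariant 𝒜 w (fun i => {q | q ∉ τ i}) cl
      (fun i q hq => ⟨(hcl i q hq).1, fun q' hq' => Or.inl ((hcl i q hq).2.1 q' hq')⟩) ?_ q hq
    rintro ρ hρ ⟨N, hN⟩
    obtain ⟨i, hi, h⟩ := visit ρ (fun i hi hn => by
      have hi' := (hD i _).1 hi
      have hτi : ρ i ∉ τ i := (hρ i).1
      refine (hcl i _ hτi).2.2 ?_ _ (hρ i).2
      tauto) N
    exact (hρ i).1 (h.2 (hN i hi))
  · intro hq
    rw [mem_typ]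
    have hex : ∀ i q c, ∃ q', q ∈ τ i → c ∈ (𝒜.δ q (w.get i)).clauses → q' ∈ c ∧ q' ∈ τ (i + 1) ∧
        ((𝒜.δ q (w.get i)).SatBy (D' (i + 1) ∩ τ (i + 1)) → q' ∈ D' (i + 1)) := by
      intro i q c
      by_cases hc : c ∈ (𝒜.δ q (w.get i)).clauses
      · by_cases hs : (𝒜.δ q (w.get i)).SatBy (D' (i + 1) ∩ τ (i + 1))
        · obtain ⟨q', h1, h2⟩ := hs c hc
          rw [Finset.mem_inter] at h2
          exact ⟨q', fun _ _ => ⟨h1, h2.2, fun _ => h2.1⟩⟩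
        · by_cases hq : q ∈ τ i
          · have hq' := hq
            rw [hτ, mem_pre] at hq'
            obtain ⟨q', h1, h2⟩ := hq' c hc
            exact ⟨q', fun _ _ => ⟨h1, h2, fun h => absurd h hs⟩⟩
          · exact ⟨q, fun h => absurd h hq⟩
      · exact ⟨q, fun _ h => absurd h hc⟩
    choose nx hnx using hex
    refine not_rejects_of_invariant 𝒜 w (fun i => {q | q ∈ τ i}) nx
      (fun i q hq c hc => ⟨(hnx i q c hq hc).1, Or.inl (hnx i q c hq hc).2.1⟩) ?_ q hq
    intro ρ hρ
    -- Weakness is needed here: the acceptor has forced only infinitely many accepting visits.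
    refine h𝒜.eventually_acc w ρ (fun i => ?_) fun N => ?_
    · obtain ⟨h, c, hc, he⟩ := hρ i
      exact ⟨c, hc, he ▸ (hnx i _ c h hc).1⟩
    · obtain ⟨i, hi, h⟩ := visit ρ (fun i hi hn => by
        have hi' := (hD i _).1 hi
        obtain ⟨h, c, hc, he⟩ := hρ i
        have hτi : ρ i ∈ τ i := h
        rw [he]
        refine (hnx i _ c h hc).2.2 ?_
        tauto) N
      exact ⟨i, hi, h.1 (hρ i).1⟩

/-- The witness is the periodic word repeating `v`, with a breakpoint at the start of every copy. -/
theorem exists_typ_eq_of_loop {𝒜 : AltAut A Q} (h𝒜 : 𝒜.IsWeak) {σ : Finset Q} {v : List A}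
    (hv : v ≠ []) (h : 𝒜.pword v (𝒜.pinit σ) = (σ, Finset.univ)) : ∃ w, 𝒜.typ w = σ := by
  have hm : 0 < v.length := List.length_pos_iff.2 hv
  have hlt : ∀ i, i % v.length < v.length := fun i => Nat.mod_lt _ hm
  set z : ℕ → Finset Q × Finset Q := fun r => 𝒜.pword (v.drop r) (𝒜.pinit σ) with hz
  have hz0 : z 0 = (σ, Finset.univ) := h
  have hzs : ∀ r (hr : r < v.length), z r = 𝒜.pstep v[r] (z (r + 1)) := by
    intro r hr
    simp only [hz]
    rw [List.drop_eq_getElem_cons hr]; rfl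
  have hzm : z v.length = 𝒜.pinit σ := by simp [hz, pword]
  refine ⟨fun i => v[i % v.length]'(hlt i), ?_⟩
  have := typ_eq_of_progress h𝒜 (fun i => v[i % v.length]'(hlt i)) (fun i => (z (i % v.length)).1)
    (fun i => (z (i % v.length)).2)
    (fun i => if i % v.length = 0 then (𝒜.pinit (z (i % v.length)).1).2
      else (z (i % v.length)).2) (fun i => i % v.length = 0)
    (fun N => ⟨v.length * N, Nat.le_mul_of_pos_left N hm, by simp⟩)
    (fun i hi => by simp [hi, hz0]) (fun i hi => by simp [hi]) ?_
  · simpa [hz0] using this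
  · intro i
    refine (hzs _ (hlt i)).trans ?_
    change 𝒜.pstep (v[i % v.length]'(hlt i)) _ = 𝒜.pstep (v[i % v.length]'(hlt i)) _
    congr 1
    have hmod : (i + 1) % v.length =
        if i % v.length + 1 = v.length then 0 else i % v.length + 1 := by
      split_ifs with hi
      · rw [← Nat.mod_add_mod, hi, Nat.mod_self]
      · rw [← Nat.mod_add_mod, Nat.mod_eq_of_lt]
        have := hlt i
        omega
    -- Propagation within a copy starts at its end from `pinit σ`, to which `D'` is reset at the
    -- following breakpoint.
    by_cases hi : i % v.length + 1 = v.length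
    · rw [hi, hzm]
      rw [if_pos hi] at hmod
      simp [hmod, hz0]
      rfl
    · rw [if_neg hi] at hmod
      simp [hmod]

theorem exists_typ_eq {𝒜 : AltAut A Q} (h𝒜 : 𝒜.IsWeak) {σ : Finset Q} {u v : List A}
    (hv : v ≠ []) (h : 𝒜.pword v (𝒜.pinit σ) = (σ, Finset.univ)) :
    ∃ w, 𝒜.typ w = 𝒜.preWord u σ := by
  obtain ⟨w, hw⟩ := exists_typ_eq_of_loop h𝒜 hv h
  exact ⟨u ++ₛ w, by rw [typ_append, hw]⟩

/-- Progress within the first `m` letters of a word. -/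
noncomputable def progress (𝒜 : AltAut A Q) (w : Stream' A) (m : ℕ) : Finset Q × Finset Q :=
  𝒜.pword (w.take m) (𝒜.pinit (𝒜.typ (w.drop m)))

theorem progress_succ (𝒜 : AltAut A Q) (w : Stream' A) (m : ℕ) :
    𝒜.progress w (m + 1) = 𝒜.pstep w.head (𝒜.progress w.tail m) := by
  simp only [progress, Stream'.take_succ, pword, List.foldr_cons]; rfl

theorem progress_fst (𝒜 : AltAut A Q) (w : Stream' A) (m : ℕ) :
    (𝒜.progress w m).1 = 𝒜.typ w := by
  rw [progress, pword_fst, pinit, ← typ_append, Stream'.append_take_drop]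

theorem mem_progress_succ {𝒜 : AltAut A Q} {w : Stream' A} {m : ℕ} {q : Q} :
    q ∈ (𝒜.progress w (m + 1)).2 ↔ (q ∈ 𝒜.typ w ↔ q ∈ 𝒜.acc) ∨
      (q ∈ 𝒜.typ w ∧ (𝒜.δ q w.head).SatBy ((𝒜.progress w.tail m).2 ∩ 𝒜.typ w.tail)) ∨
      (q ∉ 𝒜.typ w ∧ ¬ (𝒜.δ q w.head).SatBy (𝒜.typ w.tail ∪ (𝒜.progress w.tail m).2ᶜ)) := by
  rw [progress_succ, 𝒜.typ_eq_pre w]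
  simp [pstep, progress_fst]

theorem mem_progress_zero {𝒜 : AltAut A Q} {w : Stream' A} {q : Q} :
    q ∈ (𝒜.progress w 0).2 ↔ (q ∈ 𝒜.typ w ↔ q ∈ 𝒜.acc) := by
  rw [progress, pword, Stream'.take_zero, List.foldr_nil, pinit, Finset.mem_filter_univ]
  rfl

theorem progress_mono (𝒜 : AltAut A Q) (w : Stream' A) :
    Monotone fun m => (𝒜.progress w m).2 := by
  refine monotone_nat_of_le_succ fun m => ?_
  induction m generalizing w with
  | zero =>
    intro q hq
    rw [mem_progress_zero] at hq
    exact mem_progress_succ.2 (Or.inl hq)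
  | succ m ih =>
    intro q hq
    rw [mem_progress_succ] at hq ⊢
    have h := ih w.tail
    refine hq.imp_right (Or.imp (And.imp_right fun hs => hs.mono ?_)
      (And.imp_right (mt fun hs => hs.mono ?_)))
    · exact Finset.union_subset_union_right (Finset.compl_subset_compl.2 h)
    · exact Finset.inter_subset_inter_right h

/-- There are finitely many states and progress persists for longer prefixes, so the largest waiting
time serves all states. -/
theorem exists_progress_stable (𝒜 : AltAut A Q) (w : Stream' A) :
    ∃ M, ∀ q, (∃ m, q ∈ (𝒜.progress w m).2) → ∀ m ≥ M, q ∈ (𝒜.progress w m).2 := by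
  classical
  have : ∀ q, ∃ M, (∃ m, q ∈ (𝒜.progress w m).2) → q ∈ (𝒜.progress w M).2 := by
    intro q
    by_cases h : ∃ m, q ∈ (𝒜.progress w m).2
    · exact ⟨h.choose, fun _ => h.choose_spec⟩
    · exact ⟨0, fun h' => absurd h' h⟩
  choose M hM using this
  exact ⟨Finset.univ.sup M, fun q hq m hm =>
    𝒜.progress_mono w ((Finset.le_sup (Finset.mem_univ q)).trans hm) (hM q hq)⟩

/-- If the designated winner never made progress, his opponent could always move to a state that he
himself wins or to one with the same designated winner and again no progress. Plays of the second
kind never meet a good state, so the opponent would win after all. -/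
theorem exists_mem_progress (𝒜 : AltAut A Q) (w : Stream' A) (q : Q) :
    ∃ m, q ∈ (𝒜.progress w m).2 := by
  classical
  by_contra hq
  by_cases hτ : q ∈ 𝒜.typ w
  · refine mem_typ.1 hτ ?_
    have hex : ∀ i q, ∃ c, (q ∈ 𝒜.typ (w.drop i) ∧ ¬ ∃ m, q ∈ (𝒜.progress (w.drop i) m).2) →
        c ∈ (𝒜.δ q (w.get i)).clauses ∧ ∀ q' ∈ c, (q' ∈ 𝒜.typ (w.drop (i + 1)) ∧
          ¬ ∃ m, q' ∈ (𝒜.progress (w.drop (i + 1)) m).2) ∨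
          (𝒜.withInit q').Rejects (w.drop (i + 1)) := by
      intro i q
      by_cases hK : q ∈ 𝒜.typ (w.drop i) ∧ ¬ ∃ m, q ∈ (𝒜.progress (w.drop i) m).2
      -- The opponent's clause depends on the allowed waiting time; the stable bound yields one
      -- clause that works for all waiting times.
      · obtain ⟨M, hM⟩ := 𝒜.exists_progress_stable (w.drop (i + 1))
        have h1 := mt mem_progress_succ.2 (not_exists.1 hK.2 (M + 1))
        rw [not_or, not_or, not_and] at h1
        have h2 := h1.2.1 hK.1
        rw [PCNF.not_satBy] at h2
        obtain ⟨c, hc, h⟩ := h2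
        refine ⟨c, fun _ => ⟨by simpa using hc, fun q' hq' => ?_⟩⟩
        have h3 := h q' hq'
        rw [Stream'.tail_drop, Finset.mem_inter, not_and] at h3
        by_cases h4 : q' ∈ 𝒜.typ (w.drop (i + 1))
        · exact Or.inl ⟨h4, fun h5 => h3 (hM q' h5 M le_rfl) h4⟩
        · exact Or.inr (not_not.1 (mt mem_typ.2 h4))
      · exact ⟨[], fun h => absurd h hK⟩
    choose cl hcl using hex
    refine rejects_of_invariant 𝒜 w (fun i => {q | q ∈ 𝒜.typ (w.drop i) ∧
      ¬ ∃ m, q ∈ (𝒜.progress (w.drop i) m).2}) cl (fun i q hq => hcl i q hq) ?_ q ⟨hτ, hq⟩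
    rintro ρ hρ ⟨N, hN⟩
    have h1 := (hρ N).1
    exact h1.2 ⟨0, mem_progress_zero.2 (iff_of_true h1.1 (hN N le_rfl))⟩
  · refine hτ (mem_typ.2 ?_)
    have hex : ∀ i q c, ∃ q', (q ∉ 𝒜.typ (w.drop i) ∧ ¬ ∃ m, q ∈ (𝒜.progress (w.drop i) m).2) →
        c ∈ (𝒜.δ q (w.get i)).clauses → q' ∈ c ∧ ((q' ∉ 𝒜.typ (w.drop (i + 1)) ∧
          ¬ ∃ m, q' ∈ (𝒜.progress (w.drop (i + 1)) m).2) ∨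
          ¬ (𝒜.withInit q').Rejects (w.drop (i + 1))) := by
      intro i q c
      by_cases hK : (q ∉ 𝒜.typ (w.drop i) ∧ ¬ ∃ m, q ∈ (𝒜.progress (w.drop i) m).2) ∧
          c ∈ (𝒜.δ q (w.get i)).clauses
      · obtain ⟨M, hM⟩ := 𝒜.exists_progress_stable (w.drop (i + 1))
        have h1 := mt mem_progress_succ.2 (not_exists.1 hK.1.2 (M + 1))
        rw [not_or, not_or, not_and, not_and, not_not] at h1
        obtain ⟨q', hq', h3⟩ := h1.2.2 hK.1.1 c (by simpa using hK.2)
        refine ⟨q', fun _ _ => ⟨hq', ?_⟩⟩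
        rw [Stream'.tail_drop, Finset.mem_union, Finset.mem_compl] at h3
        by_cases h4 : q' ∈ 𝒜.typ (w.drop (i + 1))
        · exact Or.inr (mem_typ.1 h4)
        · exact Or.inl ⟨h4, fun h5 => h3.resolve_left h4 (hM q' h5 M le_rfl)⟩
      · exact ⟨q, fun h h' => absurd ⟨h, h'⟩ hK⟩
    choose nx hnx using hex
    refine not_rejects_of_invariant 𝒜 w (fun i => {q | q ∉ 𝒜.typ (w.drop i) ∧
      ¬ ∃ m, q ∈ (𝒜.progress (w.drop i) m).2}) nx (fun i q hq c => hnx i q c hq) ?_ q ⟨hτ, hq⟩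
    intro ρ hρ
    refine ⟨0, fun i _ => ?_⟩
    have h1 := (hρ i).1
    by_contra h2
    exact h1.2 ⟨0, mem_progress_zero.2 (iff_of_false h1.1 h2)⟩

/-- Some type recurs by pigeonhole; `v` runs from one occurrence to another that lies beyond the
waiting times of all states. -/
theorem exists_loop (𝒜 : AltAut A Q) (w : Stream' A) : ∃ σ u v, v ≠ [] ∧
    𝒜.pword v (𝒜.pinit σ) = (σ, Finset.univ) ∧ 𝒜.preWord u σ = 𝒜.typ w := by
  obtain ⟨σ, hσ⟩ := Finite.exists_infinite_fiber fun i => 𝒜.typ (w.drop i)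
  have hσ' : ∀ N, ∃ i > N, 𝒜.typ (w.drop i) = σ := by
    intro N
    obtain ⟨i, hi, hN⟩ := (Set.infinite_coe_iff.1 hσ).exists_gt N
    exact ⟨i, hN, hi⟩
  obtain ⟨i, -, hi⟩ := hσ' 0
  obtain ⟨M, hM⟩ := 𝒜.exists_progress_stable (w.drop i)
  obtain ⟨j, hj, hjσ⟩ := hσ' (i + M)
  have h1 : 𝒜.progress (w.drop i) (j - i) = (σ, Finset.univ) := by
    refine Prod.ext ((𝒜.progress_fst _ _).trans hi) ?_
    exact Finset.eq_univ_of_forall fun q =>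
      hM q (𝒜.exists_mem_progress _ q) _ (by omega)
  rw [progress, Stream'.drop_drop, show i + (j - i) = j by omega, hjσ] at h1
  refine ⟨σ, w.take i, (w.drop i).take (j - i), ?_, h1, ?_⟩
  · intro h
    have := congrArg List.length h
    rw [Stream'.length_take] at this
    simp at this; omega
  · rw [← hi, ← typ_append, Stream'.append_take_drop]

/-- The realised types. -/
theorem exists_typ_eq_iff {𝒜 : AltAut A Q} (h𝒜 : 𝒜.IsWeak) {τ : Finset Q} :
    (∃ w, 𝒜.typ w = τ) ↔ ∃ σ u v, v ≠ [] ∧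
      𝒜.pword v (𝒜.pinit σ) = (σ, Finset.univ) ∧ 𝒜.preWord u σ = τ := by
  constructor
  · rintro ⟨w, rfl⟩
    exact 𝒜.exists_loop w
  · rintro ⟨σ, u, v, hv, h, rfl⟩
    exact exists_typ_eq h𝒜 hv h

end AltAut

/-! ### The machine of suffix languages -/

/-- If `S` contains no clause entirely, picking from each clause an element outside `S` gives a dual
clause that `S` misses. -/
theorem PCNF.dual_satBy {X : Type} {φ : PCNF X} {S : Finset X} :
    φ.dual.SatBy S ↔ ∃ c ∈ φ.clauses, ∀ q ∈ c, q ∈ S := by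
  have key : ∀ l : List (List X), (∀ f ∈ l.sections, ∃ q ∈ f, q ∈ S) ↔
      ∃ c ∈ l, ∀ q ∈ c, q ∈ S := by
    intro l
    induction l with
    | nil => simp [List.sections]
    | cons c l ih =>
      constructor
      · intro h
        by_cases hc : ∀ q ∈ c, q ∈ S
        · exact ⟨c, List.mem_cons_self, hc⟩
        · push Not at hc
          obtain ⟨a, ha, haS⟩ := hc
          obtain ⟨d, hd, hdS⟩ := ih.1 fun f hf => by
            obtain ⟨q, hq, hqS⟩ := h (a :: f)
              (List.mem_sections.2 (.cons ha (List.mem_sections.1 hf)))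
            rcases List.mem_cons.1 hq with rfl | hq
            · exact absurd hqS haS
            · exact ⟨q, hq, hqS⟩
          exact ⟨d, List.mem_cons_of_mem _ hd, hdS⟩
      · rintro ⟨d, hd, hdS⟩ f hf
        obtain _ | ⟨hac, hf'⟩ := List.mem_sections.1 hf
        rename_i a f'
        rcases List.mem_cons.1 hd with rfl | hd
        · exact ⟨a, List.mem_cons_self, hdS _ hac⟩
        · obtain ⟨q, hq, hqS⟩ := ih.2 ⟨d, hd, hdS⟩ f' (List.mem_sections.2 hf')
          exact ⟨q, List.mem_cons_of_mem _ hq, hqS⟩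
  exact key φ.clauses

namespace NBW

variable {A V : Type}

/-- `reach` recurses on the first letter, whereas suffix languages evolve with the last one. -/
theorem mem_reach_concat (G : NBW A V) (u v : V) (p : List A) (x : A) :
    v ∈ G.reach u (p ++ [x]) ↔ ∃ v' ∈ G.reach u p, v ∈ G.trans v' x := by
  induction p generalizing u with
  | nil => simp [reach]
  | cons y p ih =>
    simp only [List.cons_append, reach, Set.mem_ofPred_eq, ih]
    constructor
    · rintro ⟨a, ha, b, hb, h⟩
      exact ⟨b, ⟨a, ha, hb⟩, h⟩
    · rintro ⟨b, ⟨a, ha, hb⟩, h⟩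
      exact ⟨a, ha, b, hb, h⟩

end NBW

/-! ### Obligation graphs, type sets and canonical machines -/

namespace AltAut

variable {A Q : Type} [Fintype Q] [DecidableEq Q]

theorem mem_obligationGraph_trans {𝒜 : AltAut A Q} {v v' : BPVertex Q} {x : A} :
    v' ∈ 𝒜.obligationGraph.trans v x ↔ ∃ S X : Finset Q, X ⊆ S ∧
      (∀ q ∈ v.1 ∪ v.2, ∃ c ∈ (𝒜.δ q x).clauses, ∀ r ∈ c, r ∈ S) ∧
      (v.1 = ∅ → X = S) ∧
      (v.1 ≠ ∅ → ∀ q ∈ v.1, ∃ c ∈ (𝒜.δ q x).clauses, ∀ r ∈ c, r ∈ X) ∧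
      v' = (X ∩ 𝒜.acc, S \ (X ∩ 𝒜.acc)) := by
  have h : ∀ X : Finset Q, X \ 𝒜.dual.acc = X ∩ 𝒜.acc := fun X => by
    ext q; simp [dual]
  have h' : ∀ q, (𝒜.dual.δ q x) = (𝒜.δ q x).dual := fun _ => rfl
  simp only [obligationGraph, miyanoHayashi, Set.mem_ofPred_eq, h, h', PCNF.dual_satBy]

/-- A run of the obligation graph describes choices by which the rejector confines the play to P ∪
R; hence it refutes every type disjoint from the final P ∪ R. -/
theorem notMem_preWord_of_mem_reach {𝒜 : AltAut A Q} {u v : BPVertex Q} {p : List A}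
    (h : v ∈ 𝒜.obligationGraph.reach u p) :
    ∀ q ∈ u.1 ∪ u.2, q ∉ 𝒜.preWord p (v.1 ∪ v.2)ᶜ := by
  induction p generalizing u with
  | nil =>
    obtain rfl : v = u := h
    intro q hq
    simpa [preWord, ← or_iff_not_imp_left] using hq
  | cons x p ih =>
    obtain ⟨v', hv', h⟩ := h
    have ih' := ih h
    obtain ⟨S, X, hXS, hS, -, -, rfl⟩ := mem_obligationGraph_trans.1 hv'
    intro q hq hq'
    obtain ⟨c, hc, hcS⟩ := hS q hq
    change q ∈ 𝒜.pre x (𝒜.preWord p (v.1 ∪ v.2)ᶜ) at hq'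
    obtain ⟨r, hr, hr'⟩ := mem_pre.1 hq' c hc
    refine ih' r ?_ hr'
    have := hcS r hr
    simp only [Finset.mem_union, Finset.mem_sdiff]
    tauto

/-- The run takes for S the complement of the propagated type, and X = S, which is allowed whether
or not P is empty. The word must be non-empty, as the start vertex cannot be chosen. -/
theorem exists_mem_reach {𝒜 : AltAut A Q} {u : BPVertex Q} {p : List A} (hp : p ≠ [])
    {τ : Finset Q} (h : ∀ q ∈ u.1 ∪ u.2, q ∉ 𝒜.preWord p τ) :
    ∃ v ∈ 𝒜.obligationGraph.reach u p, v.1 ∪ v.2 = τᶜ := by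
  induction p generalizing u with
  | nil => exact absurd rfl hp
  | cons x p ih =>
    set S := (𝒜.preWord p τ)ᶜ with hS
    have hsat : ∀ q ∈ u.1 ∪ u.2, ∃ c ∈ (𝒜.δ q x).clauses, ∀ r ∈ c, r ∈ S := by
      intro q hq
      have h1 : ¬ (𝒜.δ q x).SatBy (𝒜.preWord p τ) := mt mem_pre.2 (h q hq)
      simpa [hS] using PCNF.not_satBy.1 h1
    have htr : (S ∩ 𝒜.acc, S \ (S ∩ 𝒜.acc)) ∈ 𝒜.obligationGraph.trans u x :=
      mem_obligationGraph_trans.2 ⟨S, S, Finset.Subset.refl S, hsat, fun _ => rfl,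
        fun _ q hq => hsat q (Finset.mem_union_left _ hq), rfl⟩
    have hun : S ∩ 𝒜.acc ∪ S \ (S ∩ 𝒜.acc) = S :=
      Finset.union_sdiff_of_subset Finset.inter_subset_left
    cases p with
    | nil => exact ⟨_, ⟨_, htr, rfl⟩, hun⟩
    | cons y p =>
      obtain ⟨v, hv, hvτ⟩ := ih (u := (S ∩ 𝒜.acc, S \ (S ∩ 𝒜.acc))) (List.cons_ne_nil y p)
        (fun q hq => by rw [hun, hS, Finset.mem_compl] at hq; exact hq)
      exact ⟨v, ⟨_, htr, hv⟩, hvτ⟩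

/-- The types of the words in the suffix language of a finite word. -/
noncomputable def after (𝒜 : AltAut A Q) (p : List A) : Finset (Finset Q) :=
  𝒜.types.filter fun τ => 𝒜.init ∈ 𝒜.preWord p τ

/-- The types of the words in a language after one more letter. -/
noncomputable def next (𝒜 : AltAut A Q) (Θ : Finset (Finset Q)) (x : A) : Finset (Finset Q) :=
  𝒜.types.filter fun τ => 𝒜.pre x τ ∈ Θ

/-- The words with types in a given set. -/
def langOf (𝒜 : AltAut A Q) (Θ : Finset (Finset Q)) : Set (Stream' A) := {w | 𝒜.typ w ∈ Θ}

/-- The vertices of the obligation graph reached by the finite words with a given suffix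
language. -/
def vertsOf (𝒜 : AltAut A Q) (Θ : Finset (Finset Q)) : Set (BPVertex Q) :=
  {v | ∃ p, 𝒜.after p = Θ ∧ v ∈ 𝒜.obligationGraph.reach (∅, {𝒜.init}) p}

theorem mem_after {𝒜 : AltAut A Q} {p : List A} {τ : Finset Q} :
    τ ∈ 𝒜.after p ↔ τ ∈ 𝒜.types ∧ 𝒜.init ∈ 𝒜.preWord p τ := Finset.mem_filter

theorem after_concat (𝒜 : AltAut A Q) (p : List A) (x : A) :
    𝒜.after (p ++ [x]) = 𝒜.next (𝒜.after p) x := by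
  ext τ
  rw [mem_after, next, Finset.mem_filter, mem_after, preWord_append]
  refine and_congr_right fun hτ => ?_
  obtain ⟨w, rfl⟩ := mem_types.1 hτ
  -- Realised types are closed under `pre`, so restricting to them loses nothing when a letter is
  -- read.
  have : 𝒜.pre x (𝒜.typ w) ∈ 𝒜.types := by
    rw [← typ_cons]; exact 𝒜.typ_mem_types _
  exact (and_iff_right this).symm

theorem suffixLang_eq (𝒜 : AltAut A Q) (p : List A) :
    suffixLang 𝒜.language p = 𝒜.langOf (𝒜.after p) := by
  ext w
  have : p ++ₛ w ∈ 𝒜.language ↔ 𝒜.init ∈ 𝒜.typ (p ++ₛ w) := mem_typ.symm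
  simp only [suffixLang, langOf, Set.mem_ofPred_eq, this, mem_after, typ_append]
  exact (and_iff_right (𝒜.typ_mem_types w)).symm

/-- Every type in question is the type of some word, which witnesses its membership. -/
theorem langOf_after_injective {𝒜 : AltAut A Q} {p p' : List A}
    (h : 𝒜.langOf (𝒜.after p) = 𝒜.langOf (𝒜.after p')) : 𝒜.after p = 𝒜.after p' := by
  ext τ
  by_cases hτ : τ ∈ 𝒜.types
  · obtain ⟨w, rfl⟩ := mem_types.1 hτ
    exact Set.ext_iff.1 h w
  · exact iff_of_false (fun h => hτ (mem_after.1 h).1) fun h => hτ (mem_after.1 h).1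

/-- A type excluded after `p'` is refuted by a vertex reached by `p'`; that vertex is also reached
by a word equivalent to `p`, so the type is excluded after `p`. This makes states identifiable by
their vertex sets alone. -/
theorem after_subset_of_vertsOf_subset {𝒜 : AltAut A Q} {p p' : List A}
    (h : 𝒜.vertsOf (𝒜.after p') ⊆ 𝒜.vertsOf (𝒜.after p)) : 𝒜.after p ⊆ 𝒜.after p' := by
  intro τ hτ
  by_contra hτ'
  have hτ'' : 𝒜.init ∉ 𝒜.preWord p' τ := fun h => hτ' (mem_after.2 ⟨(mem_after.1 hτ).1, h⟩)
  obtain ⟨v, hv, hvτ⟩ : ∃ v ∈ 𝒜.obligationGraph.reach (∅, {𝒜.init}) p', v.1 ∪ v.2 ⊆ τᶜ := by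
    cases p' with
    | nil => exact ⟨_, rfl, by simpa [preWord] using hτ''⟩
    | cons x p' =>
      obtain ⟨v, hv, hvτ⟩ := exists_mem_reach (𝒜 := 𝒜) (u := (∅, {𝒜.init}))
        (List.cons_ne_nil x p') (τ := τ) (by simpa using hτ'')
      exact ⟨v, hv, hvτ.subset⟩
  obtain ⟨p'', hp'', hr⟩ := h ⟨p', rfl, hv⟩
  rw [← hp''] at hτ
  refine notMem_preWord_of_mem_reach hr 𝒜.init (by simp) (𝒜.preWord_mono p'' ?_ (mem_after.1 hτ).2)
  rw [← compl_compl τ]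
  exact Finset.compl_subset_compl.2 hvτ

theorem after_eq_of_vertsOf_eq {𝒜 : AltAut A Q} {p p' : List A}
    (h : 𝒜.vertsOf (𝒜.after p) = 𝒜.vertsOf (𝒜.after p')) : 𝒜.after p = 𝒜.after p' :=
  (after_subset_of_vertsOf_subset h.superset).antisymm (after_subset_of_vertsOf_subset h.subset)

/-- By monotonicity of `preWord`, a type contained in an excluded type is excluded; so the type of
an accepted word has an element outside each excluded one. This is the conjunctive form of the
labels. -/
theorem mem_langOf_after {𝒜 : AltAut A Q} {p : List A} {w : Stream' A} :
    w ∈ 𝒜.langOf (𝒜.after p) ↔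
      ∀ ρ ∈ 𝒜.types, ρ ∉ 𝒜.after p → ∃ q, q ∉ ρ ∧ w ∈ (𝒜.withInit q).language := by
  have hmem : ∀ q, w ∈ (𝒜.withInit q).language ↔ q ∈ 𝒜.typ w := fun q => mem_typ.symm
  simp only [hmem]
  constructor
  · intro hw ρ hρ hρ'
    by_contra hno
    push Not at hno
    refine hρ' (mem_after.2 ⟨hρ, 𝒜.preWord_mono p (fun q hq => ?_) (mem_after.1 hw).2⟩)
    by_contra hq'
    exact hno q hq' hq
  · intro h
    by_contra hw
    obtain ⟨q, h1, h2⟩ := h _ (𝒜.typ_mem_types w) hw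
    exact h1 h2

end AltAut

/-- Type sets of suffix languages have distinct vertex sets, so the numbered machine can be carried
over to vertex sets along a bijection. -/
theorem SLTMTable.exists_canonicalSLTM {k n : ℕ} {𝒜 : AltAut (Fin k) (Fin n)}
    (T : SLTMTable k n) (S : Fin T.numStates → Finset (Finset (Fin n)))
    (hinj : Function.Injective S) (hS : ∀ i, ∃ p, 𝒜.after p = S i)
    (hverts : ∀ i, T.vertexSet i = 𝒜.vertsOf (S i)) (hinit : S T.init = 𝒜.after [])
    (hstep : ∀ i x, S (T.step i x) = 𝒜.next (S i) x)
    (hlabel : ∀ i, 𝒜.labelLang (T.label i) = 𝒜.langOf (S i)) :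
    ∃ (QS : Set (Set (BPVertex (Fin n)))) (M : Moore (Fin k) QS (Set (Stream' (Fin k)))),
      IsCanonicalSLTM 𝒜 M ∧ T.Presents 𝒜 M := by
  have hvinj : Function.Injective fun i => 𝒜.vertsOf (S i) := by
    intro i j h
    obtain ⟨p, hp⟩ := hS i
    obtain ⟨p', hp'⟩ := hS j
    apply hinj
    simp only [← hp, ← hp'] at h ⊢
    exact AltAut.after_eq_of_vertsOf_eq h
  set e := Equiv.ofInjective _ hvinj
  have he : ∀ i, ((e i : Set.range fun i => 𝒜.vertsOf (S i)) : Set (BPVertex (Fin n))) =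
    𝒜.vertsOf (S i) := fun i => rfl
  set M : Moore (Fin k) (Set.range fun i => 𝒜.vertsOf (S i)) (Set (Stream' (Fin k))) :=
    ⟨e T.init, fun s x => e (T.step (e.symm s) x), fun s => 𝒜.langOf (S (e.symm s))⟩ with hM
  have hrun : ∀ p, S (e.symm (M.run p)) = 𝒜.after p := by
    intro p
    induction p using List.reverseRecOn with
    | nil => simpa [Moore.run, hM] using hinit
    | append_singleton p x ih =>
      have : M.run (p ++ [x]) = M.step (M.run p) x := by simp [Moore.run]
      rw [this, 𝒜.after_concat, ← ih, ← hstep]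
      simp [hM]
  refine ⟨_, M, ⟨⟨fun s => ?_, fun p => ?_⟩, fun s => ?_⟩, e, fun i => ?_, rfl, fun i x => ?_,
    fun i => ?_⟩
  · obtain ⟨p, hp⟩ := hS (e.symm s)
    exact ⟨p, by rw [𝒜.suffixLang_eq, hp]⟩
  · rw [𝒜.suffixLang_eq, ← hrun]
  · obtain ⟨i, rfl⟩ := e.surjective s
    have hout : M.out (e i) = 𝒜.langOf (S i) := by simp [hM]
    obtain ⟨p', hp'⟩ := hS i
    rw [he, hout, ← hp']
    ext v
    refine exists_congr fun p => and_congr ⟨fun h => ?_, fun h => ?_⟩ ?_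
    · rw [𝒜.suffixLang_eq, h]
    · rw [𝒜.suffixLang_eq] at h
      exact AltAut.langOf_after_injective h
    · exact ⟨fun h => ⟨_, rfl, h⟩, by rintro ⟨_, rfl, h⟩; exact h⟩
  · rw [he, hverts]
  · simp [hM]
  · rw [hlabel]; simp [hM]

/-! ### The algorithm -/

/-- Membership in a list of values. -/
noncomputable def memV (a : Val) (l : List Val) : Bool := l.any fun b => decide (a = b)

/-- As for most functions of the algorithm, polynomial time follows by applying the closure lemmas
along the structure of the definition. -/
theorem PTime.memV {a : Val → Val} {l : Val → List Val} (ha : PTime a) (hl : PTime l) :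
    PTime fun x => memV (a x) (l x) := by
  refine (PolyIn.app2 (F := fun a l => _root_.memV a l.toL) ?_ ha hl.ofL).congr_enc fun x => by simp
  unfold PTime2 _root_.memV
  repeat' with_reducible
    first
    | apply PTime.any | apply PTime.eq | apply PolyIn.toL | apply PolyIn.left
    | apply PolyIn.right | apply PTime.id

/-- Whether a coded formula is satisfied by a coded set. -/
noncomputable def satV (φ S : Val) : Bool := φ.toL.all fun c => c.toL.any fun q => memV q S.toL

theorem PTime.satV {φ S : Val → Val} (hφ : PTime φ) (hS : PTime S) :
    PTime fun x => satV (φ x) (S x) := by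
  refine PolyIn.app2 (F := _root_.satV) ?_ hφ hS
  unfold PTime2 _root_.satV
  repeat' with_reducible
    first
    | apply PTime.memV | apply PTime.any | apply PTime.all | apply PolyIn.toL
    | apply PolyIn.left | apply PolyIn.right | apply PTime.id

/-- Whether the dual of a coded formula is satisfied by a coded set. -/
noncomputable def dsatV (φ S : Val) : Bool := φ.toL.any fun c => c.toL.all fun q => memV q S.toL

theorem PTime.dsatV {φ S : Val → Val} (hφ : PTime φ) (hS : PTime S) :
    PTime fun x => dsatV (φ x) (S x) := by
  refine PolyIn.app2 (F := _root_.dsatV) ?_ hφ hS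
  unfold PTime2 _root_.dsatV
  repeat' with_reducible
    first
    | apply PTime.memV | apply PTime.any | apply PTime.all | apply PolyIn.toL
    | apply PolyIn.left | apply PolyIn.right | apply PTime.id

/-- The intersection of coded sets. -/
noncomputable def interV (a b : Val) : Val := ofL (a.toL.filter fun r => memV r b.toL)

theorem PTime.interV {a b : Val → Val} (ha : PTime a) (hb : PTime b) :
    PTime fun x => interV (a x) (b x) := by
  refine PolyIn.app2 (F := _root_.interV) ?_ ha hb
  unfold PTime2 _root_.interV
  repeat' with_reducible
    first
    | apply PTime.memV | apply PTime.filter | apply PolyIn.ofL | apply PolyIn.toL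
    | apply PolyIn.left | apply PolyIn.right | apply PTime.id

/-! The data derived from an automaton are kept in a value
`(subsets of states, states, letters, transition table, accepting states, initial state)`. -/

/-- The part of the data that is computed in polynomial time. -/
def baseV (x : Val) : Val :=
  .node (ofL x.left.range) <| .node (ofL x.right.left.range) <| .node x.right.right.right.left <|
    .node (ofL (x.left.range.filter fun q => (nth x.right.right.right.right q).isNode))
      x.right.right.left

theorem PTime.nth {l i : Val → Val} (hl : PTime l) (hi : PTime i) :
    PTime fun x => Val.nth (l x) (i x) := PolyIn.app2 PTime2.nth hl hi

theorem PTime.baseV : PTime baseV := by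
  unfold _root_.baseV
  repeat' with_reducible
    first
    | apply PTime.nth | apply PTime.range | apply PTime.filter | apply PolyIn.isNode
    | apply PolyIn.node | apply PolyIn.ofL | apply PolyIn.left | apply PolyIn.right
    | apply PTime.id

/-- The coded sets of states. -/
def subsetsV (g : Val) : List Val := g.left.toL

/-- The coded states. -/
def statesV (g : Val) : List Val := g.right.left.toL

/-- The coded letters. -/
def lettersV (g : Val) : List Val := g.right.right.left.toL

/-- The coded transition formula of a state for a letter. -/
def formulaV (g q x : Val) : Val := nth (nth g.right.right.right.left q) x

/-- The coded accepting set. -/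
def accV (g : Val) : Val := g.right.right.right.right.left

/-- The coded initial state. -/
def initV (g : Val) : Val := g.right.right.right.right.right

theorem PTime.subsetsV {g : Val → Val} (hg : PTime g) : PTime fun x => subsetsV (g x) :=
  hg.left.toL

theorem PTime.statesV {g : Val → Val} (hg : PTime g) : PTime fun x => statesV (g x) :=
  hg.right.left.toL

theorem PTime.lettersV {g : Val → Val} (hg : PTime g) : PTime fun x => lettersV (g x) :=
  hg.right.right.left.toL

theorem PTime.accV {g : Val → Val} (hg : PTime g) : PTime fun x => accV (g x) :=
  hg.right.right.right.right.left

theorem PTime.initV {g : Val → Val} (hg : PTime g) : PTime fun x => initV (g x) :=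
  hg.right.right.right.right.right

theorem PTime.formulaV {g q a : Val → Val} (hg : PTime g) (hq : PTime q) (ha : PTime a) :
    PTime fun x => formulaV (g x) (q x) (a x) :=
  PTime.nth (PTime.nth hg.right.right.right.left hq) ha

/-- The computation of `AltAut.pre`. -/
noncomputable def preV (g a τ : Val) : Val :=
  ofL ((statesV g).filter fun q => satV (formulaV g q a) τ)

theorem PTime.preV {g a τ : Val → Val} (hg : PTime g) (ha : PTime a) (hτ : PTime τ) :
    PTime fun x => preV (g x) (a x) (τ x) := by
  refine PolyIn.app3 (F := _root_.preV) ?_ hg ha hτ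
  unfold PTime3 _root_.preV
  repeat' with_reducible
    first
    | apply PTime.satV | apply PTime.formulaV | apply PTime.statesV | apply PTime.filter
    | apply PolyIn.ofL | apply PolyIn.left | apply PolyIn.right | apply PTime.id

/-- The computation of `AltAut.pstep`. -/
noncomputable def pstepV (g a z : Val) : Val :=
  .node (preV g a z.left) <| ofL <| (statesV g).filter fun q =>
    (memV q (preV g a z.left).toL == memV q (accV g).toL) ||
    (memV q (preV g a z.left).toL && satV (formulaV g q a) (interV z.right z.left) ||
    !memV q (preV g a z.left).toL && !satV (formulaV g q a)
      (ofL ((statesV g).filter fun r => memV r z.left.toL || !memV r z.right.toL)))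

theorem PTime.pstepV {g a z : Val → Val} (hg : PTime g) (ha : PTime a) (hz : PTime z) :
    PTime fun x => pstepV (g x) (a x) (z x) := by
  refine PolyIn.app3 (F := _root_.pstepV) ?_ hg ha hz
  unfold PTime3 _root_.pstepV
  repeat' with_reducible
    first
    | apply PTime.satV | apply PTime.formulaV | apply PTime.statesV | apply PTime.memV
    | apply PTime.preV | apply PTime.accV | apply PTime.interV | apply PTime.filter
    | apply PolyIn.and | apply PolyIn.or | apply PolyIn.not | apply PolyIn.iff
    | apply PolyIn.node | apply PolyIn.ofL | apply PolyIn.toL | apply PolyIn.left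
    | apply PolyIn.right | apply PTime.id

/-- The computation of `AltAut.pinit`. -/
noncomputable def pinitV (g σ : Val) : Val :=
  .node σ <| ofL <| (statesV g).filter fun q => memV q σ.toL == memV q (accV g).toL

theorem PTime.pinitV {g σ : Val → Val} (hg : PTime g) (hσ : PTime σ) :
    PTime fun x => pinitV (g x) (σ x) := by
  refine PolyIn.app2 (F := _root_.pinitV) ?_ hg hσ
  unfold PTime2 _root_.pinitV
  repeat' with_reducible
    first
    | apply PTime.memV | apply PTime.statesV | apply PTime.accV | apply PTime.filter
    | apply PolyIn.iff | apply PolyIn.node | apply PolyIn.ofL | apply PolyIn.toL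
    | apply PolyIn.left | apply PolyIn.right | apply PTime.id

/-- The pairs of coded sets of states. -/
def pairsV (g : Val) : List Val :=
  (subsetsV g).flatMap fun a => (subsetsV g).map fun b => Val.node a b

theorem PTime.pairsV {g : Val → Val} (hg : PTime g) : PTime fun x => pairsV (g x) := by
  refine PolyIn.comp (g := _root_.pairsV) ?_ hg
  unfold _root_.pairsV
  repeat' with_reducible
    first
    | apply PTime.subsetsV | apply PTime.flatMap | apply PTime.map | apply PolyIn.node
    | apply PolyIn.left | apply PolyIn.right | apply PTime.id

/-- The pairs reached from `pinit σ` by non-empty words. -/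
noncomputable def progressV (g σ : Val) : List Val :=
  reachList (pairsV g)
    (fun y => (lettersV g).any fun a => decide (y = pstepV g a (pinitV g σ)))
    (fun z y => (lettersV g).any fun a => decide (y = pstepV g a z))

theorem PTime.progressV {g σ : Val → Val} (hg : PTime g) (hσ : PTime σ) :
    PTime fun x => progressV (g x) (σ x) := by
  refine PolyIn.app2 (F := _root_.progressV) ?_ hg hσ
  unfold PTime2 _root_.progressV
  repeat' with_reducible
    first
    | apply PTime.pairsV | apply PTime.lettersV | apply PTime.pstepV | apply PTime.pinitV
    | apply PTime.reachList | apply PTime.any | apply PTime.eq | apply PolyIn.left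
    | apply PolyIn.right | apply PTime.id

/-- The computation of `AltAut.types`. -/
noncomputable def typesV (g : Val) : List Val :=
  (subsetsV g).filter fun τ => (subsetsV g).any fun σ =>
    memV (.node σ (ofL (statesV g))) (progressV g σ) &&
      (progressV g σ).any fun z => decide (z.left = τ)

theorem PTime.typesV : PTime typesV := by
  unfold _root_.typesV
  repeat' with_reducible
    first
    | apply PTime.subsetsV | apply PTime.statesV | apply PTime.memV | apply PTime.progressV
    | apply PTime.filter | apply PTime.any | apply PTime.eq | apply PolyIn.and
    | apply PolyIn.node | apply PolyIn.ofL | apply PolyIn.left | apply PolyIn.right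
    | apply PTime.id

/-! In the second part, the data are preceded by the list of all sets of types and by the list of
all types. -/

/-- The list of all coded sets of types. -/
def typeSetsV (h : Val) : List Val := h.left.toL

/-- The list of all coded types. -/
def typeListV (h : Val) : List Val := h.right.left.toL

theorem PTime.typeSetsV {h : Val → Val} (hh : PTime h) : PTime fun x => typeSetsV (h x) :=
  hh.left.toL

theorem PTime.typeListV {h : Val → Val} (hh : PTime h) : PTime fun x => typeListV (h x) :=
  hh.right.left.toL

/-- The computation of `AltAut.next`. -/
noncomputable def nextV (h Θ a : Val) : Val :=
  ofL ((typeListV h).filter fun τ => memV (preV h.right.right a τ) Θ.toL)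

theorem PTime.nextV {h Θ a : Val → Val} (hh : PTime h) (hΘ : PTime Θ) (ha : PTime a) :
    PTime fun x => nextV (h x) (Θ x) (a x) := by
  refine PolyIn.app3 (F := _root_.nextV) ?_ hh hΘ ha
  unfold PTime3 _root_.nextV
  repeat' with_reducible
    first
    | apply PTime.typeListV | apply PTime.memV | apply PTime.preV | apply PTime.filter
    | apply PolyIn.ofL | apply PolyIn.toL | apply PolyIn.left | apply PolyIn.right
    | apply PTime.id

/-- The types of the words in the language. -/
noncomputable def startV (h : Val) : Val :=
  ofL ((typeListV h).filter fun τ => memV (initV h.right.right) τ.toL)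

theorem PTime.startV {h : Val → Val} (hh : PTime h) : PTime fun x => startV (h x) := by
  refine PolyIn.comp (g := _root_.startV) ?_ hh
  unfold _root_.startV
  repeat' with_reducible
    first
    | apply PTime.typeListV | apply PTime.memV | apply PTime.initV | apply PTime.filter
    | apply PolyIn.ofL | apply PolyIn.toL | apply PolyIn.left | apply PolyIn.right
    | apply PTime.id

/-- Whether there is a transition between two vertices of the obligation graph. -/
noncomputable def transV (g v v' a : Val) : Bool :=
  (subsetsV g).any fun S => (subsetsV g).any fun X =>
    X.toL.all (fun q => memV q S.toL) &&
    ((v.left.toL ++ v.right.toL).all (fun q => dsatV (formulaV g q a) S) &&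
    ((bif v.left.isNode then v.left.toL.all fun q => dsatV (formulaV g q a) X
      else decide (X = S)) &&
    decide (v' = .node (interV X (accV g))
      (ofL (S.toL.filter fun q => !(memV q X.toL && memV q (accV g).toL))))))

theorem PTime.transV {g v v' a : Val → Val} (hg : PTime g) (hv : PTime v) (hv' : PTime v')
    (ha : PTime a) : PTime fun x => transV (g x) (v x) (v' x) (a x) := by
  refine PolyIn.app4 (F := _root_.transV) ?_ hg hv hv' ha
  unfold PTime4 _root_.transV
  repeat' with_reducible
    first
    | apply PTime.subsetsV | apply PTime.memV | apply PTime.dsatV | apply PTime.formulaV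
    | apply PTime.interV | apply PTime.accV | apply PTime.filter | apply PTime.any
    | apply PTime.all | apply PTime.append | apply PTime.eq | apply PolyIn.cond
    | apply PolyIn.isNode | apply PolyIn.and | apply PolyIn.not | apply PolyIn.node
    | apply PolyIn.ofL | apply PolyIn.toL | apply PolyIn.left | apply PolyIn.right
    | apply PTime.id

/-- The coded pairs of a suffix language and a vertex that are reached by the same word. -/
noncomputable def jointV (h : Val) : List Val :=
  reachList ((typeSetsV h).flatMap fun Θ => (pairsV h.right.right).map fun v => Val.node Θ v)
    (fun y => decide (y = .node (startV h)
      (.node .leaf (.node (initV h.right.right) .leaf))))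
    (fun z y => (lettersV h.right.right).any fun a =>
      decide (y.left = nextV h z.left a) && transV h.right.right z.right y.right a)

theorem PTime.jointV {h : Val → Val} (hh : PTime h) : PTime fun x => jointV (h x) := by
  refine PolyIn.comp (g := _root_.jointV) ?_ hh
  unfold _root_.jointV
  repeat' with_reducible
    first
    | apply PTime.typeSetsV | apply PTime.pairsV | apply PTime.startV | apply PTime.initV
    | apply PTime.lettersV | apply PTime.nextV | apply PTime.transV | apply PTime.reachList
    | apply PTime.flatMap | apply PTime.map | apply PTime.any | apply PTime.eq
    | apply PolyIn.and | apply PolyIn.node | apply PTime.leaf | apply PolyIn.left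
    | apply PolyIn.right | apply PTime.id

/-- The sets of types of suffix languages. -/
noncomputable def afterV (h : Val) : List Val :=
  (typeSetsV h).filter fun Θ => (pairsV h.right.right).any fun v => memV (.node Θ v) (jointV h)

theorem PTime.afterV {h : Val → Val} (hh : PTime h) : PTime fun x => afterV (h x) := by
  refine PolyIn.comp (g := _root_.afterV) ?_ hh
  unfold _root_.afterV
  repeat' with_reducible
    first
    | apply PTime.typeSetsV | apply PTime.pairsV | apply PTime.memV | apply PTime.jointV
    | apply PTime.filter | apply PTime.any | apply PolyIn.node | apply PolyIn.left
    | apply PolyIn.right | apply PTime.id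

/-- The coded canonical machine. -/
noncomputable def machineV (h : Val) : Val :=
  .node (ofL ((afterV h).map fun Θ =>
      ofL ((pairsV h.right.right).filter fun v => memV (.node Θ v) (jointV h)))) <|
  .node (idx (afterV h) (startV h)) <|
  .node (ofL ((afterV h).map fun Θ =>
      ofL ((lettersV h.right.right).map fun a => idx (afterV h) (nextV h Θ a))))
    (ofL ((afterV h).map fun Θ => ofL (((typeListV h).filter fun ρ => !memV ρ Θ.toL).map fun ρ =>
      ofL ((statesV h.right.right).filter fun q => !memV q ρ.toL))))

theorem PTime.machineV : PTime machineV := by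
  unfold _root_.machineV
  repeat' with_reducible
    first
    | apply PTime.afterV | apply PTime.pairsV | apply PTime.memV | apply PTime.jointV
    | apply PTime.idx | apply PTime.startV | apply PTime.lettersV | apply PTime.nextV
    | apply PTime.typeListV | apply PTime.statesV | apply PTime.filter | apply PTime.map
    | apply PolyIn.not | apply PolyIn.node | apply PolyIn.ofL | apply PolyIn.toL
    | apply PolyIn.left | apply PolyIn.right | apply PTime.id

/-! ### Coded subsets of a list -/

/-- Sets are coded by listing their elements in the order of a fixed repetition-free list, which
makes equality of sets the same as equality of codes. -/
theorem List.Sublist.filter_mem_eq {α : Type} [DecidableEq α] {s U : List α} (h : s.Sublist U)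
    (hU : U.Nodup) : U.filter (· ∈ s.toFinset) = s := by
  simp only [List.mem_toFinset]
  induction h with
  | slnil => rfl
  | @cons s U a h ih =>
    rw [List.nodup_cons] at hU
    have : a ∉ s := fun ha => hU.1 (h.subset ha)
    simpa [this] using ih hU.2
  | @cons_cons s U a h ih =>
    rw [List.nodup_cons] at hU
    rw [List.filter_cons_of_pos (by simp)]
    congr 1
    refine Eq.trans (List.filter_congr fun b hb => ?_) (ih hU.2)
    have : b ≠ a := fun h => hU.1 (h ▸ hb)
    simp [this]

/-- The list of the sets of entries of a list. -/
def List.powerList {α : Type} [DecidableEq α] (U : List α) : List (Finset α) :=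
  U.sublists'.map List.toFinset

/-- The coding of a set of entries of a list, given a coding of the entries. -/
def subsetCode {α : Type} [DecidableEq α] (U : List α) (e : α → Val) (s : Finset α) : Val :=
  ofL ((U.filter (· ∈ s)).map e)

section powerList

variable {α : Type} [DecidableEq α] {U : List α}

theorem List.mem_powerList {s : Finset α} :
    s ∈ U.powerList ↔ ∀ a ∈ s, a ∈ U := by
  simp only [List.powerList, List.mem_map, List.mem_sublists']
  constructor
  · rintro ⟨l, hl, rfl⟩ a ha
    exact hl.subset (List.mem_toFinset.1 ha)
  · intro h
    refine ⟨U.filter (· ∈ s), List.filter_sublist, ?_⟩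
    ext a
    simpa using h a

theorem List.nodup_powerList (hU : U.Nodup) : U.powerList.Nodup := by
  refine List.Nodup.map_on (fun s hs t ht h => ?_) (List.nodup_sublists'.2 hU)
  rw [← (List.mem_sublists'.1 hs).filter_mem_eq hU, h,
    (List.mem_sublists'.1 ht).filter_mem_eq hU]

theorem subs_map (hU : U.Nodup) (e : α → Val) :
    Val.subs (U.map e) = U.powerList.map (subsetCode U e) := by
  rw [subs_eq, List.sublists'_map, List.powerList, List.map_map, List.map_map]
  refine List.map_congr_left fun s hs => ?_
  rw [Function.comp_apply, Function.comp_apply, subsetCode,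
    (List.mem_sublists'.1 hs).filter_mem_eq hU]

variable {e : α → Val}

/-- A set computed by filtering the fixed enumeration is automatically in canonical coding. -/
theorem ofL_filter_map {p : Val → Bool} {s : Finset α}
    (h : ∀ a ∈ U, p (e a) = true ↔ a ∈ s) : ofL ((U.map e).filter p) = subsetCode U e s := by
  rw [subsetCode, List.filter_map]
  congr 2
  refine List.filter_congr fun a ha => ?_
  rw [Bool.eq_iff_iff, Function.comp_apply, h a ha, decide_eq_true_iff]

theorem memV_map (he : Function.Injective e) {l : List α} {a : α} :
    memV (e a) (l.map e) = true ↔ a ∈ l := by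
  simp [memV, he.eq_iff]

theorem memV_subsetCode (he : Function.Injective e) {s : Finset α} {a : α} (ha : a ∈ U) :
    memV (e a) (subsetCode U e s).toL = true ↔ a ∈ s := by
  rw [subsetCode, toL_ofL, memV_map he]
  simp [ha]

theorem subsetCode_inj (he : Function.Injective e) {s t : Finset α} (hs : ∀ a ∈ s, a ∈ U)
    (ht : ∀ a ∈ t, a ∈ U) : subsetCode U e s = subsetCode U e t ↔ s = t := by
  refine ⟨fun h => ?_, fun h => h ▸ rfl⟩
  ext a
  by_cases ha : a ∈ U
  · rw [← memV_subsetCode he ha, h, memV_subsetCode he ha]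
  · exact iff_of_false (fun h => ha (hs a h)) fun h => ha (ht a h)

theorem List.idxOf_map_of_inj {β : Type} [DecidableEq β] {f : α → β} {l : List α} {a : α}
    (h : ∀ b ∈ l, f b = f a → b = a) : (l.map f).idxOf (f a) = l.idxOf a := by
  induction l with
  | nil => rfl
  | cons b l ih =>
    have hb : (f b == f a) = (b == a) := by
      rw [Bool.eq_iff_iff, beq_iff_eq, beq_iff_eq]
      exact ⟨h b List.mem_cons_self, fun h => h ▸ rfl⟩
    rw [List.map_cons, List.idxOf_cons, List.idxOf_cons, hb,
      ih fun c hc => h c (List.mem_cons_of_mem _ hc)]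

end powerList

/-! ### Correctness of the algorithm -/

theorem Val.ofFin_injective {n : ℕ} : Function.Injective (Val.ofFin (n := n)) :=
  Val.ofNat_injective.comp Fin.val_injective

/-- The coding of a set of states. -/
abbrev setV {n : ℕ} : Finset (Fin n) → Val := subsetCode (List.finRange n) Val.ofFin

theorem setV_injective {n : ℕ} : Function.Injective (setV (n := n)) := fun _ _ h =>
  (subsetCode_inj Val.ofFin_injective (fun a _ => List.mem_finRange a)
    fun a _ => List.mem_finRange a).1 h

theorem memV_setV {n : ℕ} {s : Finset (Fin n)} {q : Fin n} :
    memV (ofFin q) (setV s).toL = true ↔ q ∈ s :=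
  memV_subsetCode Val.ofFin_injective (List.mem_finRange q)

theorem setV_toL {n : ℕ} (s : Finset (Fin n)) :
    (setV s).toL = ((List.finRange n).filter (· ∈ s)).map ofFin := by
  rw [setV, subsetCode, toL_ofL]

/-- The coding of a pair of sets of states. -/
def pairV {n : ℕ} (v : BPVertex (Fin n)) : Val := .node (setV v.1) (setV v.2)

theorem pairV_injective {n : ℕ} : Function.Injective (pairV (n := n)) := fun v v' h => by
  rw [pairV, pairV, Val.node.injEq, setV_injective.eq_iff, setV_injective.eq_iff] at h
  exact Prod.ext h.1 h.2

/-- The coding of a formula. -/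
def formulaCode {n : ℕ} (φ : PCNF (Fin n)) : Val := .ofList (.ofList .ofFin) φ.clauses

section formulas

variable {n : ℕ} {φ : PCNF (Fin n)} {S : Finset (Fin n)}

theorem satV_formulaCode : satV (formulaCode φ) (setV S) = true ↔ φ.SatBy S := by
  have h : ∀ q : Fin n, memV (ofFin q) (setV S).toL = true ↔ q ∈ S := fun q => memV_setV
  simp [satV, formulaCode, ofList_eq, List.all_eq_true, List.any_eq_true, PCNF.SatBy, h,
    -Bool.forall_bool]

theorem dsatV_formulaCode :
    dsatV (formulaCode φ) (setV S) = true ↔ ∃ c ∈ φ.clauses, ∀ q ∈ c, q ∈ S := by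
  have h : ∀ q : Fin n, memV (ofFin q) (setV S).toL = true ↔ q ∈ S := fun q => memV_setV
  simp [dsatV, formulaCode, ofList_eq, List.all_eq_true, List.any_eq_true, h]

theorem interV_setV (S T : Finset (Fin n)) : interV (setV S) (setV T) = setV (S ∩ T) := by
  rw [interV, setV_toL S, List.filter_map, List.filter_filter]
  refine congrArg (fun l => ofL (List.map ofFin l)) ?_
  refine List.filter_congr fun q _ => ?_
  rw [Bool.eq_iff_iff]
  have h : memV (ofFin q) (setV T).toL = true ↔ q ∈ T := memV_setV
  simp [h, and_comm]

end formulas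

namespace AltAut

variable {k n : ℕ} (𝒜 : AltAut (Fin k) (Fin n))

/-- The data derived from an automaton, without the list of the sets of states. -/
def base : Val := baseV 𝒜.code

/-- The data derived from an automaton. -/
def data : Val := .node (ofL (Val.subs 𝒜.base.left.toL)) 𝒜.base

theorem range_ofNat (m : ℕ) : (Val.ofNat m).range = (List.finRange m).map ofFin := by
  rw [Val.range_eq, toL_ofNat, List.length_replicate, ← List.map_coe_finRange_eq_range,
    List.map_map]
  rfl

theorem statesV_data : statesV 𝒜.data = (List.finRange n).map ofFin := by
  simp [statesV, data, base, baseV, code, range_ofNat]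

theorem lettersV_data : lettersV 𝒜.data = (List.finRange k).map ofFin := by
  simp [lettersV, data, base, baseV, code, range_ofNat]

theorem initV_data : initV 𝒜.data = ofFin 𝒜.init := by
  simp [initV, data, base, baseV, code]

theorem nth_ofTable {α : Type} {m : ℕ} (f : α → Val) (g : Fin m → α) (i : Fin m) :
    nth (ofTable f g) (ofFin i) = f (g i) := by
  rw [ofTable, ofList_eq, ofFin, nth_ofNat]
  simp

theorem formulaV_data (q : Fin n) (x : Fin k) :
    formulaV 𝒜.data (ofFin q) (ofFin x) = formulaCode (𝒜.δ q x) := by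
  simp [formulaV, data, base, baseV, code, nth_ofTable, formulaCode]

theorem accV_data : accV 𝒜.data = setV 𝒜.acc := by
  have : accV 𝒜.data = ofL (((List.finRange n).map ofFin).filter fun q =>
      (nth (ofTable Val.ofBool fun q => decide (q ∈ 𝒜.acc)) q).isNode) := by
    simp [accV, data, base, baseV, code, range_ofNat]
  rw [this]
  refine ofL_filter_map fun q _ => ?_
  rw [nth_ofTable]
  simp

theorem subsetsV_data : subsetsV 𝒜.data = (List.finRange n).powerList.map setV := by
  rw [← subs_map (List.nodup_finRange n), ← 𝒜.statesV_data]
  simp [subsetsV, data, statesV]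

theorem mem_powerList_finRange (s : Finset (Fin n)) : s ∈ (List.finRange n).powerList :=
  List.mem_powerList.2 fun a _ => List.mem_finRange a

theorem preV_data (x : Fin k) (τ : Finset (Fin n)) :
    preV 𝒜.data (ofFin x) (setV τ) = setV (𝒜.pre x τ) := by
  rw [preV, statesV_data]
  refine ofL_filter_map fun q _ => ?_
  rw [formulaV_data, satV_formulaCode, mem_pre]

theorem pstepV_data (x : Fin k) (z : BPVertex (Fin n)) :
    pstepV 𝒜.data (ofFin x) (pairV z) = pairV (𝒜.pstep x z) := by
  have hD : ofL ((statesV 𝒜.data).filter fun r =>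
      memV r (setV z.1).toL || !memV r (setV z.2).toL) = setV (z.1 ∪ z.2ᶜ) := by
    rw [statesV_data]
    refine ofL_filter_map fun q _ => ?_
    rw [Bool.or_eq_true, Bool.not_eq_true', ← Bool.not_eq_true, memV_setV, memV_setV]
    simp
  simp only [pstepV, pairV, left_node, right_node, hD, preV_data, accV_data, interV_setV]
  refine congrArg₂ Val.node rfl ?_
  rw [statesV_data]
  refine ofL_filter_map fun q _ => ?_
  rw [formulaV_data, Bool.or_eq_true, Bool.or_eq_true, beq_iff_eq, Bool.eq_iff_iff,
    Bool.and_eq_true, Bool.and_eq_true, Bool.not_eq_true', Bool.not_eq_true', ← Bool.not_eq_true,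
    ← Bool.not_eq_true, memV_setV, memV_setV, satV_formulaCode, satV_formulaCode]
  simp [pstep]

theorem pinitV_data (σ : Finset (Fin n)) :
    pinitV 𝒜.data (setV σ) = pairV (𝒜.pinit σ) := by
  refine congrArg₂ Val.node rfl ?_
  rw [statesV_data, accV_data]
  refine ofL_filter_map fun q _ => ?_
  rw [beq_iff_eq, Bool.eq_iff_iff, memV_setV, memV_setV]
  simp [pinit]

/-- The list of the pairs of sets of states. -/
def pairs (n : ℕ) : List (BPVertex (Fin n)) :=
  (List.finRange n).powerList ×ˢ (List.finRange n).powerList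

theorem mem_pairs (v : BPVertex (Fin n)) : v ∈ pairs n :=
  List.mem_product.2 ⟨mem_powerList_finRange _, mem_powerList_finRange _⟩

theorem pairsV_data : pairsV 𝒜.data = (pairs n).map pairV := by
  have : pairs n = (List.finRange n).powerList.flatMap fun a =>
    (List.finRange n).powerList.map fun b => (a, b) := rfl
  rw [this, pairsV, subsetsV_data, List.map_flatMap, List.flatMap_map]
  simp only [List.map_map]
  rfl

theorem mem_progressV_data (σ : Finset (Fin n)) : ∃ l : List (BPVertex (Fin n)),
    progressV 𝒜.data (setV σ) = l.map pairV ∧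
    ∀ z, z ∈ l ↔ ∃ v ≠ [], 𝒜.pword v (𝒜.pinit σ) = z := by
  classical
  refine ⟨reachList (pairs n) (fun y => decide (∃ x, y = 𝒜.pstep x (𝒜.pinit σ)))
    (fun z y => decide (∃ x, y = 𝒜.pstep x z)), ?_, fun z => ?_⟩
  · rw [progressV, pairsV_data]
    refine reachList_map _ _ _ _ _ _ (fun y _ => ?_) fun z _ y _ => ?_
    · rw [Bool.eq_iff_iff, lettersV_data, pinitV_data, List.any_map, List.any_eq_true]
      simp [pstepV_data, pairV_injective.eq_iff]
    · rw [Bool.eq_iff_iff, lettersV_data, List.any_map, List.any_eq_true]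
      simp [pstepV_data, pairV_injective.eq_iff]
  · rw [mem_reachList (fun a _ => mem_pairs a) fun _ b _ => mem_pairs b]
    simp only [decide_eq_true_iff]
    constructor
    · intro h
      induction h with
      | base h =>
        obtain ⟨x, rfl⟩ := h
        exact ⟨[x], by simp, rfl⟩
      | step _ h ih =>
        obtain ⟨x, rfl⟩ := h
        obtain ⟨v, -, rfl⟩ := ih
        -- Propagation runs backwards, so an edge of the search prepends a letter.
        exact ⟨x :: v, by simp, rfl⟩
    · rintro ⟨v, hv, rfl⟩
      induction v with
      | nil => exact absurd rfl hv
      | cons x v ih =>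
        cases v with
        | nil => exact .base ⟨x, rfl⟩
        | cons y v => exact .step (ih (by simp)) ⟨x, rfl⟩

/-- The list of the realised types. -/
noncomputable def typeList : List (Finset (Fin n)) :=
  (List.finRange n).powerList.filter (· ∈ 𝒜.types)

theorem mem_typeList {τ : Finset (Fin n)} : τ ∈ 𝒜.typeList ↔ τ ∈ 𝒜.types := by
  simp [typeList, mem_powerList_finRange]

theorem nodup_typeList : 𝒜.typeList.Nodup :=
  (List.nodup_powerList (List.nodup_finRange n)).filter _

variable {𝒜}

theorem typesV_data (h𝒜 : 𝒜.IsWeak) : typesV 𝒜.data = 𝒜.typeList.map setV := by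
  rw [typesV, subsetsV_data, typeList, List.filter_map]
  congr 1
  refine List.filter_congr fun τ _ => ?_
  rw [Bool.eq_iff_iff, Function.comp_apply, List.any_map, List.any_eq_true, decide_eq_true_iff,
    mem_types, exists_typ_eq_iff h𝒜]
  have huniv : ofL (statesV 𝒜.data) = setV (Finset.univ : Finset (Fin n)) := by
    rw [statesV_data, setV, subsetCode]; simp
  constructor
  · rintro ⟨σ, -, h⟩
    obtain ⟨l, hl, hmem⟩ := 𝒜.mem_progressV_data σ
    rw [Function.comp_apply, huniv, hl, Bool.and_eq_true,
      show (setV σ).node (setV Finset.univ) = pairV (σ, Finset.univ) from rfl,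
      memV_map pairV_injective, List.any_map, List.any_eq_true] at h
    obtain ⟨h1, z, hz, h2⟩ := h
    obtain ⟨v, hv, hvz⟩ := (hmem _).1 h1
    obtain ⟨u, hu, rfl⟩ := (hmem _).1 hz
    refine ⟨σ, u, v, hv, hvz, ?_⟩
    have h3 := setV_injective (of_decide_eq_true h2)
    rwa [pword_fst] at h3
  · rintro ⟨σ, u, v, hv, hvz, rfl⟩
    obtain ⟨l, hl, hmem⟩ := 𝒜.mem_progressV_data σ
    refine ⟨σ, mem_powerList_finRange σ, ?_⟩
    rw [Function.comp_apply, huniv, hl, Bool.and_eq_true,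
      show (setV σ).node (setV Finset.univ) = pairV (σ, Finset.univ) from rfl,
      memV_map pairV_injective, List.any_map, List.any_eq_true]
    -- The stem `u` may be empty while the search lists non-empty words only; appending `v` repairs
    -- this and leaves the type unchanged, since `v` takes σ to σ.
    refine ⟨(hmem _).2 ⟨v, hv, hvz⟩, 𝒜.pword (u ++ v) (𝒜.pinit σ),
      (hmem _).2 ⟨u ++ v, by simp [hv], rfl⟩, decide_eq_true ?_⟩
    change setV (𝒜.pword (u ++ v) (𝒜.pinit σ)).1 = _
    have h3 : 𝒜.preWord v σ = σ := by
      have := congrArg Prod.fst hvz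
      rwa [pword_fst] at this
    rw [pword_fst, preWord_append]
    change setV (𝒜.preWord u (𝒜.preWord v σ)) = _
    rw [h3]

end AltAut

/-! ### Correctness of the computed machine -/

theorem setV_empty {n : ℕ} : setV (∅ : Finset (Fin n)) = .leaf := by
  simp [setV, subsetCode]

theorem setV_singleton {n : ℕ} (q : Fin n) : setV {q} = .node (ofFin q) .leaf := by
  have := (List.singleton_sublist.2 (List.mem_finRange q)).filter_mem_eq (List.nodup_finRange n)
  rw [List.toFinset_cons, List.toFinset_nil, insert_empty_eq] at this
  rw [setV, subsetCode, this]; rfl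

theorem isNode_setV {n : ℕ} {s : Finset (Fin n)} : (setV s).isNode = true ↔ s ≠ ∅ := by
  constructor
  · rintro h rfl
    rw [setV_empty] at h
    simp at h
  · intro h
    have : setV s ≠ .leaf := fun h' => h (setV_injective (h'.trans setV_empty.symm))
    cases hs : setV s with
    | leaf => exact absurd hs this
    | node a b => rfl

theorem all_toL_setV {n : ℕ} {s : Finset (Fin n)} {p : Val → Bool} :
    (setV s).toL.all p = true ↔ ∀ q ∈ s, p (ofFin q) = true := by
  simp only [setV_toL, List.all_eq_true, List.mem_map, List.mem_filter, List.mem_finRange,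
    true_and, decide_eq_true_iff]
  exact ⟨fun h q hq => h _ ⟨q, hq, rfl⟩, fun h _ ⟨q, hq, e⟩ => e ▸ h q hq⟩

namespace AltAut

/-- The full set of states is always a legal choice of S and X. Hence every suffix language owns a
vertex and is found by searching the product with the graph. -/
theorem exists_mem_reach_obligationGraph {A Q : Type} [Fintype Q] [DecidableEq Q]
    (𝒜 : AltAut A Q) (u : BPVertex Q) (p : List A) : ∃ v, v ∈ 𝒜.obligationGraph.reach u p := by
  induction p generalizing u with
  | nil => exact ⟨u, rfl⟩
  | cons x p ih =>
    have hsat : ∀ q, ∃ c ∈ (𝒜.δ q x).clauses, ∀ r ∈ c, r ∈ Finset.univ := fun q => by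
      obtain ⟨c, hc⟩ := List.exists_mem_of_ne_nil _ (𝒜.δ q x).clauses_ne
      exact ⟨c, hc, fun r _ => Finset.mem_univ r⟩
    obtain ⟨v, hv⟩ := ih (Finset.univ ∩ 𝒜.acc, Finset.univ \ (Finset.univ ∩ 𝒜.acc))
    exact ⟨v, _, mem_obligationGraph_trans.2 ⟨Finset.univ, Finset.univ, Finset.Subset.refl _,
      fun q _ => hsat q, fun _ => rfl, fun _ q _ => hsat q, rfl⟩, hv⟩

variable {k n : ℕ} {𝒜 : AltAut (Fin k) (Fin n)}

theorem transV_data {v v' : BPVertex (Fin n)} {x : Fin k} :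
    transV 𝒜.data (pairV v) (pairV v') (ofFin x) = true ↔ v' ∈ 𝒜.obligationGraph.trans v x := by
  have hdsat : ∀ (q : Fin n) S, dsatV (formulaV 𝒜.data (ofFin q) (ofFin x)) (setV S) = true ↔
      ∃ c ∈ (𝒜.δ q x).clauses, ∀ r ∈ c, r ∈ S := fun q S => by
    rw [formulaV_data, dsatV_formulaCode]
  have hdiff : ∀ S X : Finset (Fin n), ofL ((setV S).toL.filter fun q =>
      !(memV q (setV X).toL && memV q (setV 𝒜.acc).toL)) = setV (S \ (X ∩ 𝒜.acc)) := by
    intro S X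
    rw [setV_toL S, List.filter_map, List.filter_filter]
    refine congrArg (fun l => ofL (List.map ofFin l)) (List.filter_congr fun q _ => ?_)
    rw [Bool.eq_iff_iff, Function.comp_apply, Bool.and_eq_true, decide_eq_true_iff, Bool.not_eq_true', ← Bool.not_eq_true,
      Bool.and_eq_true, memV_setV, memV_setV, decide_eq_true_iff, Finset.mem_sdiff,
      Finset.mem_inter]
    tauto
  rw [mem_obligationGraph_trans, transV, subsetsV_data, List.any_map, List.any_eq_true]
  refine exists_congr fun S => (and_iff_right (mem_powerList_finRange S)).trans ?_
  rw [Function.comp_apply, List.any_map, List.any_eq_true]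
  refine exists_congr fun X => (and_iff_right (mem_powerList_finRange X)).trans ?_
  simp only [Function.comp_apply, pairV, left_node, right_node, accV_data, interV_setV, hdiff]
  rw [Bool.and_eq_true, Bool.and_eq_true, Bool.and_eq_true, List.all_append, Bool.and_eq_true,
    all_toL_setV, all_toL_setV, all_toL_setV, decide_eq_true_iff]
  simp only [memV_setV, hdsat]
  refine and_congr Iff.rfl (and_congr ?_ ?_)
  · simp only [Finset.mem_union]
    exact ⟨fun h q => Or.rec (h.1 q) (h.2 q), fun h => ⟨fun q hq => h q (Or.inl hq),
      fun q hq => h q (Or.inr hq)⟩⟩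
  · rw [← and_assoc]
    refine and_congr ?_ ?_
    · by_cases hv : v.1 = ∅
      · have : (setV v.1).isNode = false := by
          rw [← Bool.not_eq_true, isNode_setV]; simpa using hv
        rw [this, cond_false, decide_eq_true_iff, setV_injective.eq_iff]
        simp [hv]
      · rw [isNode_setV.2 hv, cond_true, all_toL_setV]
        simp only [hdsat]
        simp [hv]
    · rw [Val.node.injEq, setV_injective.eq_iff, setV_injective.eq_iff, Prod.ext_iff]

variable (𝒜) in
/-- The data derived from an automaton, with the lists of types and of sets of types. -/
noncomputable def fullData : Val :=
  .node (ofL (Val.subs (typesV 𝒜.data))) (.node (ofL (typesV 𝒜.data)) 𝒜.data)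

variable (𝒜) in
/-- The coding of a set of types. -/
noncomputable abbrev typeSetV : Finset (Finset (Fin n)) → Val := subsetCode 𝒜.typeList setV

theorem fullData_right_right : 𝒜.fullData.right.right = 𝒜.data := rfl

theorem typeSetV_inj {Θ Θ' : Finset (Finset (Fin n))} (h : Θ ⊆ 𝒜.types) (h' : Θ' ⊆ 𝒜.types) :
    𝒜.typeSetV Θ = 𝒜.typeSetV Θ' ↔ Θ = Θ' :=
  subsetCode_inj setV_injective (fun _ hτ => 𝒜.mem_typeList.2 (h hτ))
    fun _ hτ => 𝒜.mem_typeList.2 (h' hτ)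

theorem mem_powerList_typeList {Θ : Finset (Finset (Fin n))} :
    Θ ∈ 𝒜.typeList.powerList ↔ Θ ⊆ 𝒜.types := by
  rw [List.mem_powerList]
  simp only [mem_typeList]
  rfl

theorem after_subset (p : List (Fin k)) : 𝒜.after p ⊆ 𝒜.types := Finset.filter_subset _ _

theorem next_subset (Θ : Finset (Finset (Fin n))) (x : Fin k) : 𝒜.next Θ x ⊆ 𝒜.types :=
  Finset.filter_subset _ _

section

variable (h𝒜 : 𝒜.IsWeak)

include h𝒜

theorem typeListV_fullData : typeListV 𝒜.fullData = 𝒜.typeList.map setV := by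
  simp [typeListV, fullData, typesV_data h𝒜]

theorem typeSetsV_fullData : typeSetsV 𝒜.fullData = 𝒜.typeList.powerList.map 𝒜.typeSetV := by
  rw [← subs_map 𝒜.nodup_typeList]
  simp [typeSetsV, fullData, typesV_data h𝒜]

theorem nextV_fullData (Θ : Finset (Finset (Fin n))) (x : Fin k) :
    nextV 𝒜.fullData (𝒜.typeSetV Θ) (ofFin x) = 𝒜.typeSetV (𝒜.next Θ x) := by
  rw [nextV, typeListV_fullData h𝒜]
  refine ofL_filter_map fun τ hτ => ?_
  rw [mem_typeList] at hτ
  have hτ' : 𝒜.pre x τ ∈ 𝒜.typeList := by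
    obtain ⟨w, rfl⟩ := mem_types.1 hτ
    rw [← typ_cons, mem_typeList]
    exact 𝒜.typ_mem_types _
  change memV (preV 𝒜.data (ofFin x) (setV τ)) _ = true ↔ _
  rw [preV_data, memV_subsetCode setV_injective hτ', next, Finset.mem_filter, and_iff_right hτ]

theorem startV_fullData : startV 𝒜.fullData = 𝒜.typeSetV (𝒜.after []) := by
  rw [startV, typeListV_fullData h𝒜]
  refine ofL_filter_map fun τ hτ => ?_
  rw [mem_typeList] at hτ
  change memV (initV 𝒜.data) _ = true ↔ _
  rw [initV_data, memV_setV, mem_after, and_iff_right hτ]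
  rfl

/-- The search runs through the product of the deterministic machine of type sets with the
obligation graph; both components read the same word. -/
theorem mem_jointV_fullData : ∃ l : List (Finset (Finset (Fin n)) × BPVertex (Fin n)),
    jointV 𝒜.fullData = l.map (fun z => .node (𝒜.typeSetV z.1) (pairV z.2)) ∧
    ∀ z, z ∈ l ↔ z.2 ∈ 𝒜.vertsOf z.1 := by
  classical
  set U := 𝒜.typeList.powerList ×ˢ pairs n with hU
  have memU : ∀ z, z ∈ U ↔ z.1 ⊆ 𝒜.types := fun z => by
    rw [hU, List.mem_product, mem_powerList_typeList, and_iff_left (mem_pairs z.2)]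
  refine ⟨reachList U (fun y => decide (y = (𝒜.after [], (∅, {𝒜.init}))))
    (fun z y => decide (∃ x, y.1 = 𝒜.next z.1 x ∧ y.2 ∈ 𝒜.obligationGraph.trans z.2 x)),
    ?_, fun z => ?_⟩
  · have hl : ((typeSetsV 𝒜.fullData).flatMap fun Θ =>
        (pairsV 𝒜.fullData.right.right).map fun v => Val.node Θ v) =
        U.map fun z => .node (𝒜.typeSetV z.1) (pairV z.2) := by
      have : U = 𝒜.typeList.powerList.flatMap fun a => (pairs n).map fun b => (a, b) := rfl
      rw [this, typeSetsV_fullData h𝒜, List.map_flatMap, List.flatMap_map]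
      change (𝒜.typeList.powerList.flatMap fun Θ => (pairsV 𝒜.data).map _) = _
      rw [pairsV_data]
      simp only [List.map_map]
      rfl
    rw [jointV, hl]
    refine reachList_map _ _ _ _ _ _ (fun y hy => ?_) fun z _ y hy => ?_
    · rw [decide_eq_decide, startV_fullData h𝒜]
      change _ = Val.node _ (Val.node _ (Val.node (initV 𝒜.data) _)) ↔ _
      rw [initV_data, ← setV_singleton, ← setV_empty (n := n), Val.node.injEq,
        typeSetV_inj ((memU y).1 hy) (after_subset _), Prod.ext_iff]
      exact and_congr_right fun _ => pairV_injective.eq_iff (b := (∅, {𝒜.init}))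
    · rw [Bool.eq_iff_iff, decide_eq_true_iff]
      change (lettersV 𝒜.data).any (fun a => decide (𝒜.typeSetV y.1 =
        nextV 𝒜.fullData (𝒜.typeSetV z.1) a) && transV 𝒜.data (pairV z.2) (pairV y.2) a) = true ↔ _
      rw [lettersV_data, List.any_map, List.any_eq_true]
      refine exists_congr fun x => (and_iff_right (List.mem_finRange x)).trans ?_
      rw [Function.comp_apply, Bool.and_eq_true, decide_eq_true_iff, nextV_fullData h𝒜,
        typeSetV_inj ((memU y).1 hy) (next_subset _ _), transV_data]
  · rw [mem_reachList (fun a ha => ?_) fun _ b hb => ?_]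
    · simp only [decide_eq_true_iff]
      constructor
      · intro h
        induction h with
        | base h => exact h ▸ ⟨[], rfl, rfl⟩
        | step _ h ih =>
          obtain ⟨x, h1, h2⟩ := h
          obtain ⟨p, hp, hv⟩ := ih
          exact ⟨p ++ [x], by rw [after_concat, hp, h1],
            (NBW.mem_reach_concat _ _ _ _ _).2 ⟨_, hv, h2⟩⟩
      · obtain ⟨Θ, v⟩ := z
        rintro ⟨p, hp, hv⟩
        simp only at hp hv
        subst hp
        induction p using List.reverseRecOn generalizing v with
        | nil =>
          obtain rfl : v = _ := hv
          exact .base rfl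
        | append_singleton p x ih =>
          obtain ⟨v', hv', h⟩ := (NBW.mem_reach_concat _ _ _ _ _).1 hv
          exact .step (ih v' hv') ⟨x, 𝒜.after_concat p x, h⟩
    · rw [memU, of_decide_eq_true ha]
      exact after_subset _
    · obtain ⟨x, h, -⟩ := of_decide_eq_true hb
      rw [memU, h]
      exact next_subset _ _

theorem memV_jointV_fullData {Θ : Finset (Finset (Fin n))} (hΘ : Θ ⊆ 𝒜.types)
    {v : BPVertex (Fin n)} :
    memV (.node (𝒜.typeSetV Θ) (pairV v)) (jointV 𝒜.fullData) = true ↔ v ∈ 𝒜.vertsOf Θ := by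
  obtain ⟨l, hl, hmem⟩ := mem_jointV_fullData h𝒜
  rw [hl, memV, List.any_map, List.any_eq_true, ← hmem (Θ, v)]
  constructor
  · rintro ⟨z, hz, h⟩
    have h' := of_decide_eq_true h
    obtain ⟨p, hp, -⟩ := (hmem z).1 hz
    rw [Val.node.injEq, typeSetV_inj hΘ (hp ▸ after_subset p), pairV_injective.eq_iff] at h'
    rwa [show (Θ, v) = z from Prod.ext h'.1 h'.2]
  · exact fun h => ⟨_, h, decide_eq_true rfl⟩

variable (𝒜) in
omit h𝒜 in
open Classical in
/-- The list of the sets of types of suffix languages. -/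
noncomputable def afterList : List (Finset (Finset (Fin n))) :=
  𝒜.typeList.powerList.filter fun Θ => ∃ p, 𝒜.after p = Θ

omit h𝒜 in
theorem mem_afterList {Θ : Finset (Finset (Fin n))} :
    Θ ∈ 𝒜.afterList ↔ ∃ p, 𝒜.after p = Θ := by
  classical
  rw [afterList, List.mem_filter, decide_eq_true_iff, mem_powerList_typeList]
  exact and_iff_right_of_imp fun ⟨p, hp⟩ => hp ▸ after_subset p

theorem afterV_fullData : afterV 𝒜.fullData = 𝒜.afterList.map 𝒜.typeSetV := by
  classical
  have hj : ∀ Θ ⊆ 𝒜.types, ∀ v : BPVertex (Fin n),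
      memV (.node (𝒜.typeSetV Θ) (pairV v)) (jointV 𝒜.fullData) = true ↔ v ∈ 𝒜.vertsOf Θ :=
    fun Θ hΘ v => memV_jointV_fullData h𝒜 hΘ
  rw [afterV, typeSetsV_fullData h𝒜, afterList, List.filter_map, fullData_right_right, pairsV_data]
  refine congrArg (List.map _) (List.filter_congr fun Θ hΘ => ?_)
  rw [mem_powerList_typeList] at hΘ
  rw [Function.comp_apply, Bool.eq_iff_iff, decide_eq_true_iff, List.any_map, List.any_eq_true]
  simp only [Function.comp_apply, hj Θ hΘ]
  constructor
  · rintro ⟨v, -, p, hp, -⟩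
    exact ⟨p, hp⟩
  · rintro ⟨p, hp⟩
    obtain ⟨v, hv⟩ := 𝒜.exists_mem_reach_obligationGraph (∅, {𝒜.init}) p
    exact ⟨v, mem_pairs v, p, hp, hv⟩

theorem idx_afterV {Θ : Finset (Finset (Fin n))} (hΘ : Θ ⊆ 𝒜.types) :
    Val.idx (afterV 𝒜.fullData) (𝒜.typeSetV Θ) = .ofNat (𝒜.afterList.idxOf Θ) := by
  rw [Val.idx_eq, afterV_fullData h𝒜, List.idxOf_map_of_inj]
  intro Θ' h' h
  obtain ⟨p, rfl⟩ := mem_afterList.1 h'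
  exact (typeSetV_inj (after_subset p) hΘ).1 h

end

/-- The list of the elements of a set of states. -/
def elems {n : ℕ} (s : Finset (Fin n)) : List (Fin n) := (List.finRange n).filter (· ∈ s)

theorem toFinset_elems (s : Finset (Fin n)) : (elems s).toFinset = s := by
  ext q; simp [elems]

theorem ofList_elems (s : Finset (Fin n)) : Val.ofList ofFin (elems s) = setV s :=
  ofList_eq _ _

theorem next_mem_afterList {Θ : Finset (Finset (Fin n))} (h : Θ ∈ 𝒜.afterList) (x : Fin k) :
    𝒜.next Θ x ∈ 𝒜.afterList := by
  obtain ⟨p, rfl⟩ := mem_afterList.1 h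
  exact mem_afterList.2 ⟨p ++ [x], 𝒜.after_concat p x⟩

variable (𝒜) in
open Classical in
/-- The canonical machine. -/
noncomputable def table : SLTMTable k n where
  numStates := 𝒜.afterList.length
  verts i := ((pairs n).filter (· ∈ 𝒜.vertsOf 𝒜.afterList[i])).map fun v => (elems v.1, elems v.2)
  init := ⟨𝒜.afterList.idxOf (𝒜.after []), List.idxOf_lt_length_of_mem (mem_afterList.2 ⟨[], rfl⟩)⟩
  step i x := ⟨𝒜.afterList.idxOf (𝒜.next 𝒜.afterList[i] x),
    List.idxOf_lt_length_of_mem (next_mem_afterList (List.getElem_mem _) x)⟩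
  -- No clause is empty, because the full set of states is fixed by `preWord` and so is never an
  -- excluded type. With no excluded types the label is the empty conjunction.
  label i := (𝒜.typeList.filter (· ∉ 𝒜.afterList[i])).map fun ρ => elems ρᶜ

theorem table_presents : ∃ (QS : Set (Set (BPVertex (Fin n))))
    (M : Moore (Fin k) QS (Set (Stream' (Fin k)))),
    IsCanonicalSLTM 𝒜 M ∧ 𝒜.table.Presents 𝒜 M := by
  classical
  have hnd : 𝒜.afterList.Nodup := (List.nodup_powerList 𝒜.nodup_typeList).filter _
  have hmem : ∀ i : Fin 𝒜.table.numStates, ∃ p, 𝒜.after p = 𝒜.afterList.get i := fun i =>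
    mem_afterList.1 (List.get_mem _ _)
  refine SLTMTable.exists_canonicalSLTM 𝒜.table (fun i => 𝒜.afterList.get i)
    (List.nodup_iff_injective_get.1 hnd) hmem (fun i => ?_) ?_ (fun i x => ?_) fun i => ?_
  · ext v
    simp only [SLTMTable.vertexSet, table, Set.mem_ofPred_eq, List.mem_map, List.mem_filter]
    constructor
    · rintro ⟨_, ⟨v', hv', rfl⟩, rfl⟩
      simp only [toFinset_elems]
      exact of_decide_eq_true hv'.2
    · intro h
      exact ⟨_, ⟨v, ⟨mem_pairs v, decide_eq_true h⟩, rfl⟩, by simp [toFinset_elems]⟩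
  · exact List.idxOf_get _
  · exact List.idxOf_get _
  · ext w
    obtain ⟨p, hp⟩ := hmem i
    rw [← hp, mem_langOf_after]
    simp only [labelLang, table, Set.mem_ofPred_eq, List.mem_map, List.mem_filter, mem_typeList]
    constructor
    · intro h ρ hρ hρ'
      obtain ⟨q, hq, hw⟩ := h _ ⟨ρ, ⟨hρ, decide_eq_true (by rw [hp] at hρ'; exact hρ')⟩, rfl⟩
      exact ⟨q, by simpa [elems] using hq, hw⟩
    · rintro h _ ⟨ρ, ⟨hρ, hρ'⟩, rfl⟩
      obtain ⟨q, hq, hw⟩ := h ρ hρ (by rw [hp]; exact of_decide_eq_true hρ')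
      exact ⟨q, by simpa [elems] using hq, hw⟩

theorem machineV_fullData (h𝒜 : 𝒜.IsWeak) : machineV 𝒜.fullData = 𝒜.table.code := by
  classical
  have htab : ∀ {β : Type} (f : β → Val) (F : Finset (Finset (Fin n)) → β),
      ofL (𝒜.afterList.map fun Θ => f (F Θ)) =
        ofTable f fun i : Fin 𝒜.afterList.length => F 𝒜.afterList[i] := by
    intro β f F
    rw [ofTable, ofList_eq, List.map_ofFn]
    exact congrArg ofL (List.ofFn_getElem_eq_map 𝒜.afterList fun Θ => f (F Θ)).symm
  have hsub : ∀ Θ ∈ 𝒜.afterList, Θ ⊆ 𝒜.types := fun Θ h => by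
    obtain ⟨p, rfl⟩ := mem_afterList.1 h
    exact after_subset p
  have hj : ∀ Θ ⊆ 𝒜.types, ∀ v : BPVertex (Fin n),
      memV (.node (𝒜.typeSetV Θ) (pairV v)) (jointV 𝒜.fullData) = true ↔ v ∈ 𝒜.vertsOf Θ :=
    fun Θ hΘ v => memV_jointV_fullData h𝒜 hΘ
  rw [machineV, SLTMTable.code, afterV_fullData h𝒜, List.map_map, List.map_map, List.map_map,
    fullData_right_right, pairsV_data, lettersV_data, statesV_data, typeListV_fullData h𝒜]
  refine congrArg₂ Val.node ?_ (congrArg₂ Val.node ?_ (congrArg₂ Val.node ?_ ?_))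
  · refine Eq.trans ?_ (htab _ fun Θ =>
      ((pairs n).filter (· ∈ 𝒜.vertsOf Θ)).map fun v => (elems v.1, elems v.2))
    refine congrArg ofL (List.map_congr_left fun Θ hΘ => ?_)
    rw [Function.comp_apply, ofList_eq, List.map_map, List.filter_map]
    have hc : ∀ v : BPVertex (Fin n), Val.node (Val.ofList ofFin (elems v.1))
        (Val.ofList ofFin (elems v.2)) = pairV v := fun v => by
      rw [ofList_elems, ofList_elems, pairV]
    have hf : (pairs n).filter ((fun v => memV (Val.node (𝒜.typeSetV Θ) v)
        (jointV 𝒜.fullData)) ∘ pairV) = (pairs n).filter (· ∈ 𝒜.vertsOf Θ) := by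
      refine List.filter_congr fun v _ => ?_
      rw [Bool.eq_iff_iff, decide_eq_true_iff, Function.comp_apply, hj Θ (hsub Θ hΘ)]
    rw [hf]
    exact congrArg ofL (List.map_congr_left fun v _ => (hc v).symm)
  · rw [← afterV_fullData h𝒜, startV_fullData h𝒜, idx_afterV h𝒜 (after_subset _)]
    rfl
  · refine Eq.trans ?_ (htab id fun Θ =>
      ofL ((List.finRange k).map fun x => .ofNat (𝒜.afterList.idxOf (𝒜.next Θ x)))) |>.trans ?_
    · refine congrArg ofL (List.map_congr_left fun Θ hΘ => ?_)
      rw [Function.comp_apply, List.map_map, id]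
      refine congrArg ofL (List.map_congr_left fun x _ => ?_)
      rw [Function.comp_apply, ← afterV_fullData h𝒜, nextV_fullData h𝒜,
        idx_afterV h𝒜 (next_subset _ _)]
    · rw [ofTable, ofTable, ofList_eq, ofList_eq, List.map_ofFn, List.map_ofFn]
      refine congrArg ofL (congrArg List.ofFn (funext fun i => ?_))
      change ofL _ = ofTable ofFin (𝒜.table.step i)
      rw [ofTable, ofList_eq, List.map_ofFn, List.ofFn_eq_map]
      rfl
  · refine Eq.trans ?_ (htab _ fun Θ => (𝒜.typeList.filter (· ∉ Θ)).map fun ρ => elems ρᶜ)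
    refine congrArg ofL (List.map_congr_left fun Θ hΘ => ?_)
    rw [Function.comp_apply, List.filter_map, List.map_map, ofList_eq, List.map_map]
    have hf : 𝒜.typeList.filter ((fun ρ => !memV ρ (𝒜.typeSetV Θ).toL) ∘ setV) =
        𝒜.typeList.filter (· ∉ Θ) := by
      refine List.filter_congr fun ρ hρ => ?_
      rw [Bool.eq_iff_iff, decide_eq_true_iff, Function.comp_apply, Bool.not_eq_true',
        ← Bool.not_eq_true, memV_subsetCode setV_injective hρ]
    rw [hf]
    refine congrArg ofL (List.map_congr_left fun ρ _ => ?_)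
    rw [Function.comp_apply, Function.comp_apply, ofList_elems]
    refine ofL_filter_map fun q _ => ?_
    rw [Bool.not_eq_true', ← Bool.not_eq_true, memV_setV, Finset.mem_compl]

end AltAut

/-! ### The running time -/

theorem PolyIn.mono {β : Type} [Enc β] {B B' : Val → ℕ} {f : Val → β} (hf : PolyIn B f)
    (h : ∀ x, B x ≤ B' x) : PolyIn B' f := by
  obtain ⟨p, q, hp⟩ := hf
  refine ⟨p, q, fun x => ?_⟩
  obtain ⟨t, ht, hle⟩ := hp x
  exact ⟨t, ht, hle.trans (q.evalNat_mono (h x))⟩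

theorem PolyIn.subs_comp {B : Val → ℕ} {l : Val → List Val} (hl : PolyIn B l)
    (hB : ∀ x, 2 ^ (l x).length ≤ B x) : PolyIn B fun x => Val.subs (l x) := by
  obtain ⟨r, hr⟩ := hl.exists_size_le
  have := PolyIn.comp_of_le PolyIn.subs hl.ofL (.X * (r + 2)) fun x => by
    have h := (hr x).2
    rw [enc_list] at h
    simp only [toL_ofL, Polynomial.eval_mul, Polynomial.eval_X, Polynomial.eval_add,
      Polynomial.eval_ofNat]
    gcongr
    exact hB x
  simpa only [toL_ofL] using this

/-- The data computed from a coded automaton. -/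
noncomputable def dataV (x : Val) : Val :=
  .node (ofL (Val.subs (baseV x).left.toL)) (baseV x)

/-- The data with the lists of types and of sets of types. -/
noncomputable def fullDataV (x : Val) : Val :=
  .node (ofL (Val.subs (typesV (dataV x)))) (.node (ofL (typesV (dataV x))) (dataV x))

theorem polyIn_dataV : PolyIn (fun x => 2 ^ x.left.toL.length + x.size) dataV := by
  have hb : PolyIn (fun x => 2 ^ x.left.toL.length + x.size) baseV :=
    PTime.baseV.mono fun x => Nat.le_add_left _ _
  refine (hb.left.toL.subs_comp fun x => ?_).ofL.node hb
  rw [baseV, left_node, toL_ofL, Val.range_eq]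
  simp

/-- The two exponential summands pay for the two power sets; everything else is polynomial in the
values already built. -/
theorem polyIn_machineV : PolyIn
    (fun x => 2 ^ (typesV (dataV x)).length + (2 ^ x.left.toL.length + x.size))
    fun x => machineV (fullDataV x) := by
  have hd := polyIn_dataV.mono
    (B' := fun x => 2 ^ (typesV (dataV x)).length + (2 ^ x.left.toL.length + x.size))
    fun x => Nat.le_add_left _ _
  have ht := PTime.typesV.comp hd
  exact PTime.machineV.comp
    ((ht.subs_comp fun x => Nat.le_add_right _ _).ofL.node (ht.ofL.node hd))

theorem Polynomial.exists_evalNat_le_pow (p : Polynomial ℕ) :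
    ∃ d, ∀ m, 2 ≤ m → p.eval m ≤ m ^ d := by
  induction p using Polynomial.induction_on' with
  | add p q hp hq =>
    obtain ⟨d, hd⟩ := hp
    obtain ⟨e, he⟩ := hq
    -- The last factor `m` absorbs the 2 from adding two bounds.
    refine ⟨d + e + 1, fun m hm => ?_⟩
    have h1 := (hd m hm).trans (Nat.pow_le_pow_right (by omega) (Nat.le_add_right d e))
    have h2 := (he m hm).trans (Nat.pow_le_pow_right (by omega) (Nat.le_add_left e d))
    rw [Polynomial.eval_add, pow_succ]
    nlinarith
  | monomial i a =>
    -- The coefficient is absorbed through `a ≤ 2 ^ a ≤ m ^ a`.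
    refine ⟨a + i, fun m hm => ?_⟩
    rw [Polynomial.eval_monomial, pow_add]
    gcongr
    exact (Nat.lt_two_pow_self).le.trans (Nat.pow_le_pow_left hm a)

theorem Val.size_ofList_le {α : Type} {f : α → Val} {l : List α} {s : ℕ}
    (h : ∀ a ∈ l, (f a).size ≤ s) : (ofList f l).size ≤ l.length * (s + 1) + 1 := by
  induction l with
  | nil => simp [ofList, size]
  | cons a l ih =>
    have h1 := h a List.mem_cons_self
    have h2 := ih fun b hb => h b (List.mem_cons_of_mem _ hb)
    rw [ofList, size, List.length_cons, add_mul]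
    omega

theorem Val.size_ofTable_le {α : Type} {f : α → Val} {n s : ℕ} {g : Fin n → α}
    (h : ∀ i, (f (g i)).size ≤ s) : (ofTable f g).size ≤ n * (s + 1) + 1 := by
  refine (size_ofList_le (s := s) fun a ha => ?_).trans (by rw [List.length_ofFn])
  obtain ⟨i, rfl⟩ := (List.mem_ofFn' _ _).1 ha
  exact h i

theorem Val.size_ofFin_le {n : ℕ} (i : Fin n) : (ofFin i).size ≤ 2 * n := by
  rw [ofFin, size_ofNat]
  omega

/-- A literal with its list cell costs at most `2 * n + 1`; the overhead of 2 per clause is charged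
to one of its literals, which exists as clauses are non-empty. -/
theorem size_formulaCode_le {n : ℕ} (φ : PCNF (Fin n)) :
    (formulaCode φ).size ≤ φ.size * (2 * n + 3) + 1 := by
  have : ∀ l : List (List (Fin n)), (∀ c ∈ l, c ≠ []) →
      (ofList (ofList ofFin) l).size ≤ (l.map List.length).sum * (2 * n + 3) + 1 := by
    intro l hl
    induction l with
    | nil => simp [ofList, size]
    | cons c l ih =>
      have h1 := ih fun b hb => hl b (List.mem_cons_of_mem _ hb)
      have h2 := size_ofList_le (l := c) fun a _ => size_ofFin_le a
      have h3 := List.length_pos_iff.2 (hl c List.mem_cons_self)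
      rw [ofList, size, List.map_cons, List.sum_cons, add_mul]
      nlinarith
  exact this _ φ.clause_ne

/-! ### Numerical bounds -/

namespace AltAut

variable {k n : ℕ} {𝒜 : AltAut (Fin k) (Fin n)}

theorem size_code_le {c : ℕ} (hk : k ≤ 2 ^ (c * n)) (hδ : ∀ q x, (𝒜.δ q x).size ≤ 2 ^ (c * n)) :
    𝒜.code.size ≤ 2 ^ ((2 * c + 7) * n) := by
  have hn : 1 ≤ n := 𝒜.init.pos
  have h1 : ∀ q x, (formulaCode (𝒜.δ q x)).size ≤ 2 ^ (c * n) * (2 * n + 3) + 1 := fun q x =>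
    (size_formulaCode_le _).trans (by gcongr; exact hδ q x)
  have h2 : ∀ q, (ofTable formulaCode (𝒜.δ q)).size ≤ _ := fun q => size_ofTable_le (h1 q)
  have h3 : (ofTable (ofTable formulaCode) 𝒜.δ).size ≤ _ := size_ofTable_le h2
  have h4 : (ofTable Val.ofBool fun q => decide (q ∈ 𝒜.acc)).size ≤ n * (3 + 1) + 1 :=
    size_ofTable_le fun q => by cases decide (q ∈ 𝒜.acc) <;> simp [Val.ofBool, size]
  have h5 := size_ofFin_le 𝒜.init
  have h6 : 𝒜.code.size = (ofNat n).size + ((ofNat k).size + ((ofFin 𝒜.init).size +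
    ((ofTable (ofTable formulaCode) 𝒜.δ).size +
      (ofTable Val.ofBool fun q => decide (q ∈ 𝒜.acc)).size + 1) + 1) + 1) + 1 := rfl
  rw [size_ofNat, size_ofNat] at h6
  have hS : 1 ≤ 2 ^ (c * n) := Nat.one_le_two_pow
  -- The three factors stand for letters times formula size, for `n ^ 2`, and for the constant 32,
  -- which needs `n ≥ 1`.
  have h7 : 2 ^ ((2 * c + 7) * n) = (2 ^ (c * n)) ^ 2 * (2 ^ n) ^ 2 * (2 ^ n) ^ 5 := by ring
  have h8 : 32 ≤ (2 ^ n) ^ 5 := by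
    have : 2 ^ 1 ≤ 2 ^ n := Nat.pow_le_pow_right (by omega) hn
    exact Nat.pow_le_pow_left this 5
  have h9 : n ≤ 2 ^ n := Nat.lt_two_pow_self.le
  generalize 2 ^ (c * n) = S at *
  generalize 2 ^ n = N at *
  have a1 : S * (2 * n + 3) + 1 + 1 ≤ 7 * (S * n) := by nlinarith
  have a2 : k * (S * (2 * n + 3) + 1 + 1) + 1 + 1 ≤ 9 * (S ^ 2 * n) := by
    have : k * (S * (2 * n + 3) + 1 + 1) ≤ S * (7 * (S * n)) := Nat.mul_le_mul hk a1
    have : 1 ≤ S ^ 2 * n := Nat.mul_pos (by positivity) hn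
    nlinarith
  have a3 : n * (k * (S * (2 * n + 3) + 1 + 1) + 1 + 1) + 1 ≤ 10 * (S ^ 2 * n ^ 2) := by
    have : n * (k * (S * (2 * n + 3) + 1 + 1) + 1 + 1) ≤ n * (9 * (S ^ 2 * n)) :=
      Nat.mul_le_mul le_rfl a2
    have : 1 ≤ S ^ 2 * n ^ 2 := Nat.mul_pos (by positivity) (by positivity)
    nlinarith
  have a4 : 𝒜.code.size ≤ 32 * (S ^ 2 * n ^ 2) := by
    have b1 : n ≤ S ^ 2 * n ^ 2 := by 
      nlinarith [Nat.mul_le_mul (Nat.pow_le_pow_left hS 2) (Nat.mul_le_mul hn (le_refl n))]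
    have b2 : k ≤ S ^ 2 * n ^ 2 := by
      nlinarith [Nat.mul_le_mul (Nat.mul_le_mul hk hS) (Nat.mul_le_mul hn hn)]
    omega
  calc 𝒜.code.size ≤ S ^ 2 * n ^ 2 * 32 := by omega
    _ ≤ S ^ 2 * N ^ 2 * N ^ 5 := by gcongr
    _ = _ := h7.symm

theorem dataV_code : dataV 𝒜.code = 𝒜.data := rfl

theorem fullDataV_code : fullDataV 𝒜.code = 𝒜.fullData := rfl

theorem length_typesV_le (h𝒜 : 𝒜.IsWeak) : (typesV 𝒜.data).length ≤ 2 ^ n := by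
  rw [typesV_data h𝒜, List.length_map]
  refine (List.length_filter_le _ _).trans ?_
  rw [List.powerList, List.length_map, List.length_sublists', List.length_finRange]

theorem bound_le {c : ℕ} (h𝒜 : 𝒜.IsWeak) (hk : k ≤ 2 ^ (c * n))
    (hδ : ∀ q x, (𝒜.δ q x).size ≤ 2 ^ (c * n)) :
    2 ^ (typesV (dataV 𝒜.code)).length + (2 ^ 𝒜.code.left.toL.length + 𝒜.code.size) ≤
      2 ^ (2 ^ ((2 * c + 8) * n)) := by
  have hn : 1 ≤ n := 𝒜.init.pos
  have h1 : 𝒜.code.left.toL.length = n := by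
    rw [code, left_node, toL_ofNat, List.length_replicate]
  have h2 := size_code_le hk hδ
  have h3 : n ≤ (2 * c + 7) * n := Nat.le_mul_of_pos_left n (by omega)
  have h4 := Nat.pow_le_pow_right (n := 2) (by omega)
    ((length_typesV_le h𝒜).trans (Nat.pow_le_pow_right (n := 2) (by omega) h3))
  have h5 : (2 * c + 7) * n + 1 ≤ (2 * c + 8) * n := by nlinarith
  have h6 := Nat.pow_le_pow_right (n := 2) (by omega) h3
  rw [h1, dataV_code]
  refine le_trans ?_ (Nat.pow_le_pow_right (n := 2) (by omega)
    (Nat.pow_le_pow_right (n := 2) (by omega) h5))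
  generalize (2 * c + 7) * n = a at *
  have h7 : 2 ^ a ≤ 2 ^ 2 ^ a := Nat.pow_le_pow_right (by omega) Nat.lt_two_pow_self.le
  have h8 : 2 ≤ 2 ^ a := by
    calc 2 = 2 ^ 1 := rfl
      _ ≤ 2 ^ a := Nat.pow_le_pow_right (by omega) (by omega)
  have h9 : 2 ^ (2 ^ a + 2) ≤ 2 ^ 2 ^ (a + 1) :=
    Nat.pow_le_pow_right (by omega) (by rw [pow_succ]; omega)
  -- Each of the three summands is at most `2 ^ 2 ^ a`; the resulting factor, below 4, is absorbed
  -- by passing from `a` to `a + 1`.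
  rw [pow_add] at h9
  omega

end AltAut

theorem mainTheorem6 :
    ∃ prog : Prog, ∀ c : ℕ, ∃ C : ℕ, ∀ (k n : ℕ) (𝒜 : AltAut (Fin k) (Fin n)),
      𝒜.IsWeak → k ≤ 2 ^ (c * n) → (∀ q x, (𝒜.δ q x).size ≤ 2 ^ (c * n)) →
      ∃ (QS : Set (Set (BPVertex (Fin n)))) (M : Moore (Fin k) QS (Set (Stream' (Fin k))))
        (T : SLTMTable k n) (t : ℕ),
        IsCanonicalSLTM 𝒜 M ∧ T.Presents 𝒜 M ∧
        Run prog 𝒜.code T.code t ∧ t ≤ 2 ^ (2 ^ (C * n)) := by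
  obtain ⟨prog, p, hprog⟩ := polyIn_machineV
  obtain ⟨d, hd⟩ := p.exists_evalNat_le_pow
  -- Raising the bound `2 ^ 2 ^ ((2 * c + 8) * n)` to the power `d` multiplies the inner power by
  -- `d`, and `d ≤ 2 ^ (d * n)`.
  refine ⟨prog, fun c => ⟨2 * c + 8 + d, fun k n 𝒜 h𝒜 hk hδ => ?_⟩⟩
  obtain ⟨QS, M, hM, hT⟩ := 𝒜.table_presents
  obtain ⟨t, ht, hle⟩ := hprog 𝒜.code
  beta_reduce at ht hle
  rw [AltAut.fullDataV_code, AltAut.machineV_fullData h𝒜] at ht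
  refine ⟨QS, M, 𝒜.table, t, hM, hT, ht, hle.trans ?_⟩
  have hn : 1 ≤ n := 𝒜.init.pos
  refine (p.evalNat_mono (AltAut.bound_le h𝒜 hk hδ)).trans ?_
  refine (hd _ ?_).trans ?_
  · calc 2 = 2 ^ 1 := rfl
      _ ≤ _ := Nat.pow_le_pow_right (by omega) Nat.one_le_two_pow
  · rw [← pow_mul]
    refine Nat.pow_le_pow_right (by omega) ?_
    rw [add_mul _ d, pow_add]
    refine Nat.mul_le_mul le_rfl (Nat.lt_two_pow_self.le.trans ?_)
    exact Nat.pow_le_pow_right (by omega) (Nat.le_mul_of_pos_right d hn)
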